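/- Setting. Let $d$ be a fixed dimension and $\sigma:\mathbb R\to\mathbb R$ a $C_\sigma$-Lipschitz activation function. Let $(\Omega,\mathcal G,\{\mathcal G_t\}_{t\ge0},\mathrm P)$ be a filtered probability space, $T\ge3$, and \[ Y_t=m(X_t)+\eta(X_t)v_t,\qquad t=1,\dots,T, \] with $Y_t\in\mathbb R$, $X_t\in\mathbb R^d$, measurable $m,\eta:\mathbb R^d\to\mathbb R$ and $C_\eta=\sup_{x\in[0,1]^d}|\eta(x)|<\infty$. Put $f_0=m\mathbf 1_{[0,1]^d}$ and $\|f\|_\infty=\sup_{x\in[0,1]^d}|f(x)|$. Assume, for $t=1,\dots,T$: (i) $v_t$ is $\mathcal G_t$-measurable, $\mathrm E[v_t\mid\mathcal G_{t-1}]=0$, $\mathrm E[v_t^2\mid\mathcal G_{t-1}]=1$, and $\mathrm E[\exp(v_t^2/K_t^2)\mid\mathcal G_{t-1}]\le2$ for a constant $K_t>0$; put $K=\max_{1\le t\le T}K_t$. (ii) $X=\{X_t\}_{t=1}^T$ is exponentially $\beta$-mixing: $\beta_X(t)\le C_{1,\beta}e^{-C_{2,\beta}t}$ for all $t\ge1$,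 with constants $C_{1,\beta}$ and $C_{2,\beta}>0$. Here $\beta_X(t)=\sup_{1\le k\le T-t}\beta(\sigma(X_1,\dots,X_k),\sigma(X_{k+t},\dots,X_T))$ and $\beta(\mathcal A,\mathcal B)=\frac12\sup\sum_{i,j}|\mathrm P(A_i\cap B_j)-\mathrm P(A_i)\mathrm P(B_j)|$, the supremum being over finite partitions $\{A_i\}\subset\mathcal A$ and $\{B_j\}\subset\mathcal B$ of $\Omega$. (iii) $X_t$ is $\mathcal G_{t-1}$-measurable. For $L,N,B,F,S>0$ let $\mathcal F=\mathcal F_\sigma(L,N,B,F,S)$ be the set of functions $f\mathbf 1_{[0,1]^d}$, where $f=A_{\ell+1}\circ\sigma\circ A_\ell\circ\cdots\circ\sigma\circ A_1:\mathbb R^d\to\mathbb R$ is a neural network ($A_i$ affine, $\sigma$ applied componentwise) with $1\le\ell\le L$ hidden layers, hidden widths at most $N$, all weights and shifts at most $B$ in absolute value and at most $S$ of them non-zero, and $\|f\|_\infty\le F$. An estimator $\hat f_T$ is a random function on $\mathbb R^d$ such that $(\omega,x)\mapsto\hat f_T(\omega,x)$ is measurable for the product of the $\sigma$-field generated by $\{Y_t,X_t\}_{t=1}^T$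 and the Borel $\sigma$-field. Put $Q_T(f)=\frac1T\sum_{t=1}^T(Y_t-f(X_t))^2$ and \[ R(\hat f_T,f_0)=\mathrm E\Big[\frac1T\sum_{t=1}^T(\hat f_T(X^*_t)-f_0(X^*_t))^2\Big],\qquad \Psi_T^{\mathcal F}(\hat f_T)=\mathrm E\Big[Q_T(\hat f_T)-\inf_{f\in\mathcal F}Q_T(f)\Big], \] where $X^*$ is a copy of $X$ independent of the data $\{Y_t,X_t\}_{t=1}^T$. Theorem. Suppose (i)--(iii) hold, $F\ge1$, $B\ge1$ and $\|f_0\|_\infty\le F$, and let $\hat f_T$ be any estimator taking values in $\mathcal F=\mathcal F_\sigma(L,N,B,F,S)$. Then for any $\rho>1$ there is a constant $C_\rho$, depending only on $(C_\eta,C_{1,\beta},C_{2,\beta},K,\rho)$ and on $d$, $C_\sigma$ and $|\sigma(0)|$, such that \[ R(\hat f_T,f_0)\le\rho\Big(\Psi_T^{\mathcal F}(\hat f_T)+\inf_{f\in\mathcal F}R(f,f_0)\Big)+C_\rho F^2\,\frac{S(L+1)\log\big((L+1)(N+1)BT\big)(\log T)}{T}. \] -/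

import Mathlib

open MeasureTheory ProbabilityTheory
open scoped NNReal

noncomputable section

/-! ### Deep neural networks -/

/-- The parameters of a neural network with output dimension `m`, as a function of the input
dimension: either the last affine map `A_{L+1}`, given by a weight matrix and a shift vector, or
a first affine map `A_1` into `ℝ^p` (followed by the activation) and the remaining network. -/
inductive DNN (m : ℕ) : ℕ → Type
  | output {n : ℕ} (W : Matrix (Fin m) (Fin n) ℝ) (b : Fin m → ℝ) : DNN m n
  | layer {n : ℕ} (p : ℕ) (W : Matrix (Fin p) (Fin n) ℝ) (b : Fin p → ℝ) (g : DNN m p) : DNN m n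

namespace DNN

variable {m : ℕ}

/-- The function `A_{L+1} ∘ σ_L ∘ A_L ∘ ⋯ ∘ σ_1 ∘ A_1` realised by the network, where `σ_ℓ` is
the componentwise application of `σ`. -/
def eval (σ : ℝ → ℝ) : {n : ℕ} → DNN m n → (Fin n → ℝ) → (Fin m → ℝ)
  | _, output W b, x => W.mulVec x + b
  | _, layer _ W b g, x => g.eval σ (fun i => σ ((W.mulVec x + b) i))

/-- The widths `p_1, …, p_L` of the hidden layers. -/
def hiddenWidths : {n : ℕ} → DNN m n → List ℕ
  | _, output _ _ => []
  | _, layer p _ _ g => p :: g.hiddenWidths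

/-- The number `L` of hidden layers. -/
def depth {n : ℕ} (g : DNN m n) : ℕ := g.hiddenWidths.length

/-- The columns of a matrix, concatenated. -/
def vec {p n : ℕ} (W : Matrix (Fin p) (Fin n) ℝ) : List ℝ :=
  (List.finRange n).flatMap fun j => List.ofFn fun i => W i j

/-- The parameter vector `θ = (vec W_1, b_1, …, vec W_{L+1}, b_{L+1})`. -/
def theta : {n : ℕ} → DNN m n → List ℝ
  | _, output W b => vec W ++ List.ofFn b
  | _, layer _ W b g => vec W ++ List.ofFn b ++ g.theta

/-- The number `|θ|_0` of non-zero parameters. -/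
def sparsity {n : ℕ} (g : DNN m n) : ℕ := (g.theta.filter fun a => a ≠ 0).length

end DNN

/-- The unit cube `[0,1]^d`. -/
def unitCube (d : ℕ) : Set (Fin d → ℝ) := Set.Icc 0 1

/-- The class `F_σ(L,N,B,F,S)` of functions `f 1_{[0,1]^d}`, where `f` is realised by a network
with input dimension `d`, output dimension `1`, between `1` and `L` hidden layers, widths between
`1` and `N`, parameters bounded by `B` in absolute value of which at most `S` are non-zero, and
`|f| ≤ F` on `[0,1]^d`. -/
def sparseDNNClass (d : ℕ) (σ : ℝ → ℝ) (L N B F S : ℝ) : Set ((Fin d → ℝ) → ℝ) :=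
  {h | ∃ g : DNN 1 d,
    1 ≤ g.depth ∧ (g.depth : ℝ) ≤ L ∧
    (∀ p ∈ g.hiddenWidths, 1 ≤ p ∧ (p : ℝ) ≤ N) ∧
    (∀ a ∈ g.theta, |a| ≤ B) ∧
    (g.sparsity : ℝ) ≤ S ∧
    (∀ x ∈ unitCube d, |g.eval σ x 0| ≤ F) ∧
    h = (unitCube d).indicator (fun x => g.eval σ x 0)}

/-! ### β-mixing -/

section

variable {Ω : Type*} [mΩ : MeasurableSpace Ω]

/-- `A` is a finite partition of `Ω` into members of the σ-field `𝒜`. -/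
def IsFinPartition (𝒜 : MeasurableSpace Ω) {n : ℕ} (A : Fin n → Set Ω) : Prop :=
  (∀ i, MeasurableSet[𝒜] (A i)) ∧ Pairwise (fun i j => Disjoint (A i) (A j)) ∧
    (⋃ i, A i) = Set.univ

/-- The β-mixing coefficient between two σ-fields: half the supremum over finite partitions
`(A_i) ⊂ 𝒜`, `(B_j) ⊂ ℬ` of `∑_{i,j} |P(A_i ∩ B_j) - P(A_i) P(B_j)|`. -/
def betaCoeff (P : Measure Ω) (𝒜 ℬ : MeasurableSpace Ω) : ℝ :=
  (1 / 2) * sSup {s : ℝ | ∃ (n k : ℕ) (A : Fin n → Set Ω) (B : Fin k → Set Ω),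
    IsFinPartition 𝒜 A ∧ IsFinPartition ℬ B ∧
    s = ∑ i, ∑ j, |P.real (A i ∩ B j) - P.real (A i) * P.real (B j)|}

/-- The σ-field generated by `X_a, …, X_b`. -/
@[reducible] def sigmaBetween {E : Type*} [MeasurableSpace E] (X : ℕ → Ω → E) (a b : ℕ) : MeasurableSpace Ω :=
  ⨆ s ∈ Set.Icc a b, MeasurableSpace.comap (X s) inferInstance

/-- The β-mixing coefficient `β_X(t) = sup_k β(σ(X_1,…,X_k), σ(X_{k+t},…,X_T))` of the possibly
nonstationary process `X_1, …, X_T`; the supremum is over `1 ≤ k ≤ T - t` (and is `0` if there is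
no such `k`). -/
def betaMixing {E : Type*} [MeasurableSpace E] (P : Measure Ω) (T : ℕ) (X : ℕ → Ω → E)
    (t : ℕ) : ℝ :=
  sSup {b : ℝ | ∃ k : ℕ, 1 ≤ k ∧ k + t ≤ T ∧
    b = betaCoeff P (sigmaBetween X 1 k) (sigmaBetween X (k + t) T)}

/-! ### The regression model -/

/-- The model `Y_t = m(X_t) + η(X_t) v_t`, `1 ≤ t ≤ T`, with `|η| ≤ Cη` on `[0,1]^d`, noise `v`
that is adapted, conditionally centred with conditional variance `1` and conditionally
sub-Gaussian with constants `κ_t ≤ K`, and regressors `X` that are predictable and exponentially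
β-mixing. (Conditional expectations of non-integrable functions are `0` in Mathlib, so that the
integrability implied by the sub-Gaussian bound is written out.) -/
structure RegressionModel {d : ℕ} (P : Measure Ω) (𝒢 : Filtration ℕ mΩ) (T : ℕ)
    (X : ℕ → Ω → (Fin d → ℝ)) (v Y : ℕ → Ω → ℝ) (m η : (Fin d → ℝ) → ℝ)
    (Cη C₁ C₂ K : ℝ) : Prop where
  measurable_m : Measurable m
  measurable_η : Measurable η
  η_le : ∀ x ∈ unitCube d, |η x| ≤ Cη
  model : ∀ t ∈ Set.Icc 1 T, ∀ ω, Y t ω = m (X t ω) + η (X t ω) * v t ω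
  adapted : ∀ t ∈ Set.Icc 1 T, Measurable[𝒢 t] (v t)
  centred : ∀ t ∈ Set.Icc 1 T, P[v t | 𝒢 (t - 1)] =ᵐ[P] 0
  subGaussian : ∃ κ : ℕ → ℝ, ∀ t ∈ Set.Icc 1 T, 0 < κ t ∧ κ t ≤ K ∧
    Integrable (fun ω => Real.exp ((v t ω) ^ 2 / (κ t) ^ 2)) P ∧
    P[fun ω => Real.exp ((v t ω) ^ 2 / (κ t) ^ 2) | 𝒢 (t - 1)] ≤ᵐ[P] fun _ => 2
  variance : ∀ t ∈ Set.Icc 1 T, P[fun ω => (v t ω) ^ 2 | 𝒢 (t - 1)] =ᵐ[P] fun _ => 1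
  mixing : ∀ t : ℕ, 1 ≤ t → betaMixing P T X t ≤ C₁ * Real.exp (-C₂ * t)
  predictable : ∀ t ∈ Set.Icc 1 T, Measurable[𝒢 (t - 1)] (X t)

/-- `(ω, x) ↦ fhat ω x` is measurable for the product of the σ-field generated by
`(Y_t, X_t)`, `1 ≤ t ≤ T`, and the Borel σ-field of `ℝ^d`. -/
def IsEstimator {d : ℕ} (T : ℕ) (X : ℕ → Ω → (Fin d → ℝ)) (Y : ℕ → Ω → ℝ)
    (fhat : Ω → (Fin d → ℝ) → ℝ) : Prop :=
  @Measurable (Ω × (Fin d → ℝ)) ℝ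
    (MeasurableSpace.prod (sigmaBetween (fun t ω => (Y t ω, X t ω)) 1 T) inferInstance)
    inferInstance (fun p => fhat p.1 p.2)

/-- The generalization error `R(fhat, f₀) = E[T⁻¹ ∑_t (fhat(X*_t) - f₀(X*_t))²]`. The independent
copy `X*` of `X`, independent of the data, is realised on the product space `(Ω × Ω, P ⊗ P)` by
`X*_t (ω, ω') = X_t ω'`, while `fhat` depends on `ω`. -/
def genError {d : ℕ} (P : Measure Ω) (T : ℕ) (X : ℕ → Ω → (Fin d → ℝ))
    (fhat : Ω → (Fin d → ℝ) → ℝ) (f₀ : (Fin d → ℝ) → ℝ) : ℝ :=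
  ∫ p : Ω × Ω, (1 / (T : ℝ)) *
    ∑ t ∈ Finset.Icc 1 T, (fhat p.1 (X t p.2) - f₀ (X t p.2)) ^ 2 ∂(P.prod P)

/-- The empirical risk `Q_T(f) = T⁻¹ ∑_t (Y_t - f(X_t))²` at the sample point `ω`. -/
def empRisk {d : ℕ} (T : ℕ) (X : ℕ → Ω → (Fin d → ℝ)) (Y : ℕ → Ω → ℝ)
    (f : (Fin d → ℝ) → ℝ) (ω : Ω) : ℝ :=
  (1 / (T : ℝ)) * ∑ t ∈ Finset.Icc 1 T, (Y t ω - f (X t ω)) ^ 2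

/-- The expected optimization gap `Ψ_T^𝓕(fhat) = E[Q_T(fhat) - inf_{f ∈ 𝓕} Q_T(f)]`. -/
def optGap {d : ℕ} (P : Measure Ω) (T : ℕ) (X : ℕ → Ω → (Fin d → ℝ)) (Y : ℕ → Ω → ℝ)
    (𝓕 : Set ((Fin d → ℝ) → ℝ)) (fhat : Ω → (Fin d → ℝ) → ℝ) : ℝ :=
  ∫ ω, (empRisk T X Y (fhat ω) ω - ⨅ f : 𝓕, empRisk T X Y f ω) ∂P

end

end

/-! Let `a` be the expected cumulative squared error of `fhat` along the observed path. Expanding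
the squares in Q_T(fhat) - Q_T(f) (`mul_empRisk_sub_empRisk`) and taking expectations gives, for
each f in the class, a ≤ T Ψ + T R(f, f₀) + 2 E[noise term of fhat]: the noise term of a fixed f is
a sum of martingale differences, so it has mean zero. Two fluctuations remain: the noise term of the
data-dependent `fhat`, and the gap between `a` and the error on an independent path. Each is bounded
by a fraction x of a squared error plus a remainder proportional to the log-cardinality of a finite
cover. This self-bounding yields the rate 1/T up to logarithms; deviations measured on an absolute
scale would only give T^(-1/2).

Noise (`exists_integral_le_of_subGaussian`). For predictable weights the conditional sub-Gaussian
bound makes exp(Σ (a_t v_t - κ_t² a_t²)) a supermartingale. The logarithm of one plus the sum of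
these exponentials over the cover dominates all the exponents and has mean at most log(1 + card).
The quadratic compensator is a multiple of the squared error.

Independent path (`exists_integral_le_of_betaMixing`). Time is cut into blocks of length b of order
log T, treated separately for even and odd blocks. For independent blocks, e^(-y) ≤ 1 - (1 - x) y on
[0, x] gives a multiplicative lower-tail bound that needs no variance. Passing to the true law costs
the total variation distance between joint and product law, at most the number of blocks times twice
a mixing coefficient. The functions are first rounded to finitely many values, so that the
definition of β by finite partitions applies directly and no coupling is needed.

Entropy (`exists_log_card_cover_sparseDNNClass_le`). The realised function depends on the parameters
with a Lipschitz constant exponential in the depth. Rounding the parameters to a grid and recording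
the widths with the positions and values of the non-zero rounded entries gives a 1/T-cover of
logarithmic size S (L + 1) log((L + 1)(N + 1) B T).

The fluctuations together cost a factor (1 - x)², and x is chosen with ρ (1 - x)² ≥ 1. -/

namespace DNN

/-! ### Networks as functions of their parameters -/

variable {m n : ℕ}

/-- The network with `r` applied to all parameters. -/
def mapParams (r : ℝ → ℝ) : {n : ℕ} → DNN m n → DNN m n
  | _, output W b => output (W.map r) (fun i => r (b i))
  | _, layer p W b g => layer p (W.map r) (fun i => r (b i)) (g.mapParams r)

theorem hiddenWidths_mapParams (r : ℝ → ℝ) (g : DNN m n) :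
    (g.mapParams r).hiddenWidths = g.hiddenWidths := by
  induction g with
  | output W b => rfl
  | layer p W b g ih => simp [mapParams, hiddenWidths, ih]

theorem vec_map {p n : ℕ} (r : ℝ → ℝ) (W : Matrix (Fin p) (Fin n) ℝ) :
    vec (W.map r) = (vec W).map r := by
  simp [vec, List.map_flatMap, Function.comp_def]

theorem mem_vec {p n : ℕ} (W : Matrix (Fin p) (Fin n) ℝ) (i : Fin p) (j : Fin n) :
    W i j ∈ vec W := by
  simp only [vec, List.mem_flatMap, List.mem_finRange, true_and]
  exact ⟨j, List.mem_ofFn.2 ⟨i, rfl⟩⟩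

theorem length_vec {p n : ℕ} (W : Matrix (Fin p) (Fin n) ℝ) : (vec W).length = n * p := by
  simp [vec, List.length_flatMap]

theorem vec_injective {p n : ℕ} :
    Function.Injective (vec : Matrix (Fin p) (Fin n) ℝ → List ℝ) := by
  intro W W' h
  have key : ∀ l : List (Fin n), (l.flatMap fun j => List.ofFn fun i => W i j) =
      (l.flatMap fun j => List.ofFn fun i => W' i j) → ∀ j ∈ l, ∀ i, W i j = W' i j := by
    intro l
    induction l with
    | nil => simp
    | cons a l ih =>
      intro hl
      simp only [List.flatMap_cons] at hl
      obtain ⟨h1, h2⟩ := List.append_inj hl (by simp)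
      intro j hj i
      rcases List.mem_cons.1 hj with rfl | hj
      · exact congrFun (List.ofFn_injective h1) i
      · exact ih h2 j hj i
  ext i j
  exact key _ h j (List.mem_finRange j) i

theorem theta_mapParams (r : ℝ → ℝ) (g : DNN m n) : (g.mapParams r).theta = g.theta.map r := by
  induction g with
  | output W b => simp [mapParams, theta, vec_map, List.map_ofFn, Function.comp_def]
  | layer p W b g ih => simp [mapParams, theta, vec_map, List.map_ofFn, Function.comp_def, ih]

theorem length_theta_congr (g g' : DNN m n) (h : g.hiddenWidths = g'.hiddenWidths) :
    g.theta.length = g'.theta.length := by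
  induction g with
  | output W b =>
    cases g' with
    | output W' b' => simp [theta, length_vec]
    | layer p' W' b' g' => simp [hiddenWidths] at h
  | layer p W b g ih =>
    cases g' with
    | output W' b' => simp [hiddenWidths] at h
    | layer p' W' b' g' =>
      simp only [hiddenWidths, List.cons.injEq] at h
      obtain ⟨rfl, h⟩ := h
      simp [theta, length_vec, ih g' h]

/-- The widths fix the lengths of the segments of `theta`, so the concatenation can be cut in only
one way. This allows a rounded network to be recovered from its code. -/
theorem ext_theta (g g' : DNN m n) (h : g.hiddenWidths = g'.hiddenWidths)
    (hθ : g.theta = g'.theta) : g = g' := by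
  induction g with
  | output W b =>
    cases g' with
    | output W' b' =>
      obtain ⟨h1, h2⟩ := List.append_inj hθ (by simp [length_vec])
      rw [vec_injective h1, List.ofFn_injective h2]
    | layer p' W' b' g' => simp [hiddenWidths] at h
  | layer p W b g ih =>
    cases g' with
    | output W' b' => simp [hiddenWidths] at h
    | layer p' W' b' g' =>
      simp only [hiddenWidths, List.cons.injEq] at h
      obtain ⟨rfl, h⟩ := h
      obtain ⟨h1, h3⟩ := List.append_inj hθ (by simp [length_vec])
      obtain ⟨h1, h2⟩ := List.append_inj h1 (by simp [length_vec])
      rw [vec_injective h1, List.ofFn_injective h2, ih g' h h3]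

theorem length_theta_le {D : ℕ} (hm : m ≤ D) (g : DNN m n) (hn : n ≤ D)
    (hw : ∀ p ∈ g.hiddenWidths, p ≤ D) : g.theta.length ≤ (g.depth + 1) * (D * (D + 1)) := by
  induction g with
  | output W b =>
    simp only [theta, List.length_append, length_vec, List.length_ofFn, depth, hiddenWidths,
      List.length_nil, zero_add, one_mul]
    nlinarith
  | @layer n p W b g ih =>
    simp only [hiddenWidths, List.mem_cons, forall_eq_or_imp] at hw
    have := ih hw.1 hw.2
    simp only [theta, List.length_append, length_vec, List.length_ofFn, depth, hiddenWidths,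
      List.length_cons] at this ⊢
    have h1 : n * p ≤ D * D := Nat.mul_le_mul hn hw.1
    nlinarith [hw.1]

theorem abs_mulVec_add_le {p n : ℕ} {D : ℕ} {B R : ℝ} (hB : 0 ≤ B) (hR : 1 ≤ R) (hn : n ≤ D)
    (W : Matrix (Fin p) (Fin n) ℝ) (b : Fin p → ℝ) (hW : ∀ i j, |W i j| ≤ B)
    (hb : ∀ i, |b i| ≤ B) (x : Fin n → ℝ) (hx : ∀ i, |x i| ≤ R) (i : Fin p) :
    |(W.mulVec x + b) i| ≤ (D + 1) * B * R := by
  have h1 : |∑ j, W i j * x j| ≤ D * (B * R) := by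
    calc |∑ j, W i j * x j| ≤ ∑ j, |W i j * x j| := Finset.abs_sum_le_sum_abs _ _
      _ ≤ ∑ _j : Fin n, B * R := by
        refine Finset.sum_le_sum fun j _ => ?_
        rw [abs_mul]
        exact mul_le_mul (hW i j) (hx j) (abs_nonneg _) hB
      _ = n * (B * R) := by simp
      _ ≤ D * (B * R) := by gcongr
  have h2 : B ≤ B * R := le_mul_of_one_le_right hB hR
  calc |(W.mulVec x + b) i| ≤ |∑ j, W i j * x j| + |b i| := abs_add_le _ _
    _ ≤ D * (B * R) + B * R := add_le_add h1 ((hb i).trans h2)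
    _ = _ := by ring

/-- Each summand splits as (w - r w) x + r w (x - x'). Rounded weights are at most B + ε ≤ 2 B
because ε ≤ 1 ≤ B, whence the factor 2. -/
theorem abs_mulVec_add_sub_le {p n : ℕ} {D : ℕ} {B R ε e : ℝ} (hB : 1 ≤ B) (hR : 1 ≤ R)
    (hε : 0 ≤ ε) (hε1 : ε ≤ 1) (he : 0 ≤ e) (hn : n ≤ D)
    (W : Matrix (Fin p) (Fin n) ℝ) (b : Fin p → ℝ) (hW : ∀ i j, |W i j| ≤ B)
    {r : ℝ → ℝ} (hr : ∀ a, |a - r a| ≤ ε) (x x' : Fin n → ℝ) (hx : ∀ i, |x i| ≤ R)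
    (hxx : ∀ i, |x i - x' i| ≤ e) (i : Fin p) :
    |(W.mulVec x + b) i - ((W.map r).mulVec x' + fun i => r (b i)) i| ≤
      2 * (D + 1) * B * (e + ε * R) := by
  have h1 : |∑ j, (W i j * x j - r (W i j) * x' j)| ≤ D * (2 * B * (e + ε * R)) := by
    calc |∑ j, (W i j * x j - r (W i j) * x' j)| ≤ ∑ j, |W i j * x j - r (W i j) * x' j| :=
          Finset.abs_sum_le_sum_abs _ _
      _ ≤ ∑ _j : Fin n, 2 * B * (e + ε * R) := by
        refine Finset.sum_le_sum fun j _ => ?_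
        have h3 : W i j * x j - r (W i j) * x' j =
          (W i j - r (W i j)) * x j + r (W i j) * (x j - x' j) := by ring
        have h4 : |r (W i j)| ≤ 2 * B := by
          have := abs_sub_abs_le_abs_sub (r (W i j)) (W i j)
          rw [abs_sub_comm] at this
          linarith [hr (W i j), hW i j]
        rw [h3]
        calc _ ≤ |(W i j - r (W i j)) * x j| + |r (W i j) * (x j - x' j)| := abs_add_le _ _
          _ ≤ ε * R + 2 * B * e := by
            rw [abs_mul, abs_mul]
            exact add_le_add (mul_le_mul (hr _) (hx j) (abs_nonneg _) hε)
              (mul_le_mul h4 (hxx j) (abs_nonneg _) (by linarith))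
          _ ≤ _ := by nlinarith [mul_nonneg hε (by linarith : (0:ℝ) ≤ R)]
      _ = n * (2 * B * (e + ε * R)) := by simp
      _ ≤ D * (2 * B * (e + ε * R)) := by gcongr
  have h2 : ε ≤ 2 * B * (e + ε * R) := by
    have : ε ≤ ε * R := le_mul_of_one_le_right hε hR
    nlinarith
  have h5 : (W.mulVec x + b) i - ((W.map r).mulVec x' + fun i => r (b i)) i =
      ∑ j, (W i j * x j - r (W i j) * x' j) + (b i - r (b i)) := by
    simp only [Pi.add_apply, Matrix.mulVec, dotProduct, Matrix.map_apply, Finset.sum_sub_distrib]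
    ring
  rw [h5]
  calc _ ≤ |∑ j, (W i j * x j - r (W i j) * x' j)| + |b i - r (b i)| := abs_add_le _ _
    _ ≤ D * (2 * B * (e + ε * R)) + 2 * B * (e + ε * R) := add_le_add h1 ((hr _).trans h2)
    _ = _ := by ring

/-- Perturbing all parameters by at most `ε` changes the realised function in a controlled way. -/
theorem abs_eval_sub_eval_mapParams_le {σ : ℝ → ℝ} {Cσ s₀ : ℝ≥0} (hσ : LipschitzWith Cσ σ)
    (h0 : |σ 0| ≤ s₀) {D : ℕ} {B ε : ℝ} (hB : 1 ≤ B) (hε : 0 ≤ ε) (hε1 : ε ≤ 1)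
    {r : ℝ → ℝ} (hr : ∀ a, |a - r a| ≤ ε) (g : DNN m n) (hn : n ≤ D)
    (hw : ∀ p ∈ g.hiddenWidths, p ≤ D) (hθ : ∀ a ∈ g.theta, |a| ≤ B)
    (x x' : Fin n → ℝ) {R e : ℝ} (hR : 1 ≤ R) (he : 0 ≤ e) (hx : ∀ i, |x i| ≤ R)
    (hxx : ∀ i, |x i - x' i| ≤ e) (i : Fin m) :
    |g.eval σ x i - (g.mapParams r).eval σ x' i| ≤
      (2 * (Cσ + s₀ + 1) * (D + 1) * B) ^ (g.depth + 1) * (e + (g.depth + 1) * ε * R) := by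
  have hC : (0 : ℝ) ≤ Cσ := Cσ.2
  have hs : (0 : ℝ) ≤ s₀ := s₀.2
  have hDB : 0 ≤ 2 * ((D : ℝ) + 1) * B := by positivity
  induction g generalizing R e with
  | output W b =>
    simp only [theta, List.mem_append] at hθ
    have := abs_mulVec_add_sub_le hB hR hε hε1 he hn W b
      (fun i j => hθ _ (Or.inl (mem_vec W i j))) hr x x' hx hxx i
    simp only [eval, mapParams, depth, hiddenWidths, List.length_nil, zero_add, pow_one,
      Nat.cast_zero, one_mul]
    refine this.trans ?_
    have h1 : 2 * ((D : ℝ) + 1) * B ≤ 2 * (Cσ + s₀ + 1) * (D + 1) * B := by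
      nlinarith [mul_nonneg hDB (add_nonneg hC hs)]
    gcongr
  | layer p W b g ih =>
    simp only [theta, List.mem_append] at hθ
    simp only [hiddenWidths, List.mem_cons, forall_eq_or_imp] at hw
    have hlip : ∀ a b : ℝ, |σ a - σ b| ≤ Cσ * |a - b| := fun a b => by
      simpa [Real.dist_eq] using hσ.dist_le_mul a b
    have hW := fun i j => hθ _ (Or.inl (Or.inl (mem_vec W i j)))
    have hb : ∀ i, |b i| ≤ B := fun i => hθ _ (Or.inl (Or.inr (List.mem_ofFn.2 ⟨i, rfl⟩)))
    set G : ℝ := 2 * (Cσ + s₀ + 1) * (D + 1) * B with hG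
    have hG1 : 1 ≤ G := by
      have h1 : (1 : ℝ) ≤ D + 1 := by linarith [(Nat.cast_nonneg D : (0 : ℝ) ≤ D)]
      have h2 : (1 : ℝ) ≤ 2 * (Cσ + s₀ + 1) := by linarith
      exact one_le_mul_of_one_le_of_one_le (one_le_mul_of_one_le_of_one_le h2 h1) hB
    have hb1 : ∀ i, |σ ((W.mulVec x + b) i)| ≤ G * R := by
      intro i
      have h1 := abs_mulVec_add_le (by linarith) hR hn W b hW hb x hx i
      have h2 := hlip ((W.mulVec x + b) i) 0
      rw [sub_zero] at h2
      have h3 := abs_sub_abs_le_abs_sub (σ ((W.mulVec x + b) i)) (σ 0)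
      have h4 : (Cσ : ℝ) * |(W.mulVec x + b) i| ≤ Cσ * ((D + 1) * B * R) := by gcongr
      have h5 : (1 : ℝ) ≤ (D + 1) * B * R := one_le_mul_of_one_le_of_one_le
        (one_le_mul_of_one_le_of_one_le (by linarith [(Nat.cast_nonneg D : (0 : ℝ) ≤ D)]) hB) hR
      have h6 : G * R = 2 * (Cσ + s₀ + 1) * ((D + 1) * B * R) := by rw [hG]; ring
      rw [h6]
      nlinarith [mul_le_mul_of_nonneg_left h5 hs, mul_nonneg hC (by linarith : (0:ℝ) ≤ (D + 1) * B * R)]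
    have hb2 : ∀ i, |σ ((W.mulVec x + b) i) -
        σ (((W.map r).mulVec x' + fun i => r (b i)) i)| ≤ G * (e + ε * R) := by
      intro i
      have h1 := abs_mulVec_add_sub_le hB hR hε hε1 he hn W b hW hr x x' hx hxx i
      refine (hlip _ _).trans ((mul_le_mul_of_nonneg_left h1 hC).trans ?_)
      have h2 : 0 ≤ e + ε * R := by positivity
      have h3 : G * (e + ε * R) = (Cσ + s₀ + 1) * (2 * (D + 1) * B * (e + ε * R)) := by
        rw [hG]; ring
      rw [h3]
      have h4 : 0 ≤ 2 * ((D : ℝ) + 1) * B * (e + ε * R) := by positivity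
      gcongr
      linarith
    -- One layer sends (R, e) to (G R, G (e + ε R)), under which e + (ℓ + 1) ε R becomes G (e + (ℓ +
    -- 2) ε R): the shape of the bound survives the induction.
    have := ih hw.1 hw.2 (fun a ha => hθ a (Or.inr ha)) _ _ (R := G * R) (e := G * (e + ε * R))
      (one_le_mul_of_one_le_of_one_le hG1 hR) (by positivity) hb1 hb2
    simp only [eval, mapParams]
    refine this.trans (le_of_eq ?_)
    simp only [depth, hiddenWidths, List.length_cons]
    push_cast
    ring

theorem continuous_eval {σ : ℝ → ℝ} (hσ : Continuous σ) (g : DNN m n) :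
    Continuous (g.eval σ) := by
  induction g with
  | output W b =>
    exact (Continuous.matrix_mulVec continuous_const continuous_id).add continuous_const
  | layer p W b g ih =>
    refine ih.comp (continuous_pi fun i => hσ.comp ((continuous_apply i).comp ?_))
    exact (Continuous.matrix_mulVec continuous_const continuous_id).add continuous_const

theorem eval_eq_zero {σ : ℝ → ℝ} (g : DNN m n) (h : ∀ a ∈ g.theta, a = 0) (x : Fin n → ℝ) :
    g.eval σ x = 0 := by
  induction g with
  | output W b =>
    simp only [theta, List.mem_append] at h
    have hW : W = 0 := by
      ext i j
      exact h _ (Or.inl (mem_vec W i j))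
    have hb : b = 0 := funext fun i => h _ (Or.inr (List.mem_ofFn.2 ⟨i, rfl⟩))
    simp [eval, hW, hb]
  | layer p W b g ih =>
    simp only [theta, List.mem_append] at h
    exact ih (fun a ha => h a (Or.inr ha)) _

end DNN

/-! ### Covering numbers of the sparse network class -/

theorem Finset.card_filter_powerset_card_le {α : Type*} (S : Finset α) (s : ℕ) :
    (S.powerset.filter fun t => t.card ≤ s).card ≤ (S.card + 1) ^ s := by
  classical
  have h1 : (Fintype.piFinset fun _ : Fin s => Finset.insertNone S).card = (S.card + 1) ^ s := by
    simp
  rw [← h1]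
  -- A set of at most s elements is listed by s slots, each holding an element or `none`.
  refine Finset.card_le_card_of_surjOn
    (fun φ => Finset.eraseNone (Finset.univ.image φ)) fun t ht => ?_
  simp only [Finset.coe_filter, Finset.mem_powerset, Set.mem_ofPred_eq] at ht
  refine ⟨fun i => t.toList[(i : ℕ)]?, ?_, ?_⟩
  · simp only [Fintype.coe_piFinset, Set.mem_pi, Set.mem_univ, Finset.mem_coe,
      Finset.mem_insertNone, forall_const]
    intro i a ha
    exact ht.1 (Finset.mem_toList.1 (List.mem_of_getElem? ha))
  · ext a
    simp only [Finset.mem_eraseNone, Finset.mem_image, Finset.mem_univ, true_and]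
    constructor
    · rintro ⟨i, hi⟩
      exact Finset.mem_toList.1 (List.mem_of_getElem? hi)
    · intro ha
      obtain ⟨i, hi, h⟩ := List.getElem_of_mem (Finset.mem_toList.2 ha)
      exact ⟨⟨i, by rw [Finset.length_toList] at hi; omega⟩, List.getElem?_eq_some_iff.2 ⟨hi, h⟩⟩

/-- The representatives are taken inside `P`, so the centres of the cover belong to the class and
inherit its bounds, which rounded networks need not satisfy. -/
theorem Set.exists_finset_representatives {α β : Type*} (P : Set α) (code : α → β)
    (K : Finset β) (hK : ∀ a ∈ P, code a ∈ K) :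
    ∃ R : Finset α, (R : Set α) ⊆ P ∧ R.card ≤ K.card ∧ ∀ a ∈ P, ∃ a' ∈ R, code a' = code a := by
  obtain ⟨s', hs', hbij⟩ := Set.exists_subset_bijOn P code
  have hfin : s'.Finite := by
    refine Set.Finite.of_finite_image ?_ hbij.injOn
    exact K.finite_toSet.subset (by rintro _ ⟨a, ha, rfl⟩; exact hK a (hs' ha))
  refine ⟨hfin.toFinset, by simpa using hs', ?_, ?_⟩
  · refine Finset.card_le_card_of_injOn code ?_ (by simpa using hbij.injOn)
    intro a ha
    exact hK a (hs' (by simpa using ha))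
  · intro a ha
    obtain ⟨a', ha', h⟩ := hbij.surjOn ⟨a, ha, rfl⟩
    exact ⟨a', by simpa using ha', h⟩

theorem List.card_filter_range_getD_le (l : List ℝ) (P : ℕ) :
    ((Finset.range P).filter fun i => l.getD i 0 ≠ 0).card ≤
      (l.filter fun a => a ≠ 0).length := by
  induction l generalizing P with
  | nil => simp
  | cons a l ih =>
    cases P with
    | zero => simp
    | succ P =>
      have := ih P
      rw [Finset.card_filter] at this ⊢
      rw [Finset.sum_range_succ']
      by_cases ha : a = 0
      · simpa [ha] using this
      · simpa [ha] using this

/-- The parameters of the networks that realise the members of `sparseDNNClass`. -/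
def sparseDNNParams (d : ℕ) (σ : ℝ → ℝ) (L N B F S : ℝ) : Set (DNN 1 d) :=
  {g | 1 ≤ g.depth ∧ (g.depth : ℝ) ≤ L ∧
    (∀ p ∈ g.hiddenWidths, 1 ≤ p ∧ (p : ℝ) ≤ N) ∧
    (∀ a ∈ g.theta, |a| ≤ B) ∧
    (g.sparsity : ℝ) ≤ S ∧
    (∀ x ∈ unitCube d, |g.eval σ x 0| ≤ F)}

/-- The function realised by a network, cut off outside the unit cube. -/
noncomputable def DNN.realize {d : ℕ} (σ : ℝ → ℝ) (g : DNN 1 d) : (Fin d → ℝ) → ℝ :=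
  (unitCube d).indicator (fun x => g.eval σ x 0)

theorem sparseDNNClass_eq_image (d : ℕ) (σ : ℝ → ℝ) (L N B F S : ℝ) :
    sparseDNNClass d σ L N B F S = DNN.realize σ '' sparseDNNParams d σ L N B F S := by
  ext h
  constructor
  · rintro ⟨g, h1, h2, h3, h4, h5, h6, rfl⟩
    exact ⟨g, ⟨h1, h2, h3, h4, h5, h6⟩, rfl⟩
  · rintro ⟨g, ⟨h1, h2, h3, h4, h5, h6⟩, rfl⟩
    exact ⟨g, h1, h2, h3, h4, h5, h6, rfl⟩

/-- The widths and the non-zero rounded parameters (with their positions) of a network. -/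
noncomputable def DNN.code {m n : ℕ} (l P : ℕ) (ε : ℝ) (g : DNN m n) :
    (Fin l → Option ℕ) × Finset (ℕ × ℤ) :=
  (fun i => g.hiddenWidths[(i : ℕ)]?,
    ((Finset.range P).image fun i => (i, ⌊g.theta.getD i 0 / ε⌋)).filter fun q => q.2 ≠ 0)

theorem DNN.mapParams_eq_of_code_eq {m n : ℕ} {l P : ℕ} {ε : ℝ} (g g' : DNN m n)
    (hl : g.depth ≤ l) (hl' : g'.depth ≤ l) (hP : g.theta.length ≤ P)
    (h : g.code l P ε = g'.code l P ε) :
    g.mapParams (fun a => ε * ⌊a / ε⌋) = g'.mapParams (fun a => ε * ⌊a / ε⌋) := by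
  obtain ⟨h1, h2⟩ := Prod.mk.inj h
  have hwid : g.hiddenWidths = g'.hiddenWidths := by
    refine List.ext_getElem? fun i => ?_
    by_cases hi : i < l
    · exact congrFun h1 ⟨i, hi⟩
    · rw [List.getElem?_eq_none (by unfold depth at hl; omega),
        List.getElem?_eq_none (by unfold depth at hl'; omega)]
  have hfl : ∀ i < P, ⌊g.theta.getD i 0 / ε⌋ = ⌊g'.theta.getD i 0 / ε⌋ := by
    intro i hi
    -- Only non-zero rounded values are stored, so the codes compare these directly; a zero is then
    -- recognised by the absence of its position.
    have key : ∀ v : ℤ, v ≠ 0 →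
        (⌊g.theta.getD i 0 / ε⌋ = v ↔ ⌊g'.theta.getD i 0 / ε⌋ = v) := by
      intro v hv
      have h3 := Finset.ext_iff.1 h2 (i, v)
      simpa [hv, hi] using h3
    by_cases h0 : ⌊g.theta.getD i 0 / ε⌋ = 0
    · by_contra hne
      have := (key _ (fun h => hne (h0.trans h.symm))).2 rfl
      exact hne this
    · exact ((key _ h0).1 rfl).symm
  refine DNN.ext_theta _ _ (by simp [hiddenWidths_mapParams, hwid]) ?_
  have hlen := length_theta_congr g g' hwid
  rw [theta_mapParams, theta_mapParams]
  refine List.ext_getElem (by simp [hlen]) fun i hi hi' => ?_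
  simp only [List.length_map] at hi hi'
  have := hfl i (by omega)
  rw [List.getD_eq_getElem _ _ hi, List.getD_eq_getElem _ _ hi'] at this
  simp [this]

/-- Networks with the same code round to the same network, so any two of them differ by at most
twice the rounding error. The cardinality counts codes: widths, each absent or at most ⌊N⌋, times
sets of at most ⌊S⌋ pairs (position, grid value). -/
theorem exists_finset_sparseDNNClass {d : ℕ} {σ : ℝ → ℝ} {Cσ s₀ : ℝ≥0}
    (hσ : LipschitzWith Cσ σ) (h0 : |σ 0| ≤ s₀) (L N B F S : ℝ) (hB : 1 ≤ B)
    {ε : ℝ} (hε : 0 < ε) (hε1 : ε ≤ 1) :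
    ∃ A : Finset ((Fin d → ℝ) → ℝ), (A : Set _) ⊆ sparseDNNClass d σ L N B F S ∧
      (∀ f ∈ sparseDNNClass d σ L N B F S, ∃ f' ∈ A, ∀ x, |f x - f' x| ≤
        2 * ((2 * (Cσ + s₀ + 1) * ((⌊N⌋₊ + d + 1 : ℕ) + 1) * B) ^ (⌊L⌋₊ + 1) *
          ((⌊L⌋₊ + 1) * ε))) ∧
      A.card ≤ (⌊N⌋₊ + 2) ^ ⌊L⌋₊ *
        ((⌊L⌋₊ + 1) * ((⌊N⌋₊ + d + 1) * (⌊N⌋₊ + d + 2)) * (2 * ⌈B / ε⌉₊ + 1) + 1) ^ ⌊S⌋₊ := by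
  classical
  set l := ⌊L⌋₊
  set D := ⌊N⌋₊ + d + 1 with hD
  set s := ⌊S⌋₊
  set P := (l + 1) * (D * (D + 1)) with hP
  set Q := ⌈B / ε⌉₊ with hQ
  have hQB : B / ε ≤ Q := Nat.le_ceil _
  have hdepth : ∀ g ∈ sparseDNNParams d σ L N B F S, g.depth ≤ l :=
    fun g hg => Nat.le_floor hg.2.1
  have hwidth : ∀ g ∈ sparseDNNParams d σ L N B F S, ∀ p ∈ g.hiddenWidths, p ≤ ⌊N⌋₊ :=
    fun g hg p hp => Nat.le_floor (hg.2.2.1 p hp).2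
  have hlen : ∀ g ∈ sparseDNNParams d σ L N B F S, g.theta.length ≤ P := by
    intro g hg
    refine (DNN.length_theta_le (D := D) (by omega) g (by omega)
      fun p hp => (hwidth g hg p hp).trans (by omega)).trans ?_
    exact Nat.mul_le_mul_right _ (Nat.add_le_add_right (hdepth g hg) 1)
  set K₁ : Finset (Fin l → Option ℕ) :=
    Fintype.piFinset fun _ => Finset.insertNone (Finset.range (⌊N⌋₊ + 1)) with hK₁
  set Sq : Finset (ℕ × ℤ) := Finset.range P ×ˢ Finset.Icc (-(Q : ℤ)) Q with hSq
  set K₂ : Finset (Finset (ℕ × ℤ)) := Sq.powerset.filter fun t => t.card ≤ s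
  have hcode : ∀ g ∈ sparseDNNParams d σ L N B F S, g.code l P ε ∈ K₁ ×ˢ K₂ := by
    intro g hg
    rw [Finset.mem_product]
    constructor
    · simp only [hK₁, Fintype.mem_piFinset, Finset.mem_insertNone, Finset.mem_range]
      intro i p hp
      have := hwidth g hg p (List.mem_of_getElem? hp)
      omega
    · simp only [K₂, Finset.mem_filter, Finset.mem_powerset]
      constructor
      · intro q hq
        simp only [DNN.code, Finset.mem_filter, Finset.mem_image, Finset.mem_range] at hq
        obtain ⟨⟨i, hi, rfl⟩, -⟩ := hq
        simp only [hSq, Finset.mem_product, Finset.mem_range, Finset.mem_Icc]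
        have hθ : |g.theta.getD i 0| ≤ B := by
          by_cases hi : i < g.theta.length
          · rw [List.getD_eq_getElem _ _ hi]
            exact hg.2.2.2.1 _ (List.getElem_mem hi)
          · rw [List.getD_eq_default _ _ (by omega), abs_zero]
            linarith
        obtain ⟨h1, h2⟩ := abs_le.1 hθ
        refine ⟨hi, Int.le_floor.2 ?_, ?_⟩
        · push_cast
          have : -B / ε ≤ g.theta.getD i 0 / ε := by gcongr
          rw [neg_div] at this
          linarith
        · have h3 : g.theta.getD i 0 / ε ≤ B / ε := by gcongr
          have h4 := (Int.floor_le (g.theta.getD i 0 / ε)).trans (h3.trans hQB)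
          exact_mod_cast h4
      -- As ⌊0⌋ = 0, rounding creates no new non-zero entries, and the code inherits the sparsity.
      · have h1 : (g.code l P ε).2 ⊆ ((Finset.range P).filter fun i => g.theta.getD i 0 ≠ 0).image
            fun i => (i, ⌊g.theta.getD i 0 / ε⌋) := by
          intro q hq
          simp only [DNN.code, Finset.mem_filter, Finset.mem_image, Finset.mem_range] at hq ⊢
          obtain ⟨⟨i, hi, rfl⟩, hne⟩ := hq
          refine ⟨i, ⟨hi, fun h => hne ?_⟩, rfl⟩
          change ⌊g.theta.getD i 0 / ε⌋ = 0
          rw [h]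
          simp
        refine (Finset.card_le_card h1).trans (Finset.card_image_le.trans ?_)
        exact (List.card_filter_range_getD_le _ _).trans (Nat.le_floor hg.2.2.2.2.1)
  obtain ⟨R, hR, hRc, hRcode⟩ := Set.exists_finset_representatives _ _ _ hcode
  refine ⟨R.image (DNN.realize σ), ?_, ?_, ?_⟩
  · rw [sparseDNNClass_eq_image, Finset.coe_image]
    exact Set.image_mono hR
  · rw [sparseDNNClass_eq_image]
    rintro _ ⟨g, hg, rfl⟩
    obtain ⟨g', hg', hc⟩ := hRcode g hg
    refine ⟨_, Finset.mem_image_of_mem _ hg', fun x => ?_⟩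
    set G : ℝ := 2 * (Cσ + s₀ + 1) * ((D : ℕ) + 1) * B with hG
    have hC : (0 : ℝ) ≤ Cσ := Cσ.2
    have hs : (0 : ℝ) ≤ s₀ := s₀.2
    have hG1 : 1 ≤ G := by
      have h1 : (1 : ℝ) ≤ D + 1 := by linarith [(Nat.cast_nonneg D : (0 : ℝ) ≤ D)]
      have h2 : (1 : ℝ) ≤ 2 * (Cσ + s₀ + 1) := by linarith
      exact one_le_mul_of_one_le_of_one_le (one_le_mul_of_one_le_of_one_le h2 h1) hB
    by_cases hx : x ∈ unitCube d
    · have hx1 : ∀ i, |x i| ≤ 1 := fun i => abs_le.2 ⟨by linarith [hx.1 i, Pi.zero_apply (M := fun _ : Fin d => ℝ) i], hx.2 i⟩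
      have hr : ∀ a : ℝ, |a - ε * ⌊a / ε⌋| ≤ ε := by
        intro a
        have h1 := Int.floor_le (a / ε)
        have h2 := Int.lt_floor_add_one (a / ε)
        rw [le_div_iff₀ hε] at h1
        rw [div_lt_iff₀ hε] at h2
        exact abs_le.2 ⟨by linarith, by linarith⟩
      have key : ∀ f ∈ sparseDNNParams d σ L N B F S,
          |f.eval σ x 0 - (f.mapParams fun a => ε * ⌊a / ε⌋).eval σ x 0| ≤
            G ^ (l + 1) * ((l + 1) * ε) := by
        intro f hf
        refine (DNN.abs_eval_sub_eval_mapParams_le hσ h0 (D := D) hB hε.le hε1 hr f (by omega)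
          (fun p hp => (hwidth f hf p hp).trans (by omega)) hf.2.2.2.1 x x le_rfl le_rfl hx1
          (by simp) 0).trans ?_
        have h1 : (f.depth : ℝ) ≤ l := by exact_mod_cast hdepth f hf
        have h2 := hdepth f hf
        simp only [zero_add, mul_one]
        gcongr
      have h1 := key g hg
      have h2 := key g' (hR hg')
      rw [DNN.mapParams_eq_of_code_eq g' g (hdepth _ (hR hg')) (hdepth _ hg)
        (hlen _ (hR hg')) hc, abs_sub_comm] at h2
      simp only [DNN.realize, Set.indicator_of_mem hx]
      have := abs_sub_le (g.eval σ x 0) ((g.mapParams fun a => ε * ⌊a / ε⌋).eval σ x 0)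
        (g'.eval σ x 0)
      linarith
    · simp only [DNN.realize, Set.indicator_of_notMem hx, sub_zero, abs_zero]
      positivity
  · refine Finset.card_image_le.trans (hRc.trans ?_)
    rw [Finset.card_product]
    refine Nat.mul_le_mul (le_of_eq ?_) ?_
    · simp [hK₁]
    · refine (Finset.card_filter_powerset_card_le Sq s).trans (le_of_eq ?_)
      have : Sq.card = P * (2 * Q + 1) := by
        rw [hSq, Finset.card_product, Finset.card_range, Int.card_Icc]
        congr 1
        omega
      rw [this, hP]

/-- The class of sparse networks is totally bounded for the sup norm. -/
theorem exists_finset_cover_sparseDNNClass {d : ℕ} {σ : ℝ → ℝ} {Cσ s₀ : ℝ≥0}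
    (hσ : LipschitzWith Cσ σ) (h0 : |σ 0| ≤ s₀) (L N B F S : ℝ) (hB : 1 ≤ B)
    {δ : ℝ} (hδ : 0 < δ) :
    ∃ A : Finset ((Fin d → ℝ) → ℝ), (A : Set _) ⊆ sparseDNNClass d σ L N B F S ∧
      ∀ f ∈ sparseDNNClass d σ L N B F S, ∃ f' ∈ A, ∀ x, |f x - f' x| ≤ δ := by
  set M : ℝ := 2 * ((2 * (Cσ + s₀ + 1) * ((⌊N⌋₊ + d + 1 : ℕ) + 1) * B) ^ (⌊L⌋₊ + 1) *
    (⌊L⌋₊ + 1)) with hM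
  have hC : (0 : ℝ) ≤ Cσ := Cσ.2
  have hs : (0 : ℝ) ≤ s₀ := s₀.2
  have hM0 : 0 < M := by positivity
  obtain ⟨A, h1, h2, -⟩ := exists_finset_sparseDNNClass (d := d) hσ h0 L N B F S hB
    (ε := min 1 (δ / M)) (by positivity) (min_le_left _ _)
  refine ⟨A, h1, fun f hf => ?_⟩
  obtain ⟨f', hf', h⟩ := h2 f hf
  refine ⟨f', hf', fun x => (h x).trans ?_⟩
  calc _ = M * min 1 (δ / M) := by rw [hM]; ring
    _ ≤ M * (δ / M) := by gcongr; exact min_le_right _ _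
    _ = δ := by field_simp

theorem log_one_add_le_of_le_pow_mul_pow {x X q : ℝ} {l s : ℕ} (hx : 0 ≤ x) (hX : 1 ≤ X)
    (hq : 1 ≤ q) (h : x ≤ X ^ l * q ^ s) :
    Real.log (1 + x) ≤ 1 + (l * Real.log X + s * Real.log q) := by
  have h1 : 1 ≤ X ^ l * q ^ s :=
    one_le_mul_of_one_le_of_one_le (one_le_pow₀ hX) (one_le_pow₀ hq)
  have h2 : Real.log (1 + x) ≤ Real.log (2 * (X ^ l * q ^ s)) :=
    Real.log_le_log (by linarith) (by linarith)
  rw [Real.log_mul (by norm_num) (by positivity), Real.log_mul (by positivity) (by positivity),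
    Real.log_pow, Real.log_pow] at h2
  linarith [Real.log_two_lt_d9]

theorem mul_ceil_add_one_le {p y c : ℝ} (hp : 1 ≤ p) (hy : 1 ≤ y) (hc : c ≤ y + 1) :
    p * (2 * c + 1) + 1 ≤ 6 * p * y := by
  have h6 : 2 * c + 1 ≤ 5 * y := by linarith
  have h7 := mul_le_mul_of_nonneg_left h6 (by linarith : 0 ≤ p)
  have h8 := one_le_mul_of_one_le_of_one_le hp hy
  linarith

/-- The depth-dependent power contributes (L + 1) log U to log q, and S such choices are made. The
conditions S ≥ 1 and log U ≥ 1 absorb the count of the widths and the additive constant. -/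
theorem log_count_le {L S U a c lN q : ℝ} {l s : ℕ} (hL : 0 ≤ L) (hS : 1 ≤ S) (hU : 3 ≤ U)
    (hΛ : 1 ≤ Real.log U) (ha : 0 < a) (hc : 0 < c) (hla : 0 ≤ Real.log a)
    (hlc : 0 ≤ Real.log c) (hl : l ≤ L) (hs : s ≤ S) (hlN0 : 0 ≤ lN)
    (hlN : lN ≤ 2 * Real.log U) (hq : 1 ≤ q) (h : q ≤ a * U ^ 2 * (c * U) ^ (l + 1)) :
    1 + (l * lN + s * Real.log q) ≤
      (Real.log a + Real.log c + 6) * (S * (L + 1) * Real.log U) := by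
  have hU0 : 0 < U := by linarith
  have h1 := Real.log_le_log (by linarith) h
  rw [Real.log_mul (by positivity) (by positivity), Real.log_mul (by positivity) (by positivity),
    Real.log_pow, Real.log_pow, Real.log_mul hc.ne' hU0.ne'] at h1
  push_cast at h1
  set Λ := Real.log U
  have hLΛ : 1 ≤ (L + 1) * Λ := one_le_mul_of_one_le_of_one_le (by linarith) hΛ
  have h6 : Real.log q ≤ (L + 1) * Λ * (Real.log a + Real.log c + 3) := by
    have e1 : Real.log a ≤ (L + 1) * Λ * Real.log a := le_mul_of_one_le_left hla hLΛ
    have e2 : Λ ≤ (L + 1) * Λ := le_mul_of_one_le_left (by linarith) (by linarith)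
    have e3 : ((l : ℝ) + 1) * (Real.log c + Λ) ≤ (L + 1) * (Λ * Real.log c + Λ) := by
      have : Real.log c ≤ Λ * Real.log c := le_mul_of_one_le_left hlc hΛ
      gcongr
    linarith
  have hLS : (L + 1) * Λ ≤ S * ((L + 1) * Λ) := le_mul_of_one_le_left (by linarith) hS
  have e1 : l * lN ≤ (L + 1) * (2 * Λ) := mul_le_mul (by linarith) hlN hlN0 (by linarith)
  have e2 : s * Real.log q ≤ S * ((L + 1) * Λ * (Real.log a + Real.log c + 3)) :=
    mul_le_mul hs h6 (Real.log_nonneg hq) (by linarith)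
  linarith

theorem sparseDNN_position_count_le {L N B T D d c G : ℝ} {l : ℕ} (hL : 0 ≤ L) (hN : 0 ≤ N)
    (hBT : 1 ≤ B * T) (hB : 0 ≤ B) (hl : l ≤ L) (hD0 : 0 ≤ D) (hd : 0 ≤ d)
    (hD : D + 1 ≤ (N + 1) * (d + 2)) (hG : 0 ≤ G) (hGU : G ≤ c * ((L + 1) * (N + 1) * B * T)) :
    6 * ((l + 1) * (D * (D + 1))) * (B * (2 * (G ^ (l + 1) * (l + 1)) * T)) ≤
      12 * (d + 2) ^ 2 * ((L + 1) * (N + 1) * B * T) ^ 2 *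
        (c * ((L + 1) * (N + 1) * B * T)) ^ (l + 1) := by
  have hT : 0 ≤ T := by
    by_contra h
    have := mul_nonpos_of_nonneg_of_nonpos hB (not_le.1 h).le
    linarith
  have hDD : D * (D + 1) ≤ ((N + 1) * (d + 2)) ^ 2 := by nlinarith
  set V := c * ((L + 1) * (N + 1) * B * T)
  have hV : 0 ≤ V := hG.trans hGU
  have hVp : 0 ≤ V ^ (l + 1) := pow_nonneg hV _
  calc 6 * ((l + 1) * (D * (D + 1))) * (B * (2 * (G ^ (l + 1) * (l + 1)) * T))
      ≤ 6 * ((L + 1) * ((N + 1) * (d + 2)) ^ 2) *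
        (B * (2 * (V ^ (l + 1) * (L + 1)) * T)) := by gcongr
    _ = 12 * (d + 2) ^ 2 * (((L + 1) * (N + 1)) ^ 2 * (1 * (B * T))) * V ^ (l + 1) := by ring
    -- A second factor B T ≥ 1 is inserted to complete the square of (L + 1)(N + 1) B T.
    _ ≤ 12 * (d + 2) ^ 2 * (((L + 1) * (N + 1)) ^ 2 * ((B * T) * (B * T))) * V ^ (l + 1) := by
      gcongr
    _ = _ := by ring

theorem exists_log_card_cover_sparseDNNClass_le (d : ℕ) (Cσ s₀ : ℝ≥0) :
    ∃ C : ℝ, 0 < C ∧ ∀ σ : ℝ → ℝ, LipschitzWith Cσ σ → |σ 0| ≤ s₀ →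
      ∀ (L N B F S : ℝ) (T : ℕ), 0 < L → 0 < N → 1 ≤ B → 1 ≤ S → 3 ≤ T →
      ∃ A : Finset ((Fin d → ℝ) → ℝ), (A : Set _) ⊆ sparseDNNClass d σ L N B F S ∧
        (∀ f ∈ sparseDNNClass d σ L N B F S, ∃ f' ∈ A, ∀ x, |f x - f' x| ≤ 1 / T) ∧
        Real.log (1 + A.card) ≤
          C * (S * (L + 1) * Real.log ((L + 1) * (N + 1) * B * T)) := by
  have hC : (0 : ℝ) ≤ Cσ := Cσ.2
  have hs : (0 : ℝ) ≤ s₀ := s₀.2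
  have hd : (0 : ℝ) ≤ d := Nat.cast_nonneg d
  set a : ℝ := 12 * (d + 2) ^ 2 with ha
  set c : ℝ := 2 * (Cσ + s₀ + 1) * (d + 2) with hc
  have ha1 : 1 ≤ a := by rw [ha]; nlinarith
  have hc1 : 1 ≤ c := by rw [hc]; nlinarith [add_nonneg hC hs]
  have hla := Real.log_nonneg ha1
  have hlc := Real.log_nonneg hc1
  refine ⟨Real.log a + Real.log c + 6, by linarith, ?_⟩
  intro σ hσ h0 L N B F S T hL hN hB hS hT
  have hT3 : (3 : ℝ) ≤ T := by exact_mod_cast hT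
  set U : ℝ := (L + 1) * (N + 1) * B * T with hU
  have hLN : 1 ≤ (L + 1) * (N + 1) := one_le_mul_of_one_le_of_one_le (by linarith) (by linarith)
  have hLNB : 1 ≤ (L + 1) * (N + 1) * B := one_le_mul_of_one_le_of_one_le hLN hB
  have hBT : 1 ≤ B * T := one_le_mul_of_one_le_of_one_le hB (by linarith)
  have hU3 : 3 ≤ U := by rw [hU]; nlinarith
  have hΛ : 1 ≤ Real.log U := by
    rw [Real.le_log_iff_exp_le (by linarith)]
    linarith [Real.exp_one_lt_d9]
  set Λ := Real.log U with hΛdef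
  set l := ⌊L⌋₊ with hl
  have hlL : (l : ℝ) ≤ L := Nat.floor_le hL.le
  have hnN : (⌊N⌋₊ : ℝ) ≤ N := Nat.floor_le hN.le
  have hsS : (⌊S⌋₊ : ℝ) ≤ S := Nat.floor_le (by linarith)
  set D := ⌊N⌋₊ + d + 1 with hD
  have hDle : (D : ℝ) + 1 ≤ (N + 1) * (d + 2) := by
    rw [hD]; push_cast; nlinarith
  set G : ℝ := 2 * (Cσ + s₀ + 1) * ((D : ℕ) + 1) * B with hG
  have hG1 : 1 ≤ G := by
    have h1 : (1 : ℝ) ≤ D + 1 := by linarith [(Nat.cast_nonneg D : (0 : ℝ) ≤ D)]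
    have h2 : (1 : ℝ) ≤ 2 * (Cσ + s₀ + 1) := by linarith
    exact one_le_mul_of_one_le_of_one_le (one_le_mul_of_one_le_of_one_le h2 h1) hB
  have hGU : G ≤ c * U := by
    calc G ≤ 2 * (Cσ + s₀ + 1) * ((N + 1) * (d + 2)) * B := by rw [hG]; gcongr
      _ = c * (1 * (N + 1) * B * 1) := by rw [hc]; ring
      _ ≤ c * U := by rw [hU]; gcongr <;> linarith
  set M : ℝ := 2 * (G ^ (l + 1) * (l + 1)) with hM
  have hM1 : 1 ≤ M := by
    have : 1 ≤ G ^ (l + 1) * (l + 1) := one_le_mul_of_one_le_of_one_le (one_le_pow₀ hG1)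
      (by linarith [(Nat.cast_nonneg l : (0 : ℝ) ≤ l)])
    linarith
  -- M is the amplification from grid width to sup-norm distance, so this grid gives radius exactly
  -- 1/T.
  set ε : ℝ := 1 / (M * T) with hε
  have hMT : 1 ≤ M * T := one_le_mul_of_one_le_of_one_le hM1 (by linarith)
  have hε0 : 0 < ε := by positivity
  obtain ⟨A, hA1, hA2, hA3⟩ := exists_finset_sparseDNNClass (d := d) hσ h0 L N B F S hB hε0
    (by rw [hε]; exact div_le_one_of_le₀ hMT (by linarith))
  refine ⟨A, hA1, fun f hf => ?_, ?_⟩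
  · obtain ⟨f', hf', h⟩ := hA2 f hf
    refine ⟨f', hf', fun x => (h x).trans (le_of_eq ?_)⟩
    calc _ = M * ε := by rw [hM]; ring
      _ = 1 / T := by rw [hε]; field_simp
  · set q := (l + 1) * (D * (D + 1)) * (2 * ⌈B / ε⌉₊ + 1) + 1 with hq
    have hA4 : (A.card : ℝ) ≤ (⌊N⌋₊ + 2 : ℝ) ^ l * (q : ℝ) ^ ⌊S⌋₊ := by exact_mod_cast hA3
    have hq1 : (1 : ℝ) ≤ q := by rw [hq]; push_cast; linarith [show (0:ℝ) ≤ (l + 1) * (D * (D + 1)) * (2 * ⌈B / ε⌉₊ + 1) by positivity]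
    have h2 := log_one_add_le_of_le_pow_mul_pow (Nat.cast_nonneg _)
      (by linarith [(Nat.cast_nonneg ⌊N⌋₊ : (0 : ℝ) ≤ ⌊N⌋₊)]) hq1 hA4
    have h3 : Real.log (⌊N⌋₊ + 2 : ℝ) ≤ 2 * Λ := by
      have h4 : (⌊N⌋₊ + 2 : ℝ) ≤ 2 * U := by
        have : N + 1 ≤ U := by
          calc N + 1 = 1 * (N + 1) * 1 * 1 := by ring
            _ ≤ U := by rw [hU]; gcongr <;> linarith
        linarith
      have := Real.log_le_log (by positivity) h4
      rw [Real.log_mul (by norm_num) (by linarith)] at this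
      linarith [Real.log_two_lt_d9]
    have h5 : (q : ℝ) ≤ a * U ^ 2 * (c * U) ^ (l + 1) := by
      have hBε2 : B / ε = B * (2 * (G ^ (l + 1) * (l + 1)) * T) := by
        rw [hε, div_div_eq_mul_div, div_one, ← hM]
      have hBε : 1 ≤ B / ε := by
        rw [hε, div_div_eq_mul_div, div_one]
        exact one_le_mul_of_one_le_of_one_le hB hMT
      have hceil : (⌈B / ε⌉₊ : ℝ) ≤ B / ε + 1 := (Nat.ceil_lt_add_one (by linarith)).le
      have hp1 : (1 : ℝ) ≤ (l + 1) * (D * (D + 1)) := by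
        have : 1 ≤ (l + 1) * (D * (D + 1)) := Nat.one_le_iff_ne_zero.2 (by positivity)
        exact_mod_cast this
      have hq2 : (q : ℝ) = (l + 1) * (D * (D + 1)) * (2 * ⌈B / ε⌉₊ + 1) + 1 := by
        rw [hq]; push_cast; ring
      rw [hq2]
      refine (mul_ceil_add_one_le hp1 hBε hceil).trans ?_
      rw [hBε2, ha, hU]
      exact sparseDNN_position_count_le hL.le hN.le hBT (by linarith) hlL (Nat.cast_nonneg _) hd
        hDle (by linarith) (hU ▸ hGU)
    refine h2.trans ?_
    have hlN : 0 ≤ Real.log (⌊N⌋₊ + 2 : ℝ) :=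
      Real.log_nonneg (by linarith [(Nat.cast_nonneg ⌊N⌋₊ : (0 : ℝ) ≤ ⌊N⌋₊)])
    exact log_count_le hL.le hS hU3 hΛ (by linarith) (by linarith) hla hlc hlL hsS hlN h3 hq1 h5

/-! ### Mixing coefficients and decoupling of finitely valued variables -/

section Partitions

variable {Ω : Type*} {𝒜 ℬ : MeasurableSpace Ω} [mΩ : MeasurableSpace Ω] {E E₁ E₂ : Type*}
  [Fintype E] [Fintype E₁]
  [Fintype E₂] [MeasurableSpace E] [MeasurableSingletonClass E] [MeasurableSpace E₁]
  [MeasurableSingletonClass E₁] [MeasurableSpace E₂] [MeasurableSingletonClass E₂]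

theorem sum_measureReal_inter_of_iUnion_eq_univ {ι : Type*} [Fintype ι] (P : Measure Ω)
    [IsFiniteMeasure P] (A : ι → Set Ω) (hA : ∀ i, MeasurableSet (A i))
    (hd : Pairwise fun i j => Disjoint (A i) (A j)) (hu : (⋃ i, A i) = Set.univ) {s : Set Ω}
    (hs : MeasurableSet s) : ∑ i, P.real (s ∩ A i) = P.real s := by
  have h := measureReal_biUnion_finset (μ := P) (s := Finset.univ) (f := fun i => s ∩ A i)
    (fun i _ j _ hij => (hd hij).mono Set.inter_subset_right Set.inter_subset_right)
    (fun i _ => hs.inter (hA i))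
  rw [← h]
  congr 1
  simp [← Set.inter_iUnion, hu]

theorem sum_measureReal_preimage_singleton_eq_one (P : Measure Ω) [IsProbabilityMeasure P]
    {U : Ω → E} (hU : Measurable U) : ∑ a, P.real (U ⁻¹' {a}) = 1 := by
  have := sum_measureReal_inter_of_iUnion_eq_univ P (fun a => U ⁻¹' {a})
    (fun a => hU (measurableSet_singleton a))
    (fun i j hij => Disjoint.preimage _ (by simpa using hij))
    (by ext; simp) MeasurableSet.univ
  simpa using this

/-- The real supremum of an unbounded set is 0 by convention; boundedness is what makes each
partition sum a lower bound for the supremum. -/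
theorem bddAbove_betaCoeff_set (P : Measure Ω) [IsProbabilityMeasure P]
    (h𝒜 : 𝒜 ≤ mΩ) (hℬ : ℬ ≤ mΩ) :
    BddAbove {s : ℝ | ∃ (n k : ℕ) (A : Fin n → Set Ω) (B : Fin k → Set Ω),
      IsFinPartition 𝒜 A ∧ IsFinPartition ℬ B ∧
      s = ∑ i, ∑ j, |P.real (A i ∩ B j) - P.real (A i) * P.real (B j)|} := by
  refine ⟨2, ?_⟩
  rintro _ ⟨n, k, A, B, ⟨hA, hAd, hAu⟩, ⟨hB, hBd, hBu⟩, rfl⟩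
  have hA' := fun i => h𝒜 _ (hA i)
  have hB' := fun i => hℬ _ (hB i)
  have h1 := sum_measureReal_inter_of_iUnion_eq_univ P A hA' hAd hAu MeasurableSet.univ
  have h2 := sum_measureReal_inter_of_iUnion_eq_univ P B hB' hBd hBu MeasurableSet.univ
  simp only [Set.univ_inter, probReal_univ] at h1 h2
  calc ∑ i, ∑ j, |P.real (A i ∩ B j) - P.real (A i) * P.real (B j)|
      ≤ ∑ i, ∑ j, (P.real (A i ∩ B j) + P.real (A i) * P.real (B j)) := by
        refine Finset.sum_le_sum fun i _ => Finset.sum_le_sum fun j _ => ?_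
        refine (abs_sub _ _).trans ?_
        rw [abs_of_nonneg measureReal_nonneg,
          abs_of_nonneg (mul_nonneg measureReal_nonneg measureReal_nonneg)]
    _ = ∑ i, (P.real (A i) + P.real (A i)) := by
        refine Finset.sum_congr rfl fun i _ => ?_
        rw [Finset.sum_add_distrib, ← Finset.mul_sum, h2, mul_one,
          sum_measureReal_inter_of_iUnion_eq_univ P B hB' hBd hBu (hA' i)]
    _ = 2 := by
        rw [Finset.sum_add_distrib, h1]
        norm_num

theorem isFinPartition_preimage_singleton {Ω : Type*} {𝒜 : MeasurableSpace Ω} {U : Ω → E}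
    (hU : Measurable[𝒜] U) :
    IsFinPartition 𝒜 (fun i : Fin (Fintype.card E) => U ⁻¹' {(Fintype.equivFin E).symm i}) := by
  refine ⟨fun i => hU (measurableSet_singleton _), fun i j hij => Disjoint.preimage _ ?_, ?_⟩
  · simpa using hij
  · ext ω
    simp only [Set.mem_iUnion, Set.mem_preimage, Set.mem_singleton_iff, Set.mem_univ, iff_true]
    exact ⟨Fintype.equivFin E (U ω), by simp⟩

/-- The total variation distance between the joint law of two discrete random variables and the
product of their laws is controlled by the β-mixing coefficient. -/
theorem sum_abs_joint_sub_prod_le_betaCoeff (P : Measure Ω) [IsProbabilityMeasure P]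
    (h𝒜 : 𝒜 ≤ mΩ) (hℬ : ℬ ≤ mΩ) {U : Ω → E₁} {V : Ω → E₂}
    (hU : Measurable[𝒜] U) (hV : Measurable[ℬ] V) :
    ∑ a, ∑ c, |P.real (U ⁻¹' {a} ∩ V ⁻¹' {c}) - P.real (U ⁻¹' {a}) * P.real (V ⁻¹' {c})| ≤
      2 * betaCoeff P 𝒜 ℬ := by
  have h1 := le_csSup (bddAbove_betaCoeff_set P h𝒜 hℬ)
    ⟨_, _, _, _, isFinPartition_preimage_singleton hU, isFinPartition_preimage_singleton hV, rfl⟩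
  have h2 : ∑ a, ∑ c, |P.real (U ⁻¹' {a} ∩ V ⁻¹' {c}) - P.real (U ⁻¹' {a}) * P.real (V ⁻¹' {c})|
      = ∑ i : Fin (Fintype.card E₁), ∑ j : Fin (Fintype.card E₂),
        |P.real (U ⁻¹' {(Fintype.equivFin E₁).symm i} ∩ V ⁻¹' {(Fintype.equivFin E₂).symm j}) -
          P.real (U ⁻¹' {(Fintype.equivFin E₁).symm i}) *
          P.real (V ⁻¹' {(Fintype.equivFin E₂).symm j})| := by
    refine (Equiv.sum_comp (Fintype.equivFin E₁).symm _).symm.trans ?_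
    refine Finset.sum_congr rfl fun i _ => ?_
    exact (Equiv.sum_comp (Fintype.equivFin E₂).symm _).symm
  rw [h2, betaCoeff]
  linarith

/-- This disposes of the empty blocks beyond time T, on which the block variable is constant. -/
theorem sum_abs_joint_sub_prod_const_right {E₁ E₂ : Type*} [Fintype E₁] [Fintype E₂]
    (P : Measure Ω) [IsProbabilityMeasure P]
    (U : Ω → E₁) {V : Ω → E₂} {v : E₂} (hV : ∀ ω, V ω = v) :
    ∑ a, ∑ c, |P.real (U ⁻¹' {a} ∩ V ⁻¹' {c}) - P.real (U ⁻¹' {a}) * P.real (V ⁻¹' {c})| = 0 := by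
  refine Finset.sum_eq_zero fun a _ => Finset.sum_eq_zero fun c _ => ?_
  obtain rfl : V = fun _ => v := funext hV
  by_cases h : v = c
  · simp [h]
  · have : (fun _ : Ω => v) ⁻¹' {c} = ∅ := by ext; simp [h]
    simp [this]

theorem integral_comp_eq_sum (P : Measure Ω) [IsProbabilityMeasure P] {U : Ω → E}
    (hU : Measurable U) (f : E → ℝ) : ∫ ω, f (U ω) ∂P = ∑ a, P.real (U ⁻¹' {a}) * f a := by
  have : IsProbabilityMeasure (P.map U) := Measure.isProbabilityMeasure_map hU.aemeasurable
  have hf : Measurable f := measurable_of_finite f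
  rw [← integral_map hU.aemeasurable hf.aestronglyMeasurable, integral_fintype Integrable.of_finite]
  refine Finset.sum_congr rfl fun a _ => ?_
  rw [map_measureReal_apply hU (measurableSet_singleton a), smul_eq_mul]

theorem integrable_comp_of_finite (P : Measure Ω) [IsProbabilityMeasure P] {U : Ω → E}
    (hU : Measurable U) (f : E → ℝ) : Integrable (fun ω => f (U ω)) P := by
  have : IsProbabilityMeasure (P.map U) := Measure.isProbabilityMeasure_map hU.aemeasurable
  exact (Integrable.of_finite (μ := P.map U) (f := f)).comp_measurable hU

/-- Replacing a sequence of discrete random variables by independent copies costs at most the sum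
of the dependence coefficients between each of them and its predecessors. -/
theorem sum_abs_pi_sub_prod_le (P : Measure Ω) [IsProbabilityMeasure P] (U : ℕ → Ω → E)
    (hU : ∀ i, Measurable (U i)) {β : ℝ} (n : ℕ)
    (hβ : ∀ i < n, ∑ a : Fin i → E, ∑ c : E,
      |P.real ((fun ω (k : Fin i) => U k ω) ⁻¹' {a} ∩ U i ⁻¹' {c}) -
        P.real ((fun ω (k : Fin i) => U k ω) ⁻¹' {a}) * P.real (U i ⁻¹' {c})| ≤ β) :
    ∑ a : Fin n → E, |P.real ((fun ω (k : Fin n) => U k ω) ⁻¹' {a}) -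
      ∏ k : Fin n, P.real (U k ⁻¹' {a k})| ≤ n * β := by
  induction n with
  | zero =>
    have : ∀ a : Fin 0 → E, (fun ω (k : Fin 0) => U k ω) ⁻¹' {a} = Set.univ := by
      intro a; ext ω; simp [Subsingleton.elim (fun k : Fin 0 => U k ω) a]
    simp [this]
  | succ n ih =>
    have ih' := ih fun i hi => hβ i (by omega)
    have hn := hβ n (by omega)
    rw [← Equiv.sum_comp (Fin.snocEquiv fun _ => E), Fintype.sum_prod_type_right]
    have hset : ∀ (a : Fin n → E) (c : E),
        (fun ω (k : Fin (n + 1)) => U k ω) ⁻¹' {Fin.snocEquiv (fun _ => E) (c, a)} =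
          (fun ω (k : Fin n) => U k ω) ⁻¹' {a} ∩ U n ⁻¹' {c} := by
      intro a c
      ext ω
      simp only [Set.mem_preimage, Set.mem_singleton_iff, Set.mem_inter_iff, funext_iff,
        Fin.forall_fin_succ', Fin.snocEquiv_apply, Fin.snoc_castSucc, Fin.snoc_last,
        Fin.val_castSucc, Fin.val_last]
    have hprod : ∀ (a : Fin n → E) (c : E),
        ∏ k : Fin (n + 1), P.real (U k ⁻¹' {Fin.snocEquiv (fun _ => E) (c, a) k}) =
          (∏ k : Fin n, P.real (U k ⁻¹' {a k})) * P.real (U n ⁻¹' {c}) := by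
      intro a c
      simp [Fin.prod_univ_castSucc]
    -- The intermediate term is (law of the past) × (law of the new variable): the first difference
    -- is the new dependence, and the second is the inductive one integrated over the last
    -- coordinate.
    calc _ ≤ ∑ a : Fin n → E, ∑ c : E,
          (|P.real ((fun ω (k : Fin n) => U k ω) ⁻¹' {a} ∩ U n ⁻¹' {c}) -
            P.real ((fun ω (k : Fin n) => U k ω) ⁻¹' {a}) * P.real (U n ⁻¹' {c})| +
          |P.real ((fun ω (k : Fin n) => U k ω) ⁻¹' {a}) -
            ∏ k : Fin n, P.real (U k ⁻¹' {a k})| * P.real (U n ⁻¹' {c})) := by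
          refine Finset.sum_le_sum fun a _ => Finset.sum_le_sum fun c _ => ?_
          rw [hset, hprod]
          have h0 : (0 : ℝ) ≤ P.real (U n ⁻¹' {c}) := measureReal_nonneg
          have h1 : ∀ y : ℝ, |y| * P.real (U n ⁻¹' {c}) = |y * P.real (U n ⁻¹' {c})| :=
            fun y => by rw [abs_mul, abs_of_nonneg h0]
          rw [h1, sub_mul]
          exact abs_sub_le _ _ _
      _ ≤ β + n * β := by
          simp only [Finset.sum_add_distrib, ← Finset.mul_sum,
            sum_measureReal_preimage_singleton_eq_one P (hU n), mul_one]
          exact add_le_add hn ih'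
      _ = _ := by push_cast; ring

/-- Here e^(-y) ≤ 1/(1 + y) ≤ 1 - y + y², and y² ≤ x y. A bound linear in y turns the exponential
moment into a function of the mean alone. -/
theorem Real.exp_neg_le_one_sub_mul {x y : ℝ} (hy : 0 ≤ y) (hyx : y ≤ x) :
    Real.exp (-y) ≤ 1 - (1 - x) * y := by
  have h1 : Real.exp (-y) ≤ 1 / (1 + y) := by
    rw [Real.exp_neg, ← one_div]
    exact one_div_le_one_div_of_le (by linarith) (by linarith [Real.add_one_le_exp y])
  have h2 : 1 / (1 + y) ≤ 1 - y + y ^ 2 := by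
    rw [div_le_iff₀ (by linarith)]
    nlinarith [pow_nonneg hy 3]
  nlinarith

/-- The tangent to the concave logarithm at 1 + card: it replaces Jensen's inequality and remains
linear in the `z j`. -/
theorem Real.log_one_add_sum_le {ι : Type*} [Fintype ι] (z : ι → ℝ) (hz : ∀ j, 0 ≤ z j) :
    Real.log (1 + ∑ j, z j) ≤
      Real.log (1 + Fintype.card ι) + ((1 + ∑ j, z j) / (1 + Fintype.card ι) - 1) := by
  have h0 : 0 ≤ ∑ j, z j := Finset.sum_nonneg fun j _ => hz j
  have hN : (0 : ℝ) < 1 + Fintype.card ι := by positivity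
  have := Real.log_le_sub_one_of_pos (div_pos (by linarith : 0 < 1 + ∑ j, z j) hN)
  rw [Real.log_div (by linarith) hN.ne'] at this
  linarith

theorem Real.le_log_one_add_sum_exp {ι : Type*} [Fintype ι] (z : ι → ℝ) (j : ι) :
    z j ≤ Real.log (1 + ∑ j, Real.exp (z j)) := by
  rw [Real.le_log_iff_exp_le (by positivity)]
  have := Finset.single_le_sum (f := fun j => Real.exp (z j)) (fun i _ => (Real.exp_pos _).le)
    (Finset.mem_univ j)
  linarith

theorem Real.log_one_add_sum_exp_nonneg {ι : Type*} [Fintype ι] (z : ι → ℝ) :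
    0 ≤ Real.log (1 + ∑ j, Real.exp (z j)) :=
  Real.log_nonneg (le_add_of_nonneg_right (by positivity))

theorem Real.log_one_add_sum_exp_le {ι : Type*} [Fintype ι] (z : ι → ℝ) {c : ℝ} (hc : 0 ≤ c)
    (hz : ∀ j, z j ≤ c) :
    Real.log (1 + ∑ j, Real.exp (z j)) ≤ Real.log (1 + Fintype.card ι) + c := by
  have h1 : ∑ j, Real.exp (z j) ≤ Fintype.card ι * Real.exp c := by
    calc ∑ j, Real.exp (z j) ≤ ∑ _j : ι, Real.exp c :=
          Finset.sum_le_sum fun j _ => Real.exp_le_exp.2 (hz j)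
      _ = _ := by simp
  have h2 : 1 ≤ Real.exp c := Real.one_le_exp hc
  calc Real.log (1 + ∑ j, Real.exp (z j)) ≤ Real.log ((1 + Fintype.card ι) * Real.exp c) :=
        Real.log_le_log (by positivity) (by nlinarith)
    _ = _ := by rw [Real.log_mul (by positivity) (by positivity), Real.log_exp]

/-- A uniform lower-tail bound for sums of nonnegative functions of weakly dependent discrete
random variables. -/
theorem integral_log_one_add_sum_exp_le (P : Measure Ω) [IsProbabilityMeasure P]
    {ι : Type*} [Fintype ι] (U : ℕ → Ω → E) (hU : ∀ i, Measurable (U i)) {β : ℝ} (n : ℕ)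
    (hβ : ∀ i < n, ∑ a : Fin i → E, ∑ c : E,
      |P.real ((fun ω (k : Fin i) => U k ω) ⁻¹' {a} ∩ U i ⁻¹' {c}) -
        P.real ((fun ω (k : Fin i) => U k ω) ⁻¹' {a}) * P.real (U i ⁻¹' {c})| ≤ β)
    (H : ι → E → ℝ) (hH : ∀ j a, 0 ≤ H j a) {x r : ℝ} (hx1 : x ≤ 1) (hr : 0 ≤ r)
    (hHU : ∀ j i ω, r * H j (U i ω) ≤ x) (hx0 : 0 ≤ x) :
    ∫ ω, Real.log (1 + ∑ j, Real.exp (∑ k : Fin n,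
        (r * (1 - x) * (∫ ω', H j (U k ω') ∂P) - r * H j (U k ω)))) ∂P ≤
      Real.log (1 + Fintype.card ι) + n * β * (Real.log (1 + Fintype.card ι) + n) := by
  set N : ℝ := 1 + Fintype.card ι with hN
  have hN0 : 0 < N := by positivity
  set S : ι → (Fin n → E) → ℝ := fun j a => ∑ k : Fin n,
    (r * (1 - x) * (∫ ω', H j (U k ω') ∂P) - r * H j (a k)) with hS
  set G : (Fin n → E) → ℝ := fun a => Real.log (1 + ∑ j, Real.exp (S j a)) with hG
  have hUn : Measurable fun ω (k : Fin n) => U k ω := measurable_pi_lambda _ fun k => hU k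
  have h1 : ∫ ω, G (fun k : Fin n => U k ω) ∂P =
      ∑ a, P.real ((fun ω (k : Fin n) => U k ω) ⁻¹' {a}) * G a := integral_comp_eq_sum P hUn G
  have hmean : ∀ j (k : ℕ), r * ∫ ω', H j (U k ω') ∂P ≤ x := by
    intro j k
    rw [← integral_const_mul]
    calc _ ≤ ∫ _ω : Ω, x ∂P :=
          integral_mono ((integrable_comp_of_finite P (hU k) (H j)).const_mul r)
            (integrable_const _) fun ω => hHU j k ω
      _ = x := by simp
  have hG0 : ∀ a, 0 ≤ G a := fun a => Real.log_one_add_sum_exp_nonneg _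
  have hGle : ∀ a, G a ≤ Real.log N + n := by
    intro a
    refine Real.log_one_add_sum_exp_le _ (Nat.cast_nonneg n) fun j => ?_
    calc S j a ≤ ∑ _k : Fin n, (1 : ℝ) := by
          refine Finset.sum_le_sum fun k _ => ?_
          have h2 := hmean j k
          have h3 : 0 ≤ ∫ ω', H j (U k ω') ∂P := integral_nonneg fun ω => hH _ _
          have h4 := mul_nonneg hr (hH j (a k))
          have h5 := mul_nonneg hx0 (mul_nonneg hr h3)
          nlinarith
      _ = n := by simp
  have h2 := sum_abs_pi_sub_prod_le P U hU n hβ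
  have hprob : ∀ k : Fin n, ∑ c, P.real (U k ⁻¹' {c}) = 1 := fun k =>
    sum_measureReal_preimage_singleton_eq_one P (hU k)
  have h3 : ∑ a : Fin n → E, (∏ k : Fin n, P.real (U k ⁻¹' {a k})) = 1 := by
    have := Finset.prod_univ_sum (fun _ : Fin n => (Finset.univ : Finset E))
      (fun k c => P.real (U k ⁻¹' {c}))
    rw [Fintype.piFinset_univ] at this
    rw [← this]
    simp [hprob]
  -- Under the product law the exponential moment factorises. Each factor is at most e^s (1 - s) ≤
  -- e^s e^(-s) = 1, where s is r (1 - x) times the mean.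
  have h4 : ∀ j, ∑ a : Fin n → E, (∏ k : Fin n, P.real (U k ⁻¹' {a k})) * Real.exp (S j a) ≤ 1 := by
    intro j
    have h5 := Finset.prod_univ_sum (fun _ : Fin n => (Finset.univ : Finset E))
      (fun k c => P.real (U k ⁻¹' {c}) *
        Real.exp (r * (1 - x) * (∫ ω', H j (U k ω') ∂P) - r * H j c))
    rw [Fintype.piFinset_univ] at h5
    have h6 : ∑ a : Fin n → E, (∏ k : Fin n, P.real (U k ⁻¹' {a k})) * Real.exp (S j a) =
        ∏ k : Fin n, ∑ c, P.real (U k ⁻¹' {c}) *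
          Real.exp (r * (1 - x) * (∫ ω', H j (U k ω') ∂P) - r * H j c) := by
      rw [h5]
      refine Finset.sum_congr rfl fun a _ => ?_
      rw [hS, Real.exp_sum, ← Finset.prod_mul_distrib]
    rw [h6]
    refine Finset.prod_le_one
      (fun k _ => Finset.sum_nonneg fun c _ => mul_nonneg measureReal_nonneg (Real.exp_pos _).le)
      fun k _ => ?_
    rw [← integral_comp_eq_sum P (hU k)
      (fun c => Real.exp (r * (1 - x) * (∫ ω', H j (U k ω') ∂P) - r * H j c))]
    set μ := ∫ ω', H j (U k ω') ∂P with hμ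
    have hint := integrable_comp_of_finite P (hU k) (H j)
    calc ∫ ω, Real.exp (r * (1 - x) * μ - r * H j (U k ω)) ∂P
        ≤ ∫ ω, Real.exp (r * (1 - x) * μ) * (1 - r * (1 - x) * H j (U k ω)) ∂P := by
          refine integral_mono
            (integrable_comp_of_finite P (hU k) fun c => Real.exp (r * (1 - x) * μ - r * H j c))
            (((integrable_const _).sub (hint.const_mul _)).const_mul _) fun ω => ?_
          simp only
          rw [sub_eq_add_neg, Real.exp_add]
          refine mul_le_mul_of_nonneg_left ?_ (Real.exp_pos _).le
          refine (Real.exp_neg_le_one_sub_mul (mul_nonneg hr (hH _ _)) (hHU j k ω)).trans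
            (le_of_eq ?_)
          ring
      _ = Real.exp (r * (1 - x) * μ) * (1 - r * (1 - x) * μ) := by
          rw [integral_const_mul, integral_sub (integrable_const _) (hint.const_mul _),
            integral_const_mul]
          simp [hμ]
      _ ≤ Real.exp (r * (1 - x) * μ) * Real.exp (-(r * (1 - x) * μ)) := by
          refine mul_le_mul_of_nonneg_left ?_ (Real.exp_pos _).le
          linarith [Real.add_one_le_exp (-(r * (1 - x) * μ))]
      _ = 1 := by rw [← Real.exp_add]; simp
  have h7 : ∑ a : Fin n → E, (∏ k : Fin n, P.real (U k ⁻¹' {a k})) * G a ≤ Real.log N := by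
    calc _ ≤ ∑ a : Fin n → E, (∏ k : Fin n, P.real (U k ⁻¹' {a k})) *
          (Real.log N + ((1 + ∑ j, Real.exp (S j a)) / N - 1)) := by
          refine Finset.sum_le_sum fun a _ => mul_le_mul_of_nonneg_left ?_
            (Finset.prod_nonneg fun k _ => measureReal_nonneg)
          exact Real.log_one_add_sum_le _ fun j => (Real.exp_pos _).le
      _ = (∑ a : Fin n → E, (∏ k : Fin n, P.real (U k ⁻¹' {a k}))) * (Real.log N + (1 / N - 1)) +
          (∑ j, ∑ a : Fin n → E,
            (∏ k : Fin n, P.real (U k ⁻¹' {a k})) * Real.exp (S j a)) / N := by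
          rw [Finset.sum_comm, Finset.sum_mul, Finset.sum_div, ← Finset.sum_add_distrib]
          refine Finset.sum_congr rfl fun a _ => ?_
          rw [← Finset.mul_sum]
          ring
      _ ≤ (Real.log N + (1 / N - 1)) + (∑ _j : ι, (1 : ℝ)) / N := by
          rw [h3, one_mul]
          gcongr with j
          exact h4 j
      _ = Real.log N := by
          have : ∑ _j : ι, (1 : ℝ) = N - 1 := by simp [hN]
          rw [this]
          field_simp
          ring
  change ∫ ω, G (fun k : Fin n => U k ω) ∂P ≤ _
  rw [h1]
  have hGm : 0 ≤ Real.log N + n := by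
    have : 0 ≤ Real.log N := Real.log_nonneg (by rw [hN]; linarith [(Nat.cast_nonneg (Fintype.card ι) : (0 : ℝ) ≤ _)])
    positivity
  -- Change of law: as 0 ≤ G ≤ log N + n, the true law costs at most the ℓ¹ distance to the product
  -- law times log N + n.
  calc _ ≤ ∑ a : Fin n → E, ((∏ k : Fin n, P.real (U k ⁻¹' {a k})) * G a +
        |P.real ((fun ω (k : Fin n) => U k ω) ⁻¹' {a}) - ∏ k : Fin n, P.real (U k ⁻¹' {a k})| *
          (Real.log N + n)) := by
        refine Finset.sum_le_sum fun a _ => ?_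
        have e1 := le_abs_self (P.real ((fun ω (k : Fin n) => U k ω) ⁻¹' {a}) -
          ∏ k : Fin n, P.real (U k ⁻¹' {a k}))
        have e2 := mul_le_mul_of_nonneg_right e1 (hG0 a)
        have e3 := mul_le_mul_of_nonneg_left (hGle a) (abs_nonneg
          (P.real ((fun ω (k : Fin n) => U k ω) ⁻¹' {a}) - ∏ k : Fin n, P.real (U k ⁻¹' {a k})))
        linarith
    _ ≤ _ := by
        rw [Finset.sum_add_distrib, ← Finset.sum_mul]
        exact add_le_add h7 (mul_le_mul_of_nonneg_right h2 hGm)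

end Partitions

/-! ### Blocking of a β-mixing process -/

section Blocks

/-- The `i`-th block of length `b` and parity `p` of the times `1, …, T`. -/
def timeBlock (T b p i : ℕ) : Finset ℕ :=
  (Finset.Icc 1 T).filter fun t => (t - 1) / b = 2 * i + p

theorem mem_timeBlock {T b p i t : ℕ} (hb : 1 ≤ b) :
    t ∈ timeBlock T b p i ↔
      t ≤ T ∧ (2 * i + p) * b + 1 ≤ t ∧ t ≤ (2 * i + p) * b + b := by
  simp only [timeBlock, Finset.mem_filter, Finset.mem_Icc]
  constructor
  · rintro ⟨⟨h1, h2⟩, h3⟩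
    rw [Nat.div_eq_iff (by omega)] at h3
    refine ⟨h2, ?_, ?_⟩ <;> omega
  · rintro ⟨h1, h2, h3⟩
    refine ⟨⟨by omega, h1⟩, ?_⟩
    rw [Nat.div_eq_iff (by omega)]
    omega

theorem card_timeBlock_le {T b p i : ℕ} (hb : 1 ≤ b) : (timeBlock T b p i).card ≤ b := by
  calc (timeBlock T b p i).card
      ≤ (Finset.Icc ((2 * i + p) * b + 1) ((2 * i + p) * b + b)).card :=
        Finset.card_le_card fun t ht => Finset.mem_Icc.2 ((mem_timeBlock hb).1 ht).2
    _ = b := by rw [Nat.card_Icc]; omega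

theorem sum_timeBlock {T b : ℕ} (f : ℕ → ℝ) :
    ∑ t ∈ Finset.Icc 1 T, f t = ∑ i ∈ Finset.range T, ∑ t ∈ timeBlock T b 0 i, f t +
      ∑ i ∈ Finset.range T, ∑ t ∈ timeBlock T b 1 i, f t := by
  have h1 : ∀ (g : ℕ → ℝ) (n : ℕ), ∑ k ∈ Finset.range (2 * n), g k =
      ∑ i ∈ Finset.range n, g (2 * i) + ∑ i ∈ Finset.range n, g (2 * i + 1) := by
    intro g n
    induction n with
    | zero => simp
    | succ n ih =>
      rw [mul_add, mul_one, Finset.sum_range_succ, Finset.sum_range_succ, ih,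
        Finset.sum_range_succ, Finset.sum_range_succ]
      ring
  rw [← Finset.sum_fiberwise_of_maps_to (s := Finset.Icc 1 T) (t := Finset.range (2 * T))
    (g := fun t => (t - 1) / b), h1]
  · rfl
  · intro t ht
    rw [Finset.mem_Icc] at ht
    rw [Finset.mem_range]
    have := Nat.div_le_self (t - 1) b
    omega

variable {Ω : Type*} [mΩ : MeasurableSpace Ω] {α : Type*} [MeasurableSpace α]

theorem measurable_sigmaBetween {Ω : Type*} {X : ℕ → Ω → α} {a b t : ℕ} (ht : t ∈ Set.Icc a b) :
    Measurable[sigmaBetween X a b] (X t) :=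
  (comap_measurable (X t)).mono
    (le_iSup₂_of_le (f := fun s (_ : s ∈ Set.Icc a b) => MeasurableSpace.comap (X s) inferInstance)
      t ht le_rfl) le_rfl

theorem sigmaBetween_le {X : ℕ → Ω → α} {a b : ℕ} (hX : ∀ t ∈ Set.Icc a b, Measurable (X t)) :
    sigmaBetween X a b ≤ mΩ :=
  iSup₂_le fun t ht => (hX t ht).comap_le

/-- Boundedness is again needed for the real supremum; here only finitely many k are admissible. -/
theorem betaCoeff_le_betaMixing (P : Measure Ω) {T t k : ℕ} (X : ℕ → Ω → α) (hk : 1 ≤ k)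
    (hkt : k + t ≤ T) :
    betaCoeff P (sigmaBetween X 1 k) (sigmaBetween X (k + t) T) ≤ betaMixing P T X t := by
  refine le_csSup (Set.Finite.bddAbove ?_) ⟨k, hk, hkt, rfl⟩
  refine ((Set.finite_Icc 1 T).image fun k =>
    betaCoeff P (sigmaBetween X 1 k) (sigmaBetween X (k + t) T)).subset ?_
  rintro _ ⟨k, h1, h2, rfl⟩
  exact ⟨k, ⟨h1, by omega⟩, rfl⟩

/-- The values `f (X_t)` of a process on a block of times, and `0` at all other times. -/
def blockValue {Ω α V : Type*} [Zero V] (T b p : ℕ) (X : ℕ → Ω → α) (f : α → V) (i : ℕ) (ω : Ω) :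
    Fin (T + 1) → V :=
  fun t => if (t : ℕ) ∈ timeBlock T b p i then f (X t ω) else 0

theorem sum_blockValue {Ω α V : Type*} [Zero V] {T b p i : ℕ} (hb : 1 ≤ b) (X : ℕ → Ω → α)
    (f : α → V) (g : V → ℝ) (hg : g 0 = 0) (ω : Ω) :
    ∑ t, g (blockValue T b p X f i ω t) = ∑ t ∈ timeBlock T b p i, g (f (X t ω)) := by
  simp only [blockValue, apply_ite g, hg]
  rw [Fin.sum_univ_eq_sum_range (fun t => if t ∈ timeBlock T b p i then g (f (X t ω)) else 0) (T + 1),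
    ← Finset.sum_filter]
  refine Finset.sum_congr ?_ fun _ _ => rfl
  ext t
  simp only [Finset.mem_filter, Finset.mem_range, and_iff_right_iff_imp]
  intro ht
  have := ((mem_timeBlock hb).1 ht).1
  omega

theorem measurable_blockValue {Ω V : Type*} [Zero V] [MeasurableSpace V] {T b p i k l : ℕ}
    {X : ℕ → Ω → α} {f : α → V} (hf : Measurable f)
    (h : ∀ t ∈ timeBlock T b p i, t ∈ Set.Icc k l) :
    Measurable[sigmaBetween X k l] (blockValue T b p X f i) := by
  refine @measurable_pi_lambda _ _ _ (_) _ _ fun t => ?_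
  unfold blockValue
  split_ifs with ht
  · exact hf.comp (measurable_sigmaBetween (h t ht))
  · exact measurable_const

/-- The dependence between a block and the preceding ones of the same parity. -/
theorem sum_abs_blockValue_le (P : Measure Ω) [IsProbabilityMeasure P] {V : Type*} [Zero V]
    [Fintype V] [MeasurableSpace V] [MeasurableSingletonClass V] {T b p : ℕ} (hb : 1 ≤ b)
    {X : ℕ → Ω → α} (hX : ∀ t ∈ Set.Icc 1 T, Measurable (X t)) {f : α → V} (hf : Measurable f)
    {β : ℝ} (hβ0 : 0 ≤ β) (hβ : betaMixing P T X (b + 1) ≤ β) (i : ℕ) :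
    ∑ a : Fin i → Fin (T + 1) → V, ∑ c : Fin (T + 1) → V,
      |P.real ((fun ω (k : Fin i) => blockValue T b p X f k ω) ⁻¹' {a} ∩
          blockValue T b p X f i ⁻¹' {c}) -
        P.real ((fun ω (k : Fin i) => blockValue T b p X f k ω) ⁻¹' {a}) *
          P.real (blockValue T b p X f i ⁻¹' {c})| ≤ 2 * β := by
  rcases (timeBlock T b p i).eq_empty_or_nonempty with he | ⟨t₀, ht₀⟩
  · rw [sum_abs_joint_sub_prod_const_right P _ (v := 0)]
    · positivity
    · intro ω
      ext t
      simp [blockValue, he]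
  rcases Nat.eq_zero_or_pos i with rfl | hi
  · have : ∀ a : Fin 0 → Fin (T + 1) → V,
        (fun ω (k : Fin 0) => blockValue T b p X f k ω) ⁻¹' {a} = Set.univ := by
      intro a
      ext ω
      simp [Subsingleton.elim (fun k : Fin 0 => blockValue T b p X f k ω) a]
    simp only [this, Set.univ_inter, probReal_univ, one_mul, sub_self, abs_zero,
      Finset.sum_const_zero]
    positivity
  have ht := (mem_timeBlock hb).1 ht₀
  -- Earlier blocks of the same parity end by time k, and the current one starts at k + b + 1 after
  -- a skipped block of length b; hence the mixing coefficient at lag b + 1.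
  set k := (2 * i + p - 1) * b with hk
  have hkb : k + b = (2 * i + p) * b := by
    rw [hk, ← Nat.succ_mul]
    congr 1
    omega
  have hk1 : 1 ≤ k := Nat.one_le_iff_ne_zero.2 (Nat.mul_ne_zero (by omega) (by omega))
  have hkT : k + (b + 1) ≤ T := by omega
  refine (sum_abs_joint_sub_prod_le_betaCoeff P (𝒜 := sigmaBetween X 1 k)
    (ℬ := sigmaBetween X (k + (b + 1)) T)
    (sigmaBetween_le fun t ht => hX t ⟨ht.1, ht.2.trans (by omega)⟩)
    (sigmaBetween_le fun t ht => hX t ⟨le_trans (by omega) ht.1, ht.2⟩) ?_ ?_).trans ?_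
  · refine @measurable_pi_lambda _ _ _ (_) _ _ fun j => measurable_blockValue hf fun t ht => ?_
    have h1 := (mem_timeBlock hb).1 ht
    refine ⟨by omega, h1.2.2.trans ?_⟩
    have hj := j.2
    calc (2 * (j : ℕ) + p) * b + b = (2 * j + p + 1) * b := by ring
      _ ≤ k := Nat.mul_le_mul_right b (by omega)
  · refine measurable_blockValue hf fun t ht => ?_
    have h1 := (mem_timeBlock hb).1 ht
    exact ⟨by omega, h1.1⟩
  · have := betaCoeff_le_betaMixing P X hk1 hkT
    linarith

/-- A uniform lower-tail bound for sums of nonnegative bounded functions of a β-mixing process. -/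
theorem exists_integral_le_of_betaMixing (P : Measure Ω) [IsProbabilityMeasure P] {T b : ℕ}
    (hb : 1 ≤ b) {X : ℕ → Ω → α} (hX : ∀ t ∈ Set.Icc 1 T, Measurable (X t)) {β : ℝ}
    (hβ0 : 0 ≤ β) (hβ : betaMixing P T X (b + 1) ≤ β) {ι : Type*} [Fintype ι] (h : ι → α → ℝ)
    (hm : ∀ j, Measurable (h j)) (h0 : ∀ j a, 0 ≤ h j a) {M : ℝ} (hM : 0 < M)
    (hhM : ∀ j a, h j a ≤ M) {x : ℝ} (hx0 : 0 < x) (hx1 : x ≤ 1) {δ : ℝ} (hδ : 0 < δ) :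
    ∃ Z : Ω → ℝ, Integrable Z P ∧
      ∫ ω, Z ω ∂P ≤ M * b / x * (2 * ((1 + 2 * T * β) * Real.log (1 + Fintype.card ι) +
        2 * T ^ 2 * β)) ∧
      ∀ j ω, (1 - x) * ∑ t ∈ Finset.Icc 1 T, ∫ ω', h j (X t ω') ∂P ≤
        ∑ t ∈ Finset.Icc 1 T, h j (X t ω) + Z ω + T * δ := by
  classical
  -- Rounding down to multiples of δ makes all functions jointly finitely valued; over T times it
  -- costs at most T δ.
  set Q := ⌊M / δ⌋₊
  set w : ι → α → ℝ := fun j a => δ * ⌊h j a / δ⌋₊ with hw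
  set f : α → ι → Fin (Q + 1) := fun a j => ⟨⌊h j a / δ⌋₊, Nat.lt_succ_of_le
    (Nat.floor_le_floor (div_le_div_of_nonneg_right (hhM j a) hδ.le))⟩ with hf
  have hwh : ∀ j a, w j a ≤ h j a := by
    intro j a
    have := Nat.floor_le (div_nonneg (h0 j a) hδ.le)
    rw [le_div_iff₀ hδ] at this
    simp only [hw]
    linarith
  have hhw : ∀ j a, h j a ≤ w j a + δ := by
    intro j a
    have := Nat.lt_floor_add_one (h j a / δ)
    rw [div_lt_iff₀ hδ] at this
    simp only [hw]
    linarith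
  have hw0 : ∀ j a, 0 ≤ w j a := fun j a => by positivity
  have hfm : Measurable f := by
    refine measurable_pi_lambda _ fun j => ?_
    refine measurable_to_countable' fun c => ?_
    have : (fun a => f a j) ⁻¹' {c} = (fun a => ⌊h j a / δ⌋₊) ⁻¹' {(c : ℕ)} := by
      ext a
      simp [hf, Fin.ext_iff]
    rw [this]
    exact (Nat.measurable_floor.comp ((hm j).div_const δ)) (measurableSet_singleton _)
  have hwm : ∀ j, Measurable (w j) := fun j =>
    (measurable_from_nat.comp (Nat.measurable_floor.comp ((hm j).div_const δ))).const_mul δ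
  -- A block sum is at most M b, so r times it lies in [0, x], as the exponential inequality
  -- requires.
  set r : ℝ := x / (M * b) with hr
  have hb0 : (0 : ℝ) < b := by exact_mod_cast hb
  have hr0 : 0 < r := by positivity
  set H : ι → (Fin (T + 1) → ι → Fin (Q + 1)) → ℝ := fun j u => ∑ t, δ * ((u t j : ℕ) : ℝ) with hH
  have hH0 : ∀ j u, 0 ≤ H j u := fun j u => by positivity
  have hHU : ∀ p j i ω, H j (blockValue T b p X f i ω) = ∑ t ∈ timeBlock T b p i, w j (X t ω) := by
    intro p j i ω
    exact sum_blockValue hb X f (fun v => δ * ((v j : ℕ) : ℝ)) (by simp) ω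
  have hHle : ∀ p j i ω, r * H j (blockValue T b p X f i ω) ≤ x := by
    intro p j i ω
    have h1 : ∑ t ∈ timeBlock T b p i, w j (X t ω) ≤ b * M := by
      calc _ ≤ ∑ _t ∈ timeBlock T b p i, M :=
            Finset.sum_le_sum fun t _ => (hwh j _).trans (hhM j _)
        _ = (timeBlock T b p i).card * M := by simp
        _ ≤ b * M := by
          gcongr
          exact card_timeBlock_le hb
    rw [hHU]
    calc _ ≤ r * (b * M) := by gcongr
      _ = x := by rw [hr]; field_simp
  have hUm : ∀ p i, Measurable (blockValue T b p X f i) := fun p i =>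
    (measurable_blockValue hfm (k := 1) (l := T) fun t ht => by
      have := (mem_timeBlock hb).1 ht
      exact ⟨by omega, this.1⟩).mono (sigmaBetween_le hX) le_rfl
  set G : ℕ → Ω → ℝ := fun p ω => Real.log (1 + ∑ j, Real.exp (∑ k : Fin T,
    (r * (1 - x) * (∫ ω', H j (blockValue T b p X f k ω') ∂P) -
      r * H j (blockValue T b p X f k ω)))) with hG
  have hGle : ∀ p, ∫ ω, G p ω ∂P ≤ Real.log (1 + Fintype.card ι) +
      T * (2 * β) * (Real.log (1 + Fintype.card ι) + T) := fun p =>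
    integral_log_one_add_sum_exp_le P _ (hUm p) T
      (fun i _ => sum_abs_blockValue_le P hb hX hfm hβ0 hβ i) H hH0 hx1 hr0.le (hHle p) hx0.le
  have hGint : ∀ p, Integrable (G p) P := fun p =>
    integrable_comp_of_finite P (measurable_pi_lambda _ fun k : Fin T => hUm p k)
      fun a : Fin T → Fin (T + 1) → ι → Fin (Q + 1) =>
        Real.log (1 + ∑ j, Real.exp (∑ k : Fin T,
          (r * (1 - x) * (∫ ω', H j (blockValue T b p X f k ω') ∂P) - r * H j (a k))))
  have hwint : ∀ j, ∀ t ∈ Finset.Icc 1 T, Integrable (fun ω => w j (X t ω)) P := by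
    intro j t ht
    refine Integrable.of_bound
      ((hwm j).comp (hX t (by simpa using ht))).aestronglyMeasurable M (ae_of_all _ fun ω => ?_)
    rw [Real.norm_of_nonneg (hw0 _ _)]
    exact (hwh _ _).trans (hhM _ _)
  have hhint : ∀ j, ∀ t ∈ Finset.Icc 1 T, Integrable (fun ω => h j (X t ω)) P := by
    intro j t ht
    refine Integrable.of_bound
      ((hm j).comp (hX t (by simpa using ht))).aestronglyMeasurable M (ae_of_all _ fun ω => ?_)
    rw [Real.norm_of_nonneg (h0 _ _)]
    exact hhM _ _
  have hGge : ∀ p j ω, r * ((1 - x) * (∑ i ∈ Finset.range T, ∑ t ∈ timeBlock T b p i,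
      ∫ ω', w j (X t ω') ∂P) - ∑ i ∈ Finset.range T, ∑ t ∈ timeBlock T b p i, w j (X t ω)) ≤
      G p ω := by
    intro p j ω
    refine le_trans (le_of_eq ?_) (Real.le_log_one_add_sum_exp _ j)
    have h1 : ∀ k : Fin T, ∫ ω', H j (blockValue T b p X f k ω') ∂P =
        ∑ t ∈ timeBlock T b p k, ∫ ω', w j (X t ω') ∂P := by
      intro k
      simp only [hHU]
      exact integral_finsetSum _ fun t ht => hwint j t (Finset.mem_filter.1 ht).1
    simp only [h1]
    simp only [hHU]
    rw [Fin.sum_univ_eq_sum_range (fun k => r * (1 - x) *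
      (∑ t ∈ timeBlock T b p k, ∫ ω', w j (X t ω') ∂P) - r * ∑ t ∈ timeBlock T b p k, w j (X t ω)) T,
      Finset.sum_sub_distrib, ← Finset.mul_sum, ← Finset.mul_sum]
    ring
  -- The two parities are added, and division by r undoes the scaling; this produces the factor M b
  -- / x.
  refine ⟨fun ω => (G 0 ω + G 1 ω) / r, ((hGint 0).add (hGint 1)).div_const r, ?_, ?_⟩
  · rw [integral_div, integral_add (hGint 0) (hGint 1), div_eq_mul_inv, hr, inv_div, mul_comm]
    refine mul_le_mul_of_nonneg_left ?_ (by positivity)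
    linarith [hGle 0, hGle 1]
  · intro j ω
    have h1 := hGge 0 j ω
    have h2 := hGge 1 j ω
    have h3 : (1 - x) * (∑ t ∈ Finset.Icc 1 T, ∫ ω', w j (X t ω') ∂P) -
        ∑ t ∈ Finset.Icc 1 T, w j (X t ω) ≤ (G 0 ω + G 1 ω) / r := by
      rw [le_div_iff₀ hr0, sum_timeBlock (b := b), sum_timeBlock (b := b) (fun t => w j (X t ω))]
      linarith
    have h4 : ∑ t ∈ Finset.Icc 1 T, w j (X t ω) ≤ ∑ t ∈ Finset.Icc 1 T, h j (X t ω) :=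
      Finset.sum_le_sum fun t _ => hwh j _
    have h5 : ∑ t ∈ Finset.Icc 1 T, ∫ ω', h j (X t ω') ∂P ≤
        ∑ t ∈ Finset.Icc 1 T, ∫ ω', w j (X t ω') ∂P + T * δ := by
      calc _ ≤ ∑ t ∈ Finset.Icc 1 T, (∫ ω', w j (X t ω') ∂P + δ) := by
            refine Finset.sum_le_sum fun t ht => ?_
            calc _ ≤ ∫ ω', (w j (X t ω') + δ) ∂P :=
                  integral_mono (hhint j t ht) ((hwint j t ht).add (integrable_const _))
                    fun ω => hhw j _
              _ = _ := by rw [integral_add (hwint j t ht) (integrable_const _)]; simp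
        _ = _ := by simp [Finset.sum_add_distrib]
    have h6 := mul_le_mul_of_nonneg_left h5 (by linarith : 0 ≤ 1 - x)
    have h7 : 0 ≤ x * (T * δ) := by positivity
    linarith

end Blocks

/-! ### Conditionally sub-Gaussian noise and exponential supermartingales -/

section SubGaussian

theorem Real.exp_le_add_exp_sq (y : ℝ) : Real.exp y ≤ y + Real.exp (y ^ 2) := by
  have h1 := Real.add_one_le_exp (y ^ 2)
  rcases le_or_gt |y| 1 with h | h
  · have := (abs_le.1 (Real.abs_exp_sub_one_sub_id_le h)).2
    linarith
  rcases lt_abs.1 h with h | h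
  · have : Real.exp y ≤ Real.exp (y ^ 2) := Real.exp_le_exp.2 (by nlinarith)
    linarith
  · have : Real.exp y ≤ 1 := Real.exp_le_one_iff.2 (by linarith)
    nlinarith

/-- With θ = κ² a² ≤ 1, convexity gives exp((a v)²) ≤ 1 - θ + θ exp(v²/κ²). Conditionally on the
past the bound has mean at most 1 + θ, since a v is centred and the last exponential has mean at
most 2. -/
theorem Real.exp_mul_le_of_abs_mul_le_one {a v κ : ℝ} (hκ : 0 < κ) (ha : |a| * κ ≤ 1) :
    Real.exp (a * v) ≤
      a * v + 1 + κ ^ 2 * a ^ 2 * (Real.exp (v ^ 2 / κ ^ 2) - 1) := by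
  have hθ : κ ^ 2 * a ^ 2 ≤ 1 := by
    have : κ ^ 2 * a ^ 2 = (|a| * κ) ^ 2 := by rw [mul_pow, sq_abs]; ring
    rw [this]
    exact pow_le_one₀ (by positivity) ha
  have h1 := convexOn_exp.2 (Set.mem_univ (v ^ 2 / κ ^ 2)) (Set.mem_univ 0)
    (by positivity : 0 ≤ κ ^ 2 * a ^ 2) (by linarith : 0 ≤ 1 - κ ^ 2 * a ^ 2) (by ring)
  simp only [smul_eq_mul, mul_zero, add_zero, Real.exp_zero, mul_one] at h1
  have h2 : κ ^ 2 * a ^ 2 * (v ^ 2 / κ ^ 2) = (a * v) ^ 2 := by field_simp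
  rw [h2] at h1
  linarith [Real.exp_le_add_exp_sq (a * v)]

theorem Real.abs_le_mul_exp_sq_div {κ : ℝ} (hκ : 0 < κ) (v : ℝ) :
    |v| ≤ κ * Real.exp (v ^ 2 / κ ^ 2) := by
  have h1 := Real.add_one_le_exp (v ^ 2 / κ ^ 2)
  have h2 : |v| / κ ≤ v ^ 2 / κ ^ 2 + 1 := by
    have : v ^ 2 / κ ^ 2 = (|v| / κ) ^ 2 := by rw [div_pow, sq_abs]
    rw [this]
    nlinarith [sq_nonneg (|v| / κ - 1), sq_nonneg (|v| / κ)]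
  have h3 := h2.trans h1
  rw [div_le_iff₀ hκ] at h3
  linarith

variable {Ω : Type*} {m : MeasurableSpace Ω} [mΩ : MeasurableSpace Ω]

/-- Pulling a nonnegative weight out of a bound on a conditional expectation. -/
theorem integrable_mul_of_condExp_le (P : Measure Ω) [IsProbabilityMeasure P] (hm : m ≤ mΩ)
    {u φ : Ω → ℝ} (hu : Measurable[m] u) (hu0 : ∀ ω, 0 ≤ u ω) (hui : Integrable u P)
    (hφ : Measurable φ) (hφ0 : ∀ ω, 0 ≤ φ ω) (hφi : Integrable φ P) {c : ℝ} (hc : 0 ≤ c)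
    (h : P[φ | m] ≤ᵐ[P] fun _ => c) :
    Integrable (fun ω => u ω * φ ω) P ∧ ∫ ω, u ω * φ ω ∂P ≤ c * ∫ ω, u ω ∂P := by
  -- The weight u may be unbounded, so integrability of u φ is not known beforehand. The conditional
  -- bound says that φ P is at most c P on the σ-field m, and the nonnegative m-measurable u is
  -- integrated against both measures.
  set ν := P.withDensity fun ω => ENNReal.ofReal (φ ω) with hν
  have hle : ν.trim hm ≤ ENNReal.ofReal c • P.trim hm := by
    refine Measure.le_iff.2 fun A hA => ?_
    rw [trim_measurableSet_eq hm hA, Measure.smul_apply, trim_measurableSet_eq hm hA, hν,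
      withDensity_apply _ (hm A hA),
      ← ofReal_integral_eq_lintegral_ofReal hφi.integrableOn (ae_of_all _ hφ0),
      ← setIntegral_condExp hm hφi hA]
    calc ENNReal.ofReal (∫ ω in A, (P[φ | m]) ω ∂P) ≤ ENNReal.ofReal (∫ _ω in A, c ∂P) := by
          refine ENNReal.ofReal_le_ofReal ?_
          exact integral_mono_ae integrable_condExp.integrableOn (integrable_const c)
            (ae_restrict_of_ae h)
      _ = ENNReal.ofReal c • P A := by
          rw [setIntegral_const, smul_eq_mul, mul_comm, ENNReal.ofReal_mul hc, smul_eq_mul,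
            ofReal_measureReal]
  have hum : Measurable[m] fun ω => ENNReal.ofReal (u ω) := ENNReal.measurable_ofReal.comp hu
  have key : ∫⁻ ω, ENNReal.ofReal (u ω * φ ω) ∂P ≤ ENNReal.ofReal (c * ∫ ω, u ω ∂P) := by
    calc ∫⁻ ω, ENNReal.ofReal (u ω * φ ω) ∂P = ∫⁻ ω, ENNReal.ofReal (u ω) ∂ν := by
          rw [hν, lintegral_withDensity_eq_lintegral_mul _ hφ.ennreal_ofReal
            (hum.mono hm le_rfl)]
          refine lintegral_congr fun ω => ?_
          rw [Pi.mul_apply, ENNReal.ofReal_mul (hu0 ω), mul_comm]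
      _ = ∫⁻ ω, ENNReal.ofReal (u ω) ∂(ν.trim hm) := (lintegral_trim hm hum).symm
      _ ≤ ∫⁻ ω, ENNReal.ofReal (u ω) ∂(ENNReal.ofReal c • P.trim hm) := lintegral_mono' hle le_rfl
      _ = ENNReal.ofReal c * ∫⁻ ω, ENNReal.ofReal (u ω) ∂P := by
          rw [lintegral_smul_measure, lintegral_trim hm hum, smul_eq_mul]
      _ = _ := by
          rw [← ofReal_integral_eq_lintegral_ofReal hui (ae_of_all _ hu0), ENNReal.ofReal_mul hc]
  have hprod0 : ∀ ω, 0 ≤ u ω * φ ω := fun ω => mul_nonneg (hu0 ω) (hφ0 ω)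
  have hmeas : AEStronglyMeasurable (fun ω => u ω * φ ω) P :=
    ((hu.mono hm le_rfl).mul hφ).aestronglyMeasurable
  have hint : Integrable (fun ω => u ω * φ ω) P := by
    refine ⟨hmeas, ?_⟩
    rw [hasFiniteIntegral_iff_ofReal (ae_of_all _ hprod0)]
    exact key.trans_lt ENNReal.ofReal_lt_top
  refine ⟨hint, ?_⟩
  rw [← ofReal_integral_eq_lintegral_ofReal hint (ae_of_all _ hprod0)] at key
  exact (ENNReal.ofReal_le_ofReal_iff (mul_nonneg hc (integral_nonneg hu0))).1 key

theorem integrable_of_integrable_exp_sq (P : Measure Ω) {v : Ω → ℝ} (hv : Measurable v)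
    {κ : ℝ} (hκ : 0 < κ) (hφi : Integrable (fun ω => Real.exp ((v ω) ^ 2 / κ ^ 2)) P) :
    Integrable v P := by
  refine (hφi.const_mul κ).mono' hv.aestronglyMeasurable (ae_of_all _ fun ω => ?_)
  rw [Real.norm_eq_abs]
  exact Real.abs_le_mul_exp_sq_div hκ _

/-- One step of the exponential supermartingale of a conditionally sub-Gaussian noise with
predictable weights. -/
theorem integral_mul_exp_le_of_subGaussian (P : Measure Ω) [IsProbabilityMeasure P] (hm : m ≤ mΩ)
    {w a v : Ω → ℝ} (hw : Measurable[m] w) (hw0 : ∀ ω, 0 ≤ w ω) (hwi : Integrable w P)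
    (ha : Measurable[m] a) (hv : Measurable v) {κ : ℝ} (hκ : 0 < κ) (haκ : ∀ ω, |a ω| * κ ≤ 1)
    (hφi : Integrable (fun ω => Real.exp ((v ω) ^ 2 / κ ^ 2)) P)
    (hφ : P[fun ω => Real.exp ((v ω) ^ 2 / κ ^ 2) | m] ≤ᵐ[P] fun _ => 2)
    (hv0 : P[v | m] =ᵐ[P] 0) :
    Integrable (fun ω => w ω * Real.exp (a ω * v ω - κ ^ 2 * a ω ^ 2)) P ∧
      ∫ ω, w ω * Real.exp (a ω * v ω - κ ^ 2 * a ω ^ 2) ∂P ≤ ∫ ω, w ω ∂P := by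
  set θ : Ω → ℝ := fun ω => κ ^ 2 * a ω ^ 2 with hθ
  set φ : Ω → ℝ := fun ω => Real.exp ((v ω) ^ 2 / κ ^ 2) with hφdef
  -- The compensator is attached to the past weight, leaving exp(a v) to be bounded conditionally.
  set w' : Ω → ℝ := fun ω => w ω * Real.exp (-θ ω) with hw'
  have hφm : Measurable φ := Real.measurable_exp.comp ((hv.pow_const 2).div_const _)
  have hθm : Measurable[m] θ := (ha.pow_const 2).const_mul _
  have hθ0 : ∀ ω, 0 ≤ θ ω := fun ω => by positivity
  have hθ1 : ∀ ω, θ ω ≤ 1 := by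
    intro ω
    have : θ ω = (|a ω| * κ) ^ 2 := by rw [mul_pow, sq_abs]; simp only [hθ]; ring
    rw [this]
    exact pow_le_one₀ (by positivity) (haκ ω)
  have hw'm : Measurable[m] w' := hw.mul (Real.measurable_exp.comp hθm.neg)
  have hw'0 : ∀ ω, 0 ≤ w' ω := fun ω => mul_nonneg (hw0 ω) (Real.exp_pos _).le
  have hw'w : ∀ ω, w' ω ≤ w ω := fun ω =>
    mul_le_of_le_one_right (hw0 ω) (Real.exp_le_one_iff.2 (by linarith [hθ0 ω]))
  have hw'i : Integrable w' P := hwi.mono' (hw'm.mono hm le_rfl).aestronglyMeasurable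
    (ae_of_all _ fun ω => by rw [Real.norm_of_nonneg (hw'0 ω)]; exact hw'w ω)
  have hwθi : Integrable (fun ω => w' ω * θ ω) P :=
    hw'i.mono' ((hw'm.mul hθm).mono hm le_rfl).aestronglyMeasurable (ae_of_all _ fun ω => by
      rw [Real.norm_of_nonneg (mul_nonneg (hw'0 ω) (hθ0 ω))]
      exact mul_le_of_le_one_right (hw'0 ω) (hθ1 ω))
  obtain ⟨i1, -⟩ := integrable_mul_of_condExp_le P hm hw'm hw'0 hw'i hφm
    (fun ω => (Real.exp_pos _).le) hφi (by norm_num : (0 : ℝ) ≤ 2) hφ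
  obtain ⟨i2, h2⟩ := integrable_mul_of_condExp_le P hm (hw'm.mul hθm)
    (fun ω => mul_nonneg (hw'0 ω) (hθ0 ω)) hwθi hφm (fun ω => (Real.exp_pos _).le) hφi
    (by norm_num : (0 : ℝ) ≤ 2) hφ
  simp only [Pi.mul_apply] at i2 h2
  have hvi := integrable_of_integrable_exp_sq P hv hκ hφi
  have i3 : Integrable (fun ω => w' ω * a ω * v ω) P := by
    refine i1.mono' (((hw'm.mul ha).mono hm le_rfl).mul hv).aestronglyMeasurable
      (ae_of_all _ fun ω => ?_)
    have hvφ : |v ω| ≤ κ * φ ω := Real.abs_le_mul_exp_sq_div hκ _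
    rw [Real.norm_eq_abs, abs_mul, abs_mul, abs_of_nonneg (hw'0 ω)]
    have hφ0 : 0 ≤ φ ω := (Real.exp_pos _).le
    calc w' ω * |a ω| * |v ω| ≤ w' ω * |a ω| * (κ * φ ω) :=
          mul_le_mul_of_nonneg_left hvφ (mul_nonneg (hw'0 ω) (abs_nonneg _))
      _ = w' ω * φ ω * (|a ω| * κ) := by ring
      _ ≤ w' ω * φ ω := mul_le_of_le_one_right (mul_nonneg (hw'0 ω) hφ0) (haκ ω)
  have h3 : ∫ ω, w' ω * a ω * v ω ∂P = 0 := by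
    have e1 := condExp_mul_of_stronglyMeasurable_left (μ := P) (m := m) (f := fun ω => w' ω * a ω)
      (g := v) (hw'm.mul ha).stronglyMeasurable i3 hvi
    have e2 : ∫ ω, w' ω * a ω * v ω ∂P = ∫ ω, (P[(fun ω => w' ω * a ω) * v | m]) ω ∂P :=
      (integral_condExp hm).symm
    rw [e2, ← integral_zero Ω ℝ (μ := P)]
    refine integral_congr_ae ?_
    filter_upwards [e1, hv0] with ω h1 h2
    rw [h1, Pi.mul_apply, h2]
    simp
  have hbound : ∀ ω, w ω * Real.exp (a ω * v ω - κ ^ 2 * a ω ^ 2) ≤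
      w' ω - w' ω * θ ω + w' ω * a ω * v ω + w' ω * θ ω * φ ω := by
    intro ω
    have h1 := mul_le_mul_of_nonneg_left (Real.exp_mul_le_of_abs_mul_le_one (v := v ω) hκ (haκ ω))
      (hw'0 ω)
    have h2 : w ω * Real.exp (a ω * v ω - κ ^ 2 * a ω ^ 2) = w' ω * Real.exp (a ω * v ω) := by
      rw [sub_eq_neg_add, Real.exp_add, ← mul_assoc]
    rw [h2]
    refine h1.trans (le_of_eq ?_)
    simp only [hθ, hφdef]
    ring
  have i4 : Integrable (fun ω => w' ω - w' ω * θ ω) P := hw'i.sub hwθi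
  have i5 : Integrable (fun ω => w' ω - w' ω * θ ω + w' ω * a ω * v ω) P := i4.add i3
  have hRi : Integrable (fun ω => w' ω - w' ω * θ ω + w' ω * a ω * v ω + w' ω * θ ω * φ ω) P :=
    i5.add i2
  have hLi : Integrable (fun ω => w ω * Real.exp (a ω * v ω - κ ^ 2 * a ω ^ 2)) P := by
    refine hRi.mono' ?_ (ae_of_all _ fun ω => ?_)
    · have ha' := ha.mono hm le_rfl
      have hw'' := hw.mono hm le_rfl
      exact (hw''.mul (Real.measurable_exp.comp
        ((ha'.mul hv).sub ((ha'.pow_const 2).const_mul _)))).aestronglyMeasurable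
    · rw [Real.norm_of_nonneg (mul_nonneg (hw0 ω) (Real.exp_pos _).le)]
      exact hbound ω
  refine ⟨hLi, (integral_mono hLi hRi hbound).trans ?_⟩
  rw [integral_add i5 i2, integral_add i4 i3,
    integral_sub hw'i hwθi, h3]
  calc _ ≤ ∫ ω, w' ω ∂P + ∫ ω, w' ω * θ ω ∂P := by linarith
    _ = ∫ ω, (w' ω + w' ω * θ ω) ∂P := (integral_add hw'i hwθi).symm
    -- The compensator e^(-θ) cancels the growth 1 + θ ≤ e^θ.
    _ ≤ ∫ ω, w ω ∂P := by
      refine integral_mono (hw'i.add hwθi) hwi fun ω => ?_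
      have h1 := Real.add_one_le_exp (θ ω)
      have h2 : Real.exp (-θ ω) * Real.exp (θ ω) = 1 := by rw [← Real.exp_add]; simp
      have h3 : Real.exp (-θ ω) * (1 + θ ω) ≤ 1 := by
        rw [← h2]
        exact mul_le_mul_of_nonneg_left (by linarith) (Real.exp_pos _).le
      calc w' ω + w' ω * θ ω = w ω * (Real.exp (-θ ω) * (1 + θ ω)) := by simp only [hw']; ring
        _ ≤ w ω := mul_le_of_le_one_right (hw0 ω) h3

/-- The exponential supermartingale of a conditionally sub-Gaussian noise with predictable
weights. -/
theorem integral_exp_sum_le_one_of_subGaussian (P : Measure Ω) [IsProbabilityMeasure P]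
    (𝒢 : Filtration ℕ mΩ) {v a : ℕ → Ω → ℝ} {κ : ℕ → ℝ} (n : ℕ)
    (hκ : ∀ t ∈ Set.Icc 1 n, 0 < κ t)
    (hv : ∀ t ∈ Set.Icc 1 n, Measurable[𝒢 t] (v t))
    (ha : ∀ t ∈ Set.Icc 1 n, Measurable[𝒢 (t - 1)] (a t))
    (haκ : ∀ t ∈ Set.Icc 1 n, ∀ ω, |a t ω| * κ t ≤ 1)
    (hφi : ∀ t ∈ Set.Icc 1 n, Integrable (fun ω => Real.exp ((v t ω) ^ 2 / (κ t) ^ 2)) P)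
    (hφ : ∀ t ∈ Set.Icc 1 n,
      P[fun ω => Real.exp ((v t ω) ^ 2 / (κ t) ^ 2) | 𝒢 (t - 1)] ≤ᵐ[P] fun _ => 2)
    (hv0 : ∀ t ∈ Set.Icc 1 n, P[v t | 𝒢 (t - 1)] =ᵐ[P] 0) :
    Integrable (fun ω => Real.exp (∑ t ∈ Finset.Icc 1 n,
        (a t ω * v t ω - κ t ^ 2 * a t ω ^ 2))) P ∧
      ∫ ω, Real.exp (∑ t ∈ Finset.Icc 1 n, (a t ω * v t ω - κ t ^ 2 * a t ω ^ 2)) ∂P ≤ 1 := by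
  induction n with
  | zero => simp
  | succ n ih =>
    have hsub : ∀ t ∈ Set.Icc 1 n, t ∈ Set.Icc 1 (n + 1) := fun t ht => ⟨ht.1, by have := ht.2; omega⟩
    have hmem : n + 1 ∈ Set.Icc 1 (n + 1) := ⟨by omega, le_rfl⟩
    obtain ⟨i1, h1⟩ := ih (fun t ht => hκ t (hsub t ht)) (fun t ht => hv t (hsub t ht))
      (fun t ht => ha t (hsub t ht)) (fun t ht => haκ t (hsub t ht))
      (fun t ht => hφi t (hsub t ht)) (fun t ht => hφ t (hsub t ht))
      (fun t ht => hv0 t (hsub t ht))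
    have hwm : Measurable[𝒢 n] fun ω => Real.exp (∑ t ∈ Finset.Icc 1 n,
        (a t ω * v t ω - κ t ^ 2 * a t ω ^ 2)) := by
      refine Real.measurable_exp.comp (Finset.measurable_sum _ fun t ht => ?_)
      have ht' := Finset.mem_Icc.1 ht
      have e1 : Measurable[𝒢 n] (a t) :=
        (ha t (hsub t ⟨ht'.1, ht'.2⟩)).mono (𝒢.mono (by omega)) le_rfl
      have e2 : Measurable[𝒢 n] (v t) :=
        (hv t (hsub t ⟨ht'.1, ht'.2⟩)).mono (𝒢.mono ht'.2) le_rfl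
      exact (e1.mul e2).sub ((e1.pow_const 2).const_mul _)
    have key := integral_mul_exp_le_of_subGaussian P (𝒢.le n) hwm (fun ω => (Real.exp_pos _).le) i1
      (ha _ hmem) ((hv _ hmem).mono (𝒢.le _) le_rfl) (hκ _ hmem) (haκ _ hmem) (hφi _ hmem)
      (hφ _ hmem) (hv0 _ hmem)
    have heq : ∀ ω, Real.exp (∑ t ∈ Finset.Icc 1 (n + 1),
        (a t ω * v t ω - κ t ^ 2 * a t ω ^ 2)) = Real.exp (∑ t ∈ Finset.Icc 1 n,
        (a t ω * v t ω - κ t ^ 2 * a t ω ^ 2)) *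
        Real.exp (a (n + 1) ω * v (n + 1) ω - κ (n + 1) ^ 2 * a (n + 1) ω ^ 2) := by
      intro ω
      rw [Finset.sum_Icc_succ_top (by omega), Real.exp_add]
    simp only [heq]
    exact ⟨key.1, key.2.trans h1⟩

/-- A maximal inequality over finitely many predictable weights. -/
theorem exists_integral_le_of_subGaussian (P : Measure Ω) [IsProbabilityMeasure P]
    (𝒢 : Filtration ℕ mΩ) {ι : Type*} [Fintype ι] {v : ℕ → Ω → ℝ} {a : ι → ℕ → Ω → ℝ}
    {κ : ℕ → ℝ} (n : ℕ) (hκ : ∀ t ∈ Set.Icc 1 n, 0 < κ t)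
    (hv : ∀ t ∈ Set.Icc 1 n, Measurable[𝒢 t] (v t))
    (ha : ∀ j, ∀ t ∈ Set.Icc 1 n, Measurable[𝒢 (t - 1)] (a j t))
    (haκ : ∀ j, ∀ t ∈ Set.Icc 1 n, ∀ ω, |a j t ω| * κ t ≤ 1)
    (hφi : ∀ t ∈ Set.Icc 1 n, Integrable (fun ω => Real.exp ((v t ω) ^ 2 / (κ t) ^ 2)) P)
    (hφ : ∀ t ∈ Set.Icc 1 n,
      P[fun ω => Real.exp ((v t ω) ^ 2 / (κ t) ^ 2) | 𝒢 (t - 1)] ≤ᵐ[P] fun _ => 2)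
    (hv0 : ∀ t ∈ Set.Icc 1 n, P[v t | 𝒢 (t - 1)] =ᵐ[P] 0) :
    ∃ Z : Ω → ℝ, Integrable Z P ∧ ∫ ω, Z ω ∂P ≤ Real.log (1 + Fintype.card ι) ∧
      ∀ j ω, ∑ t ∈ Finset.Icc 1 n, (a j t ω * v t ω - κ t ^ 2 * a j t ω ^ 2) ≤ Z ω := by
  set S : ι → Ω → ℝ := fun j ω =>
    ∑ t ∈ Finset.Icc 1 n, (a j t ω * v t ω - κ t ^ 2 * a j t ω ^ 2) with hS
  have hM := fun j => integral_exp_sum_le_one_of_subGaussian P 𝒢 n hκ hv (ha j) (haκ j) hφi hφ hv0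
  have hsum : Integrable (fun ω => ∑ j, Real.exp (S j ω)) P :=
    integrable_finsetSum _ fun j _ => (hM j).1
  set N : ℝ := 1 + Fintype.card ι with hN
  have hN0 : 0 < N := by positivity
  have i1 : Integrable (fun ω => 1 + ∑ j, Real.exp (S j ω)) P := (integrable_const _).add hsum
  have i2 : Integrable (fun ω => (1 + ∑ j, Real.exp (S j ω)) / N - 1) P :=
    (i1.div_const _).sub (integrable_const _)
  have hRi : Integrable (fun ω => Real.log N + ((1 + ∑ j, Real.exp (S j ω)) / N - 1)) P :=
    (integrable_const _).add i2
  have hZi : Integrable (fun ω => Real.log (1 + ∑ j, Real.exp (S j ω))) P := by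
    refine hRi.mono' ?_ (ae_of_all _ fun ω => ?_)
    · exact (Real.measurable_log.comp_aemeasurable
        i1.aestronglyMeasurable.aemeasurable).aestronglyMeasurable
    · rw [Real.norm_of_nonneg (Real.log_one_add_sum_exp_nonneg _)]
      exact Real.log_one_add_sum_le _ fun j => (Real.exp_pos _).le
  refine ⟨_, hZi, ?_, fun j ω => Real.le_log_one_add_sum_exp (fun j => S j ω) j⟩
  calc _ ≤ ∫ ω, (Real.log N + ((1 + ∑ j, Real.exp (S j ω)) / N - 1)) ∂P :=
        integral_mono hZi hRi fun ω => Real.log_one_add_sum_le _ fun j => (Real.exp_pos _).le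
    _ = Real.log N + ((1 + ∑ j, ∫ ω, Real.exp (S j ω) ∂P) / N - 1) := by
        rw [integral_add (integrable_const _) i2,
          integral_sub (i1.div_const _) (integrable_const _),
          integral_div, integral_add (integrable_const _) hsum,
          integral_finsetSum _ fun j _ => (hM j).1]
        simp [hS]
    _ ≤ Real.log N + ((1 + ∑ _j : ι, (1 : ℝ)) / N - 1) := by
        gcongr with j
        exact (hM j).2
    _ = Real.log N := by
        have : 1 + ∑ _j : ι, (1 : ℝ) = N := by simp [hN]
        rw [this, div_self hN0.ne']
        ring

end SubGaussian

/-! ### Elementary properties of the network class -/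

theorem sparseDNNClass.eq_zero_of_notMem {d : ℕ} {σ : ℝ → ℝ} {L N B F S : ℝ}
    {f : (Fin d → ℝ) → ℝ} (hf : f ∈ sparseDNNClass d σ L N B F S) {x : Fin d → ℝ}
    (hx : x ∉ unitCube d) : f x = 0 := by
  obtain ⟨g, -, -, -, -, -, -, rfl⟩ := hf
  exact Set.indicator_of_notMem hx _

theorem sparseDNNClass.abs_le {d : ℕ} {σ : ℝ → ℝ} {L N B F S : ℝ} (hF : 0 ≤ F)
    {f : (Fin d → ℝ) → ℝ} (hf : f ∈ sparseDNNClass d σ L N B F S) (x : Fin d → ℝ) :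
    |f x| ≤ F := by
  by_cases hx : x ∈ unitCube d
  · obtain ⟨g, -, -, -, -, -, h, rfl⟩ := hf
    rw [Set.indicator_of_mem hx]
    exact h x hx
  · rw [sparseDNNClass.eq_zero_of_notMem hf hx, abs_zero]
    exact hF

theorem measurableSet_unitCube (d : ℕ) : MeasurableSet (unitCube d) := measurableSet_Icc

theorem sparseDNNClass.measurable {d : ℕ} {σ : ℝ → ℝ} (hσ : Continuous σ) {L N B F S : ℝ}
    {f : (Fin d → ℝ) → ℝ} (hf : f ∈ sparseDNNClass d σ L N B F S) : Measurable f := by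
  obtain ⟨g, -, -, -, -, -, -, rfl⟩ := hf
  exact ((continuous_apply 0).comp (g.continuous_eval hσ)).measurable.indicator
    (measurableSet_unitCube d)

/-- The entropy bound assumes S ≥ 1; below 1 every parameter vanishes and the class has at most one
element. -/
theorem sparseDNNClass.eq_zero_of_lt_one {d : ℕ} {σ : ℝ → ℝ} {L N B F S : ℝ} (hS : S < 1)
    {f : (Fin d → ℝ) → ℝ} (hf : f ∈ sparseDNNClass d σ L N B F S) : f = 0 := by
  obtain ⟨g, -, -, -, -, h, -, rfl⟩ := hf
  have h0 : g.sparsity = 0 := by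
    have : (g.sparsity : ℝ) < 1 := h.trans_lt hS
    exact_mod_cast Nat.lt_one_iff.1 (by exact_mod_cast this)
  have hθ : ∀ a ∈ g.theta, a = 0 := by
    rw [DNN.sparsity, List.length_eq_zero_iff, List.filter_eq_nil_iff] at h0
    simpa using h0
  ext x
  simp [DNN.eval_eq_zero g hθ]

theorem unitCube_nonempty (d : ℕ) : (0 : Fin d → ℝ) ∈ unitCube d :=
  ⟨le_rfl, fun _ => zero_le_one⟩

/-! ### Empirical risk and measurability of its infimum -/

section Risk

variable {Ω : Type*} [mΩ : MeasurableSpace Ω] {d : ℕ} {P : Measure Ω} {T : ℕ}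
  {X : ℕ → Ω → (Fin d → ℝ)} {v Y : ℕ → Ω → ℝ} {m η : (Fin d → ℝ) → ℝ}

theorem empRisk_nonneg {Ω : Type*} {X : ℕ → Ω → (Fin d → ℝ)} {Y : ℕ → Ω → ℝ}
    (f : (Fin d → ℝ) → ℝ) (ω : Ω) : 0 ≤ empRisk T X Y f ω := by
  unfold empRisk
  positivity

theorem bddBelow_empRisk {Ω : Type*} {X : ℕ → Ω → (Fin d → ℝ)} {Y : ℕ → Ω → ℝ}
    (𝓕 : Set ((Fin d → ℝ) → ℝ)) (ω : Ω) :
    BddBelow (Set.range fun f : 𝓕 => empRisk T X Y f ω) :=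
  ⟨0, by rintro _ ⟨f, rfl⟩; exact empRisk_nonneg _ _⟩

theorem optGap_nonneg {𝓕 : Set ((Fin d → ℝ) → ℝ)} {fhat : Ω → (Fin d → ℝ) → ℝ}
    (h : ∀ ω, fhat ω ∈ 𝓕) : 0 ≤ optGap P T X Y 𝓕 fhat :=
  integral_nonneg fun ω => sub_nonneg.2 (ciInf_le (bddBelow_empRisk 𝓕 ω) ⟨fhat ω, h ω⟩)

theorem genError_nonneg (fhat : Ω → (Fin d → ℝ) → ℝ) (f₀ : (Fin d → ℝ) → ℝ) :
    0 ≤ genError P T X fhat f₀ :=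
  integral_nonneg fun ω => by positivity

/-- The difference of two empirical risks, in terms of the noise. -/
theorem mul_empRisk_sub_empRisk {Ω : Type*} {X : ℕ → Ω → (Fin d → ℝ)} {v Y : ℕ → Ω → ℝ}
    (hT : T ≠ 0)
    (hY : ∀ t ∈ Set.Icc 1 T, ∀ ω, Y t ω = m (X t ω) + η (X t ω) * v t ω)
    {f f' : (Fin d → ℝ) → ℝ} (hf : ∀ x ∉ unitCube d, f x = 0)
    (hf' : ∀ x ∉ unitCube d, f' x = 0) (ω : Ω) :
    T * (empRisk T X Y f ω - empRisk T X Y f' ω) =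
      ∑ t ∈ Finset.Icc 1 T, (f (X t ω) - (unitCube d).indicator m (X t ω)) ^ 2 -
      ∑ t ∈ Finset.Icc 1 T, (f' (X t ω) - (unitCube d).indicator m (X t ω)) ^ 2 -
      2 * ∑ t ∈ Finset.Icc 1 T, (unitCube d).indicator η (X t ω) * v t ω *
        (f (X t ω) - (unitCube d).indicator m (X t ω)) +
      2 * ∑ t ∈ Finset.Icc 1 T, (unitCube d).indicator η (X t ω) * v t ω *
        (f' (X t ω) - (unitCube d).indicator m (X t ω)) := by
  have hT' : (T : ℝ) ≠ 0 := by exact_mod_cast hT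
  unfold empRisk
  rw [← mul_sub, ← mul_assoc, mul_one_div_cancel hT', one_mul, Finset.mul_sum, Finset.mul_sum,
    ← Finset.sum_sub_distrib, ← Finset.sum_sub_distrib, ← Finset.sum_sub_distrib,
    ← Finset.sum_add_distrib]
  refine Finset.sum_congr rfl fun t ht => ?_
  rw [hY t (by simpa using ht)]
  by_cases hx : X t ω ∈ unitCube d
  · simp only [Set.indicator_of_mem hx]
    ring
  -- Off the cube both predictions are 0 and the squares of Y_t cancel, so m and η need no bound
  -- there.
  · simp [hf _ hx, hf' _ hx, Set.indicator_of_notMem hx]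

theorem abs_empRisk_sub_empRisk_le {Ω : Type*} {X : ℕ → Ω → (Fin d → ℝ)} {Y : ℕ → Ω → ℝ}
    {F δ : ℝ} {f f' : (Fin d → ℝ) → ℝ} (hf : ∀ x, |f x| ≤ F) (hf' : ∀ x, |f' x| ≤ F)
    (h : ∀ x, |f x - f' x| ≤ δ) (ω : Ω) :
    |empRisk T X Y f ω - empRisk T X Y f' ω| ≤
      δ * (1 / T * ∑ t ∈ Finset.Icc 1 T, (2 * |Y t ω| + 2 * F)) := by
  unfold empRisk
  rw [← mul_sub, ← Finset.sum_sub_distrib, abs_mul, abs_of_nonneg (by positivity : (0:ℝ) ≤ 1 / T),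
    mul_left_comm, Finset.mul_sum]
  refine mul_le_mul_of_nonneg_left ?_ (by positivity)
  refine (Finset.abs_sum_le_sum_abs _ _).trans (Finset.sum_le_sum fun t _ => ?_)
  have h1 : (Y t ω - f (X t ω)) ^ 2 - (Y t ω - f' (X t ω)) ^ 2 =
      (f (X t ω) - f' (X t ω)) * -(Y t ω + Y t ω - f (X t ω) - f' (X t ω)) := by ring
  have h2 : |Y t ω + Y t ω - f (X t ω) - f' (X t ω)| ≤ 2 * |Y t ω| + 2 * F := by
    have e1 := abs_sub (Y t ω + Y t ω - f (X t ω)) (f' (X t ω))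
    have e2 := abs_sub (Y t ω + Y t ω) (f (X t ω))
    have e3 := abs_add_le (Y t ω) (Y t ω)
    linarith [hf (X t ω), hf' (X t ω)]
  rw [h1, abs_mul, abs_neg]
  exact mul_le_mul (h _) h2 (abs_nonneg _) ((abs_nonneg _).trans (h (X t ω)))

/-- The infimum of the empirical risk over a class that is totally bounded for the sup norm is
measurable. -/
theorem measurable_iInf_empRisk (hX : ∀ t ∈ Set.Icc 1 T, Measurable (X t))
    (hY : ∀ t ∈ Set.Icc 1 T, Measurable (Y t)) {𝓕 : Set ((Fin d → ℝ) → ℝ)} (hne : 𝓕.Nonempty)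
    (hm : ∀ f ∈ 𝓕, Measurable f) {F : ℝ} (hF : ∀ f ∈ 𝓕, ∀ x, |f x| ≤ F)
    (hcov : ∀ δ : ℝ, 0 < δ → ∃ A : Finset ((Fin d → ℝ) → ℝ), (A : Set _) ⊆ 𝓕 ∧
      ∀ f ∈ 𝓕, ∃ f' ∈ A, ∀ x, |f x - f' x| ≤ δ) :
    Measurable fun ω => ⨅ f : 𝓕, empRisk T X Y f ω := by
  -- The union of the covers of radius 1/(n + 1) is a countable sup-norm dense subfamily, over which
  -- the infimum is unchanged.
  choose A hA hAcov using fun n : ℕ => hcov (1 / (n + 1)) (by positivity)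
  set 𝓕₀ : Set ((Fin d → ℝ) → ℝ) := ⋃ n, (A n : Set _) with h𝓕₀
  have hsub : 𝓕₀ ⊆ 𝓕 := Set.iUnion_subset hA
  have hc : Countable 𝓕₀ := (Set.countable_iUnion fun n => (A n).countable_toSet).to_subtype
  have : Nonempty 𝓕 := hne.to_subtype
  have : Nonempty 𝓕₀ := by
    obtain ⟨f, hf⟩ := hne
    obtain ⟨f', hf', -⟩ := hAcov 0 f hf
    exact ⟨⟨f', Set.mem_iUnion.2 ⟨0, hf'⟩⟩⟩
  have heq : (fun ω => ⨅ f : 𝓕, empRisk T X Y f ω) = fun ω => ⨅ f : 𝓕₀, empRisk T X Y f ω := by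
    ext ω
    refine le_antisymm ?_ ?_
    · exact le_ciInf fun f => ciInf_le (bddBelow_empRisk 𝓕 ω) ⟨f.1, hsub f.2⟩
    · refine le_ciInf fun f => le_of_forall_pos_le_add fun ε hε => ?_
      set c := 1 / (T : ℝ) * ∑ t ∈ Finset.Icc 1 T, (2 * |Y t ω| + 2 * F) with hc
      have hc0 : 0 ≤ c := by
        obtain ⟨f, hf⟩ := hne
        have : 0 ≤ F := (abs_nonneg _).trans (hF f hf 0)
        positivity
      obtain ⟨n, hn⟩ := exists_nat_one_div_lt (show 0 < ε / (c + 1) by positivity)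
      obtain ⟨f', hf', hff⟩ := hAcov n f f.2
      have h1 := abs_empRisk_sub_empRisk_le (T := T) (X := X) (Y := Y) (hF f f.2)
        (hF f' (hA n hf')) hff ω
      have h2 : (1 / ((n : ℝ) + 1)) * c ≤ ε := by
        have := mul_le_mul_of_nonneg_right hn.le hc0
        have h3 : ε / (c + 1) * c ≤ ε := by
          rw [div_mul_eq_mul_div, div_le_iff₀ (by positivity)]
          nlinarith
        linarith
      have h4 := ciInf_le (bddBelow_empRisk (T := T) (X := X) (Y := Y) 𝓕₀ ω)
        ⟨f', Set.mem_iUnion.2 ⟨n, hf'⟩⟩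
      simp only at h4
      have h5 := neg_le_of_abs_le h1
      linarith
  rw [heq]
  refine Measurable.iInf fun f => ?_
  unfold empRisk
  refine (Finset.measurable_sum _ fun t ht => ?_).const_mul _
  have ht' : t ∈ Set.Icc 1 T := by simpa using ht
  exact ((hY t ht').sub ((hm f (hsub f.2)).comp (hX t ht'))).pow_const 2

end Risk

/-! ### Consequences of the model assumptions -/

namespace RegressionModel

variable {Ω : Type*} [mΩ : MeasurableSpace Ω] {d : ℕ} {P : Measure Ω} {𝒢 : Filtration ℕ mΩ}
  {T : ℕ} {X : ℕ → Ω → (Fin d → ℝ)} {v Y : ℕ → Ω → ℝ} {m η : (Fin d → ℝ) → ℝ} {Cη C₁ C₂ K : ℝ}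

theorem measurable_X (h : RegressionModel P 𝒢 T X v Y m η Cη C₁ C₂ K) {t : ℕ}
    (ht : t ∈ Set.Icc 1 T) : Measurable (X t) :=
  (h.predictable t ht).mono (𝒢.le _) le_rfl

theorem measurable_v (h : RegressionModel P 𝒢 T X v Y m η Cη C₁ C₂ K) {t : ℕ}
    (ht : t ∈ Set.Icc 1 T) : Measurable (v t) :=
  (h.adapted t ht).mono (𝒢.le _) le_rfl

theorem measurable_Y (h : RegressionModel P 𝒢 T X v Y m η Cη C₁ C₂ K) {t : ℕ}
    (ht : t ∈ Set.Icc 1 T) : Measurable (Y t) := by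
  have : Y t = fun ω => m (X t ω) + η (X t ω) * v t ω := funext (h.model t ht)
  rw [this]
  exact (h.measurable_m.comp (h.measurable_X ht)).add
    ((h.measurable_η.comp (h.measurable_X ht)).mul (h.measurable_v ht))

theorem Cη_nonneg (h : RegressionModel P 𝒢 T X v Y m η Cη C₁ C₂ K) : 0 ≤ Cη :=
  (abs_nonneg _).trans (h.η_le 0 (unitCube_nonempty d))

theorem abs_indicator_η_le (h : RegressionModel P 𝒢 T X v Y m η Cη C₁ C₂ K) (x : Fin d → ℝ) :
    |(unitCube d).indicator η x| ≤ Cη := by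
  by_cases hx : x ∈ unitCube d
  · rw [Set.indicator_of_mem hx]
    exact h.η_le x hx
  · rw [Set.indicator_of_notMem hx, abs_zero]
    exact h.Cη_nonneg

theorem measurable_indicator_η (h : RegressionModel P 𝒢 T X v Y m η Cη C₁ C₂ K) :
    Measurable ((unitCube d).indicator η) :=
  h.measurable_η.indicator (measurableSet_unitCube d)

theorem measurable_indicator_m (h : RegressionModel P 𝒢 T X v Y m η Cη C₁ C₂ K) :
    Measurable ((unitCube d).indicator m) :=
  h.measurable_m.indicator (measurableSet_unitCube d)

theorem integrable_v (h : RegressionModel P 𝒢 T X v Y m η Cη C₁ C₂ K) {t : ℕ}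
    (ht : t ∈ Set.Icc 1 T) : Integrable (v t) P := by
  obtain ⟨κ, hκ⟩ := h.subGaussian
  obtain ⟨h1, -, h2, -⟩ := hκ t ht
  exact integrable_of_integrable_exp_sq P (h.measurable_v ht) h1 h2

theorem integral_abs_v_le [IsProbabilityMeasure P]
    (h : RegressionModel P 𝒢 T X v Y m η Cη C₁ C₂ K) {t : ℕ}
    (ht : t ∈ Set.Icc 1 T) : ∫ ω, |v t ω| ∂P ≤ 1 := by
  have h1 : ∫ ω, (v t ω) ^ 2 ∂P = 1 := by
    rw [← integral_condExp (𝒢.le (t - 1)), integral_congr_ae (h.variance t ht)]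
    simp
  have h2 : Integrable (fun ω => (v t ω) ^ 2) P := by
    -- A non-integrable function has Bochner integral 0, so the value 1 already forces
    -- integrability.
    by_contra hc
    rw [integral_undef hc] at h1
    exact zero_ne_one h1
  have h3 : ∫ ω, |v t ω| ∂P ≤ ∫ ω, ((v t ω) ^ 2 / 2 + 1 / 2) ∂P := by
    refine integral_mono (h.integrable_v ht).abs ((h2.div_const 2).add (integrable_const _))
      fun ω => ?_
    have := sq_nonneg (|v t ω| - 1)
    rw [sub_sq, sq_abs] at this
    simp only
    linarith
  rw [integral_add (h2.div_const 2) (integrable_const _), integral_div, h1] at h3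
  simp at h3
  linarith

/-- The factor multiplying v_t is a bounded function of X_t and hence predictable. This fails for
`fhat`, which depends on the whole sample. -/
theorem integral_noise_mul_eq_zero [IsProbabilityMeasure P]
    (h : RegressionModel P 𝒢 T X v Y m η Cη C₁ C₂ K) {g : (Fin d → ℝ) → ℝ} (hg : Measurable g)
    {M : ℝ} (hM : ∀ x, |g x| ≤ M) {t : ℕ} (ht : t ∈ Set.Icc 1 T) :
    ∫ ω, (unitCube d).indicator η (X t ω) * v t ω * g (X t ω) ∂P = 0 := by
  set u : Ω → ℝ := fun ω => (unitCube d).indicator η (X t ω) * g (X t ω) with hu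
  have hum : Measurable[𝒢 (t - 1)] u :=
    (h.measurable_indicator_η.comp (h.predictable t ht)).mul (hg.comp (h.predictable t ht))
  have hub : ∀ ω, |u ω| ≤ Cη * M := fun ω => by
    rw [hu, abs_mul]
    exact mul_le_mul (h.abs_indicator_η_le _) (hM _) (abs_nonneg _) h.Cη_nonneg
  have hint : Integrable (fun ω => u ω * v t ω) P :=
    (h.integrable_v ht).bdd_mul (hum.mono (𝒢.le _) le_rfl).aestronglyMeasurable
      (ae_of_all _ hub)
  have e1 := condExp_mul_of_stronglyMeasurable_left (μ := P) (m := 𝒢 (t - 1)) (f := u)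
    (g := v t) hum.stronglyMeasurable hint (h.integrable_v ht)
  have e2 : ∫ ω, (unitCube d).indicator η (X t ω) * v t ω * g (X t ω) ∂P =
      ∫ ω, (P[u * v t | 𝒢 (t - 1)]) ω ∂P := by
    rw [integral_condExp (𝒢.le (t - 1))]
    refine integral_congr_ae (ae_of_all _ fun ω => ?_)
    simp only [hu, Pi.mul_apply]
    ring
  rw [e2, ← integral_zero Ω ℝ (μ := P)]
  refine integral_congr_ae ?_
  filter_upwards [e1, h.centred t ht] with ω h1 h2
  rw [h1, Pi.mul_apply, h2]
  simp

theorem measurable_estimator (h : RegressionModel P 𝒢 T X v Y m η Cη C₁ C₂ K)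
    {fhat : Ω → (Fin d → ℝ) → ℝ} (hf : IsEstimator T X Y fhat) :
    Measurable fun p : Ω × (Fin d → ℝ) => fhat p.1 p.2 := by
  have hle : sigmaBetween (fun t ω => (Y t ω, X t ω)) 1 T ≤ mΩ :=
    sigmaBetween_le fun t ht => (h.measurable_Y ht).prodMk (h.measurable_X ht)
  exact Measurable.mono hf (sup_le_sup (MeasurableSpace.comap_mono hle) le_rfl) le_rfl

end RegressionModel

theorem abs_sq_sub_sq_le {a b c δ : ℝ} (ha : |a| ≤ c) (hb : |b| ≤ c) (h : |a - b| ≤ δ) :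
    |a ^ 2 - b ^ 2| ≤ 2 * c * δ := by
  have h1 : a ^ 2 - b ^ 2 = (a + b) * (a - b) := by ring
  rw [h1, abs_mul]
  exact mul_le_mul ((abs_add_le a b).trans (by linarith)) h (abs_nonneg _)
    (by linarith [abs_nonneg a])

/-! ### The oracle inequality over a finite cover -/

section Oracle

variable {Ω : Type*} [mΩ : MeasurableSpace Ω] {d : ℕ} {P : Measure Ω} [IsProbabilityMeasure P]
  {𝒢 : Filtration ℕ mΩ} {T : ℕ} {X : ℕ → Ω → (Fin d → ℝ)} {v Y : ℕ → Ω → ℝ}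
  {m η : (Fin d → ℝ) → ℝ} {Cη C₁ C₂ K F : ℝ} {𝓕 : Set ((Fin d → ℝ) → ℝ)}
  {fhat : Ω → (Fin d → ℝ) → ℝ}

/-- The cumulative squared error of `f` along the path of `X`. -/
noncomputable def sqErr (T : ℕ) (X : ℕ → Ω → (Fin d → ℝ)) (f₀ f : (Fin d → ℝ) → ℝ) (ω : Ω) : ℝ :=
  ∑ t ∈ Finset.Icc 1 T, (f (X t ω) - f₀ (X t ω)) ^ 2

/-- The cumulative noise term of `f` along the path of `X`. -/
noncomputable def noiseErr (T : ℕ) (X : ℕ → Ω → (Fin d → ℝ)) (v : ℕ → Ω → ℝ)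
    (f₀ e f : (Fin d → ℝ) → ℝ) (ω : Ω) : ℝ :=
  ∑ t ∈ Finset.Icc 1 T, e (X t ω) * v t ω * (f (X t ω) - f₀ (X t ω))

theorem abs_indicator_le {m : (Fin d → ℝ) → ℝ} (hF0 : 0 ≤ F) (hmF : ∀ x ∈ unitCube d, |m x| ≤ F)
    (x : Fin d → ℝ) : |(unitCube d).indicator m x| ≤ F := by
  by_cases hx : x ∈ unitCube d
  · rw [Set.indicator_of_mem hx]
    exact hmF x hx
  · rw [Set.indicator_of_notMem hx, abs_zero]
    exact hF0

theorem abs_sub_le_two_mul {f f₀ : (Fin d → ℝ) → ℝ} (hf : ∀ x, |f x| ≤ F)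
    (hf₀ : ∀ x, |f₀ x| ≤ F) (x : Fin d → ℝ) : |f x - f₀ x| ≤ 2 * F := by
  have := abs_sub (f x) (f₀ x)
  linarith [hf x, hf₀ x]

theorem sqErr_nonneg {Ω : Type*} {X : ℕ → Ω → (Fin d → ℝ)} (f₀ f : (Fin d → ℝ) → ℝ) (ω : Ω) :
    0 ≤ sqErr T X f₀ f ω := Finset.sum_nonneg fun _ _ => sq_nonneg _

theorem sqErr_le {Ω : Type*} {X : ℕ → Ω → (Fin d → ℝ)} {f₀ f : (Fin d → ℝ) → ℝ}
    (hf : ∀ x, |f x| ≤ F) (hf₀ : ∀ x, |f₀ x| ≤ F) (ω : Ω) : sqErr T X f₀ f ω ≤ T * (4 * F ^ 2) := by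
  calc sqErr T X f₀ f ω ≤ ∑ _t ∈ Finset.Icc 1 T, 4 * F ^ 2 := by
        refine Finset.sum_le_sum fun t _ => ?_
        have := abs_sub_le_two_mul hf hf₀ (X t ω)
        rw [← sq_abs]
        nlinarith [abs_nonneg (f (X t ω) - f₀ (X t ω))]
    _ = _ := by simp

theorem abs_sqErr_sub_sqErr_le {Ω : Type*} {X : ℕ → Ω → (Fin d → ℝ)}
    {f₀ f f' : (Fin d → ℝ) → ℝ} (hT : T ≠ 0)
    (hf : ∀ x, |f x| ≤ F) (hf' : ∀ x, |f' x| ≤ F) (hf₀ : ∀ x, |f₀ x| ≤ F)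
    (h : ∀ x, |f x - f' x| ≤ 1 / T) (ω : Ω) :
    |sqErr T X f₀ f ω - sqErr T X f₀ f' ω| ≤ 4 * F := by
  have hT' : (T : ℝ) ≠ 0 := by exact_mod_cast hT
  unfold sqErr
  rw [← Finset.sum_sub_distrib]
  calc _ ≤ ∑ t ∈ Finset.Icc 1 T,
        |(f (X t ω) - f₀ (X t ω)) ^ 2 - (f' (X t ω) - f₀ (X t ω)) ^ 2| :=
        Finset.abs_sum_le_sum_abs _ _
    _ ≤ ∑ _t ∈ Finset.Icc 1 T, 2 * (2 * F) * (1 / T) := by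
        refine Finset.sum_le_sum fun t _ => ?_
        refine abs_sq_sub_sq_le (abs_sub_le_two_mul hf hf₀ _) (abs_sub_le_two_mul hf' hf₀ _) ?_
        rw [sub_sub_sub_cancel_right]
        exact h _
    _ = 4 * F := by
        simp only [Finset.sum_const, Nat.card_Icc, nsmul_eq_mul]
        simp only [Nat.add_sub_cancel]
        field_simp
        ring

theorem noiseErr_sub_noiseErr_le {Ω : Type*} {X : ℕ → Ω → (Fin d → ℝ)} {v : ℕ → Ω → ℝ}
    {f₀ e f f' : (Fin d → ℝ) → ℝ} (he : ∀ x, |e x| ≤ Cη)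
    (h : ∀ x, |f x - f' x| ≤ 1 / T) (ω : Ω) :
    noiseErr T X v f₀ e f ω - noiseErr T X v f₀ e f' ω ≤
      ∑ t ∈ Finset.Icc 1 T, Cη / T * |v t ω| := by
  unfold noiseErr
  rw [← Finset.sum_sub_distrib]
  refine Finset.sum_le_sum fun t _ => ?_
  have hC : 0 ≤ Cη := (abs_nonneg _).trans (he 0)
  calc _ = e (X t ω) * v t ω * (f (X t ω) - f' (X t ω)) := by ring
    _ ≤ |e (X t ω) * v t ω * (f (X t ω) - f' (X t ω))| := le_abs_self _
    _ ≤ Cη * |v t ω| * (1 / T) := by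
        rw [abs_mul, abs_mul]
        gcongr
        · exact he _
        · exact h _
    _ = _ := by ring

theorem abs_noiseErr_le {Ω : Type*} {X : ℕ → Ω → (Fin d → ℝ)} {v : ℕ → Ω → ℝ}
    {f₀ e f : (Fin d → ℝ) → ℝ} (he : ∀ x, |e x| ≤ Cη) (hf : ∀ x, |f x| ≤ F)
    (hf₀ : ∀ x, |f₀ x| ≤ F) (ω : Ω) :
    |noiseErr T X v f₀ e f ω| ≤ ∑ t ∈ Finset.Icc 1 T, Cη * (2 * F) * |v t ω| := by
  refine (Finset.abs_sum_le_sum_abs _ _).trans (Finset.sum_le_sum fun t _ => ?_)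
  have hC : 0 ≤ Cη := (abs_nonneg _).trans (he 0)
  rw [abs_mul, abs_mul]
  calc _ ≤ Cη * |v t ω| * (2 * F) := by
        gcongr
        · exact he _
        · exact abs_sub_le_two_mul hf hf₀ _
    _ = _ := by ring

theorem integrable_sqErr (hX : ∀ t ∈ Set.Icc 1 T, Measurable (X t)) {f₀ : (Fin d → ℝ) → ℝ}
    (hf₀m : Measurable f₀) (hfm : Measurable fun p : Ω × (Fin d → ℝ) => fhat p.1 p.2)
    (hf : ∀ ω x, |fhat ω x| ≤ F) (hf₀ : ∀ x, |f₀ x| ≤ F) :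
    Integrable (fun ω => sqErr T X f₀ (fhat ω) ω) P := by
  refine Integrable.of_bound (Measurable.aestronglyMeasurable ?_) (T * (4 * F ^ 2))
    (ae_of_all _ fun ω => ?_)
  · refine Finset.measurable_sum _ fun t ht => ?_
    have ht' := hX t (by simpa using ht)
    exact ((hfm.comp (measurable_id.prodMk ht')).sub (hf₀m.comp ht')).pow_const 2
  · rw [Real.norm_of_nonneg (sqErr_nonneg _ _ _)]
    exact sqErr_le (hf ω) hf₀ ω

theorem integrable_sqErr_prod (hX : ∀ t ∈ Set.Icc 1 T, Measurable (X t)) {f₀ : (Fin d → ℝ) → ℝ}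
    (hf₀m : Measurable f₀) (hfm : Measurable fun p : Ω × (Fin d → ℝ) => fhat p.1 p.2)
    (hf : ∀ ω x, |fhat ω x| ≤ F) (hf₀ : ∀ x, |f₀ x| ≤ F) :
    Integrable (fun p : Ω × Ω => sqErr T X f₀ (fhat p.1) p.2) (P.prod P) := by
  refine Integrable.of_bound (Measurable.aestronglyMeasurable ?_) (T * (4 * F ^ 2))
    (ae_of_all _ fun ω => ?_)
  · refine Finset.measurable_sum _ fun t ht => ?_
    have ht' : Measurable fun p : Ω × Ω => X t p.2 := (hX t (by simpa using ht)).comp measurable_snd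
    exact ((hfm.comp (measurable_fst.prodMk ht')).sub (hf₀m.comp ht')).pow_const 2
  · rw [Real.norm_of_nonneg (sqErr_nonneg _ _ _)]
    exact sqErr_le (hf ω.1) hf₀ ω.2

theorem mul_genError_eq (hT : T ≠ 0) (hX : ∀ t ∈ Set.Icc 1 T, Measurable (X t))
    {f₀ : (Fin d → ℝ) → ℝ}
    (hf₀m : Measurable f₀) (hfm : Measurable fun p : Ω × (Fin d → ℝ) => fhat p.1 p.2)
    (hf : ∀ ω x, |fhat ω x| ≤ F) (hf₀ : ∀ x, |f₀ x| ≤ F) :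
    T * genError P T X fhat f₀ = ∫ ω, ∫ ω', sqErr T X f₀ (fhat ω) ω' ∂P ∂P := by
  have hT' : (T : ℝ) ≠ 0 := by exact_mod_cast hT
  rw [← integral_prod (fun p : Ω × Ω => sqErr T X f₀ (fhat p.1) p.2)
    (integrable_sqErr_prod hX hf₀m hfm hf hf₀), genError, integral_const_mul, ← mul_assoc,
    mul_one_div_cancel hT', one_mul]
  rfl

theorem integrable_noiseErr {P : Measure Ω} (h : RegressionModel P 𝒢 T X v Y m η Cη C₁ C₂ K)
    {f₀ : (Fin d → ℝ) → ℝ} (hf₀m : Measurable f₀)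
    (hfm : Measurable fun p : Ω × (Fin d → ℝ) => fhat p.1 p.2)
    (hf : ∀ ω x, |fhat ω x| ≤ F) (hf₀ : ∀ x, |f₀ x| ≤ F) :
    Integrable (fun ω => noiseErr T X v f₀ ((unitCube d).indicator η) (fhat ω) ω) P := by
  have hb : Integrable (fun ω => ∑ t ∈ Finset.Icc 1 T, Cη * (2 * F) * |v t ω|) P :=
    integrable_finsetSum _ fun t ht => (h.integrable_v (by simpa using ht)).abs.const_mul _
  refine hb.mono' (Measurable.aestronglyMeasurable ?_) (ae_of_all _ fun ω => ?_)
  · refine Finset.measurable_sum _ fun t ht => ?_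
    have ht₀ : t ∈ Set.Icc 1 T := by simpa using ht
    have ht' := h.measurable_X ht₀
    exact ((h.measurable_indicator_η.comp ht').mul (h.measurable_v ht₀)).mul
      ((hfm.comp (measurable_id.prodMk ht')).sub (hf₀m.comp ht'))
  · exact abs_noiseErr_le h.abs_indicator_η_le (hf ω) hf₀ ω

/-- The optimization gap is genuinely integrable. -/
theorem integrable_optGap (h : RegressionModel P 𝒢 T X v Y m η Cη C₁ C₂ K) (hT : T ≠ 0)
    (hF0 : 0 ≤ F) (hmF : ∀ x ∈ unitCube d, |m x| ≤ F)
    (h𝓕0 : ∀ f ∈ 𝓕, ∀ x ∉ unitCube d, f x = 0) (h𝓕F : ∀ f ∈ 𝓕, ∀ x, |f x| ≤ F)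
    (h𝓕m : ∀ f ∈ 𝓕, Measurable f)
    (hcov : ∀ δ : ℝ, 0 < δ → ∃ A : Finset ((Fin d → ℝ) → ℝ), (A : Set _) ⊆ 𝓕 ∧
      ∀ f ∈ 𝓕, ∃ f' ∈ A, ∀ x, |f x - f' x| ≤ δ)
    (hfm : Measurable fun p : Ω × (Fin d → ℝ) => fhat p.1 p.2) (hf : ∀ ω, fhat ω ∈ 𝓕) :
    Integrable (fun ω => empRisk T X Y (fhat ω) ω - ⨅ f : 𝓕, empRisk T X Y f ω) P := by
  have hT' : (0 : ℝ) < T := by exact_mod_cast Nat.pos_of_ne_zero hT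
  have hne : Nonempty 𝓕 := by
    have := (inferInstance : IsProbabilityMeasure P).neZero
    obtain ⟨ω⟩ : Nonempty Ω := Measure.nonempty_of_neZero P
    exact ⟨⟨fhat ω, hf ω⟩⟩
  -- The dominating function: the squared error of `fhat` and four bounds for a noise term, uniform
  -- over the comparison function.
  set b : Ω → ℝ := fun ω => (T * (4 * F ^ 2) +
    4 * ∑ t ∈ Finset.Icc 1 T, Cη * (2 * F) * |v t ω|) / T with hb
  have hbi : Integrable b P :=
    ((integrable_const _).add ((integrable_finsetSum _ fun t ht =>
      (h.integrable_v (by simpa using ht)).abs.const_mul _).const_mul 4)).div_const _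
  have hf₀ := abs_indicator_le hF0 hmF
  refine hbi.mono' (Measurable.aestronglyMeasurable ?_) (ae_of_all _ fun ω => ?_)
  · refine Measurable.sub ?_ (measurable_iInf_empRisk (fun t ht => h.measurable_X ht)
      (fun t ht => h.measurable_Y ht) (Set.nonempty_coe_sort.1 hne) h𝓕m h𝓕F hcov)
    refine (Finset.measurable_sum _ fun t ht => ?_).const_mul _
    have ht₀ : t ∈ Set.Icc 1 T := by simpa using ht
    exact ((h.measurable_Y ht₀).sub
      (hfm.comp (measurable_id.prodMk (h.measurable_X ht₀)))).pow_const 2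
  · rw [Real.norm_of_nonneg (sub_nonneg.2 (ciInf_le (bddBelow_empRisk 𝓕 ω) ⟨fhat ω, hf ω⟩))]
    have h1 : empRisk T X Y (fhat ω) ω - b ω ≤ ⨅ f : 𝓕, empRisk T X Y f ω := by
      refine le_ciInf fun f => ?_
      have h2 := mul_empRisk_sub_empRisk (X := X) (Y := Y) hT h.model (h𝓕0 _ (hf ω))
        (h𝓕0 f f.2) ω
      have h3 := sqErr_le (T := T) (X := X) (h𝓕F _ (hf ω)) hf₀ ω
      have h4 := sqErr_nonneg (T := T) (X := X) ((unitCube d).indicator m) f ω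
      have h5 := (abs_le.1 (abs_noiseErr_le (T := T) (X := X) (v := v) h.abs_indicator_η_le
        (h𝓕F _ (hf ω)) hf₀ ω)).1
      have h6 := (abs_le.1 (abs_noiseErr_le (T := T) (X := X) (v := v) h.abs_indicator_η_le
        (h𝓕F _ f.2) hf₀ ω)).2
      unfold noiseErr at h5 h6
      unfold sqErr at h3 h4
      have h7 : empRisk T X Y (fhat ω) ω - empRisk T X Y f ω ≤ b ω := by
        rw [hb]
        simp only
        rw [le_div_iff₀ hT', mul_comm, h2]
        linarith
      linarith
    linarith

/-- The oracle inequality in terms of the cardinality of a finite cover of the class. -/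
theorem genError_le_of_cover (h : RegressionModel P 𝒢 T X v Y m η Cη C₁ C₂ K) (hT : T ≠ 0)
    (hF1 : 1 ≤ F) (hmF : ∀ x ∈ unitCube d, |m x| ≤ F)
    (h𝓕0 : ∀ f ∈ 𝓕, ∀ x ∉ unitCube d, f x = 0) (h𝓕F : ∀ f ∈ 𝓕, ∀ x, |f x| ≤ F)
    (h𝓕m : ∀ f ∈ 𝓕, Measurable f)
    (hcov : ∀ δ : ℝ, 0 < δ → ∃ A : Finset ((Fin d → ℝ) → ℝ), (A : Set _) ⊆ 𝓕 ∧
      ∀ f ∈ 𝓕, ∃ f' ∈ A, ∀ x, |f x - f' x| ≤ δ)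
    {A : Finset ((Fin d → ℝ) → ℝ)} (hA𝓕 : (A : Set _) ⊆ 𝓕)
    (hA : ∀ f ∈ 𝓕, ∃ f' ∈ A, ∀ x, |f x - f' x| ≤ 1 / T)
    (hfm : Measurable fun p : Ω × (Fin d → ℝ) => fhat p.1 p.2) (hfhat : ∀ ω, fhat ω ∈ 𝓕)
    {b : ℕ} (hb : 1 ≤ b) {β : ℝ} (hβ0 : 0 ≤ β) (hβ : betaMixing P T X (b + 1) ≤ β)
    {x : ℝ} (hx0 : 0 < x) (hx1 : x ≤ 1) {lam : ℝ} (hlam : 0 < lam)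
    (hlam1 : 2 * lam * (K ^ 2 * Cη ^ 2) ≤ x) (hlam2 : lam * (Cη * (2 * F)) * K ≤ 1)
    {f : (Fin d → ℝ) → ℝ} (hf : f ∈ 𝓕) :
    (1 - x) ^ 2 * (T * genError P T X fhat ((unitCube d).indicator m)) ≤
      T * optGap P T X Y 𝓕 fhat +
      T * genError P T X (fun _ => f) ((unitCube d).indicator m) +
      (2 / lam * Real.log (1 + A.card) + 12 * F + 2 * Cη + 1 +
        4 * F ^ 2 * b / x * (2 * ((1 + 2 * T * β) * Real.log (1 + A.card) + 2 * T ^ 2 * β))) := by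
  have hT' : (0 : ℝ) < T := by exact_mod_cast Nat.pos_of_ne_zero hT
  have hF0 : 0 ≤ F := by linarith
  have hCη := h.Cη_nonneg
  set f₀ := (unitCube d).indicator m with hf₀def
  set e := (unitCube d).indicator η with hedef
  have hf₀ : ∀ x, |f₀ x| ≤ F := abs_indicator_le hF0 hmF
  have hf₀m : Measurable f₀ := h.measurable_indicator_m
  have he : ∀ x, |e x| ≤ Cη := h.abs_indicator_η_le
  have hXm : ∀ t ∈ Set.Icc 1 T, Measurable (X t) := fun t ht => h.measurable_X ht
  have hfF : ∀ ω x, |fhat ω x| ≤ F := fun ω => h𝓕F _ (hfhat ω)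
  have hgm : ∀ j : A, Measurable fun y => j.1 y - f₀ y :=
    fun j => (h𝓕m _ (hA𝓕 j.2)).sub hf₀m
  have hg : ∀ (j : A) y, |j.1 y - f₀ y| ≤ 2 * F := fun j y =>
    abs_sub_le_two_mul (h𝓕F _ (hA𝓕 j.2)) hf₀ y
  have hcard : Fintype.card A = A.card := Fintype.card_coe A
  obtain ⟨Z₁, hZ₁i, hZ₁, hZ₁le⟩ := exists_integral_le_of_betaMixing P hb hXm hβ0 hβ
    (fun (j : A) y => (j.1 y - f₀ y) ^ 2) (fun j => (hgm j).pow_const 2)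
    (fun j y => sq_nonneg _) (M := 4 * F ^ 2) (by positivity) (fun j y => by
      rw [← sq_abs]
      nlinarith [hg j y, abs_nonneg (j.1 y - f₀ y)]) hx0 hx1 (δ := 1 / T) (by positivity)
  obtain ⟨κ, hκ⟩ := h.subGaussian
  obtain ⟨Z₂, hZ₂i, hZ₂, hZ₂le⟩ := exists_integral_le_of_subGaussian P 𝒢 (ι := A) (v := v)
    (a := fun j t ω => lam * (e (X t ω) * (j.1 (X t ω) - f₀ (X t ω)))) (κ := κ) T
    (fun t ht => (hκ t ht).1) h.adapted
    (fun j t ht => ((h.measurable_indicator_η.comp (h.predictable t ht)).mul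
      ((hgm j).comp (h.predictable t ht))).const_mul lam)
    (fun j t ht ω => by
      have hκt := hκ t ht
      rw [abs_mul, abs_mul, abs_of_pos hlam]
      calc _ ≤ lam * (Cη * (2 * F)) * K := by
            gcongr
            · exact hκt.1.le
            · exact he _
            · exact hg j _
            · exact hκt.2.1
        _ ≤ 1 := hlam2)
    (fun t ht => (hκ t ht).2.2.1) (fun t ht => (hκ t ht).2.2.2) h.centred
  rw [hcard] at hZ₁ hZ₂
  set LN := Real.log (1 + (A.card : ℝ)) with hLN
  set W := ∑ t ∈ Finset.Icc 1 T, Cη / T * ∫ ω, |v t ω| ∂P with hW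
  have hWle : W ≤ Cη := by
    calc W ≤ ∑ _t ∈ Finset.Icc 1 T, Cη / T * 1 := by
          refine Finset.sum_le_sum fun t ht => ?_
          exact mul_le_mul_of_nonneg_left (h.integral_abs_v_le (by simpa using ht)) (by positivity)
      _ = Cη := by
          simp only [Finset.sum_const, Nat.card_Icc, nsmul_eq_mul, Nat.add_sub_cancel]
          field_simp
  have hvi : Integrable (fun ω => ∑ t ∈ Finset.Icc 1 T, Cη / T * |v t ω|) P :=
    integrable_finsetSum _ fun t ht => (h.integrable_v (by simpa using ht)).abs.const_mul _
  have hvint : ∫ ω, ∑ t ∈ Finset.Icc 1 T, Cη / T * |v t ω| ∂P = W := by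
    rw [integral_finsetSum _ fun t ht =>
      (h.integrable_v (by simpa using ht)).abs.const_mul _]
    exact Finset.sum_congr rfl fun t _ => integral_const_mul _ _
  -- pointwise inequalities
  have hR : ∀ ω, (1 - x) * ∫ ω', sqErr T X f₀ (fhat ω) ω' ∂P ≤
      sqErr T X f₀ (fhat ω) ω + Z₁ ω + (1 + 8 * F) := by
    intro ω
    obtain ⟨f', hf', hff⟩ := hA _ (hfhat ω)
    have h1 := hZ₁le ⟨f', hf'⟩ ω
    have hi' : ∀ g ∈ 𝓕, Integrable (fun ω' => sqErr T X f₀ g ω') P := fun g hg' =>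
      integrable_sqErr (fhat := fun _ => g) hXm hf₀m ((h𝓕m g hg').comp measurable_snd)
        (fun _ => h𝓕F g hg') hf₀
    have h2 : ∫ ω', sqErr T X f₀ (fhat ω) ω' ∂P ≤ ∫ ω', sqErr T X f₀ f' ω' ∂P + 4 * F := by
      calc _ ≤ ∫ ω', (sqErr T X f₀ f' ω' + 4 * F) ∂P := by
            refine integral_mono (hi' _ (hfhat ω))
              ((hi' _ (hA𝓕 hf')).add (integrable_const _)) fun ω' => ?_
            have := (abs_le.1 (abs_sqErr_sub_sqErr_le (X := X) hT (hfF ω) (h𝓕F _ (hA𝓕 hf'))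
              hf₀ hff ω')).2
            simp only
            linarith
        _ = _ := by
            rw [integral_add (hi' _ (hA𝓕 hf')) (integrable_const _)]
            simp
    have h3 : ∫ ω', sqErr T X f₀ f' ω' ∂P =
        ∑ t ∈ Finset.Icc 1 T, ∫ ω', (f' (X t ω') - f₀ (X t ω')) ^ 2 ∂P := by
      refine integral_finsetSum _ fun t ht => ?_
      have ht' := hXm t (by simpa using ht)
      refine Integrable.of_bound (((hgm ⟨f', hf'⟩).comp ht').pow_const 2).aestronglyMeasurable
        (4 * F ^ 2) (ae_of_all _ fun ω => ?_)
      rw [Real.norm_of_nonneg (sq_nonneg _), ← sq_abs]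
      nlinarith [hg ⟨f', hf'⟩ (X t ω), abs_nonneg (f' (X t ω) - f₀ (X t ω))]
    have h4 := (abs_le.1 (abs_sqErr_sub_sqErr_le (X := X) hT (hfF ω) (h𝓕F _ (hA𝓕 hf'))
              hf₀ hff ω)).1
    have h5 := mul_le_mul_of_nonneg_left h2 (by linarith : 0 ≤ 1 - x)
    have h6 : 0 ≤ x * (4 * F) := by positivity
    have h7 : (T : ℝ) * (1 / T) = 1 := mul_one_div_cancel hT'.ne'
    rw [h7, ← h3] at h1
    change _ ≤ sqErr T X f₀ f' ω + Z₁ ω + 1 at h1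
    linarith
  -- The compensator is bounded by λ² K² Cη² times the squared error of the cover element, which is
  -- then exchanged for that of `fhat`.
  have hV : ∀ ω, lam * noiseErr T X v f₀ e (fhat ω) ω ≤
      Z₂ ω + lam ^ 2 * (K ^ 2 * Cη ^ 2) * (sqErr T X f₀ (fhat ω) ω + 4 * F) +
        lam * ∑ t ∈ Finset.Icc 1 T, Cη / T * |v t ω| := by
    intro ω
    obtain ⟨f', hf', hff⟩ := hA _ (hfhat ω)
    have h1 := hZ₂le ⟨f', hf'⟩ ω
    have h2 := noiseErr_sub_noiseErr_le (X := X) (v := v) (f₀ := f₀) he hff ω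
    have h3 : lam * noiseErr T X v f₀ e f' ω - lam ^ 2 * (K ^ 2 * Cη ^ 2) * sqErr T X f₀ f' ω ≤
        Z₂ ω := by
      refine le_trans ?_ h1
      unfold noiseErr sqErr
      rw [Finset.mul_sum, Finset.mul_sum, ← Finset.sum_sub_distrib]
      refine Finset.sum_le_sum fun t ht => ?_
      have hκt := hκ t (by simpa using ht)
      have e1 : κ t ^ 2 * e (X t ω) ^ 2 ≤ K ^ 2 * Cη ^ 2 := by
        have e2 : e (X t ω) ^ 2 ≤ Cη ^ 2 := sq_le_sq.2 (by rw [abs_of_nonneg hCη]; exact he _)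
        have e3 : κ t ^ 2 ≤ K ^ 2 := pow_le_pow_left₀ hκt.1.le hκt.2.1 2
        exact mul_le_mul e3 e2 (sq_nonneg _) (sq_nonneg _)
      have e4 := mul_le_mul_of_nonneg_right e1
        (by positivity : 0 ≤ lam ^ 2 * (f' (X t ω) - f₀ (X t ω)) ^ 2)
      simp only
      linarith
    have h4 := (abs_le.1 (abs_sqErr_sub_sqErr_le (X := X) hT (hfF ω) (h𝓕F _ (hA𝓕 hf'))
              hf₀ hff ω)).1
    have h5 := mul_le_mul_of_nonneg_left (show sqErr T X f₀ f' ω ≤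
      sqErr T X f₀ (fhat ω) ω + 4 * F by linarith)
      (by positivity : 0 ≤ lam ^ 2 * (K ^ 2 * Cη ^ 2))
    have h6 := mul_le_mul_of_nonneg_left h2 hlam.le
    linarith
  have hD : ∀ ω, sqErr T X f₀ (fhat ω) ω - sqErr T X f₀ f ω -
      2 * noiseErr T X v f₀ e (fhat ω) ω + 2 * noiseErr T X v f₀ e f ω ≤
      T * (empRisk T X Y (fhat ω) ω - ⨅ f : 𝓕, empRisk T X Y f ω) := by
    intro ω
    have h1 := mul_empRisk_sub_empRisk (X := X) (Y := Y) hT h.model (h𝓕0 _ (hfhat ω))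
      (h𝓕0 f hf) ω
    have h2 : (⨅ f : 𝓕, empRisk T X Y f ω) ≤ empRisk T X Y f ω :=
      ciInf_le (bddBelow_empRisk 𝓕 ω) ⟨f, hf⟩
    have h3 := mul_le_mul_of_nonneg_left
      (sub_le_sub_left h2 (empRisk T X Y (fhat ω) ω)) hT'.le
    exact h1.symm.le.trans h3
  -- integration
  have iS : Integrable (fun ω => sqErr T X f₀ (fhat ω) ω) P :=
    integrable_sqErr hXm hf₀m hfm hfF hf₀
  have hfm' : Measurable fun p : Ω × (Fin d → ℝ) => f p.2 := (h𝓕m f hf).comp measurable_snd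
  have iSf : Integrable (fun ω => sqErr T X f₀ f ω) P :=
    integrable_sqErr (fhat := fun _ => f) hXm hf₀m hfm' (fun _ => h𝓕F f hf) hf₀
  have iV : Integrable (fun ω => noiseErr T X v f₀ e (fhat ω) ω) P :=
    integrable_noiseErr h hf₀m hfm hfF hf₀
  have iVf : Integrable (fun ω => noiseErr T X v f₀ e f ω) P :=
    integrable_noiseErr (fhat := fun _ => f) h hf₀m hfm' (fun _ => h𝓕F f hf) hf₀
  have iR : Integrable (fun ω => ∫ ω', sqErr T X f₀ (fhat ω) ω' ∂P) P :=
    (integrable_sqErr_prod hXm hf₀m hfm hfF hf₀).integral_prod_left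
  -- Without integrability the optimization gap would be 0 by convention and could not dominate the
  -- integrated left-hand side.
  have iD := integrable_optGap h hT hF0 hmF h𝓕0 h𝓕F h𝓕m hcov hfm hfhat
  set a := ∫ ω, sqErr T X f₀ (fhat ω) ω ∂P with ha
  have I1 : (1 - x) * (T * genError P T X fhat f₀) ≤ a + ∫ ω, Z₁ ω ∂P + (1 + 8 * F) := by
    rw [mul_genError_eq hT hXm hf₀m hfm hfF hf₀, ← integral_const_mul]
    have i1 : Integrable (fun ω => sqErr T X f₀ (fhat ω) ω + Z₁ ω) P := iS.add hZ₁i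
    calc _ ≤ ∫ ω, (sqErr T X f₀ (fhat ω) ω + Z₁ ω + (1 + 8 * F)) ∂P :=
          integral_mono (iR.const_mul _) (i1.add (integrable_const _)) hR
      _ = _ := by
          rw [integral_add i1 (integrable_const _), integral_add iS hZ₁i]
          simp [ha]
  have I2 : lam * ∫ ω, noiseErr T X v f₀ e (fhat ω) ω ∂P ≤
      ∫ ω, Z₂ ω ∂P + lam ^ 2 * (K ^ 2 * Cη ^ 2) * (a + 4 * F) + lam * W := by
    rw [← integral_const_mul]
    have i1 : Integrable (fun ω => sqErr T X f₀ (fhat ω) ω + 4 * F) P :=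
      iS.add (integrable_const _)
    have i2 : Integrable (fun ω => Z₂ ω +
        lam ^ 2 * (K ^ 2 * Cη ^ 2) * (sqErr T X f₀ (fhat ω) ω + 4 * F)) P :=
      hZ₂i.add (i1.const_mul _)
    calc _ ≤ ∫ ω, (Z₂ ω + lam ^ 2 * (K ^ 2 * Cη ^ 2) * (sqErr T X f₀ (fhat ω) ω + 4 * F) +
          lam * ∑ t ∈ Finset.Icc 1 T, Cη / T * |v t ω|) ∂P :=
          integral_mono (iV.const_mul _) (i2.add (hvi.const_mul _)) hV
      _ = _ := by
          rw [integral_add i2 (hvi.const_mul _), integral_add hZ₂i (i1.const_mul _),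
            integral_const_mul, integral_const_mul, integral_add iS (integrable_const _), hvint]
          simp [ha]
  have I3 : ∫ ω, noiseErr T X v f₀ e f ω ∂P = 0 := by
    unfold noiseErr
    have hfg : Measurable fun y => f y - f₀ y := (h𝓕m f hf).sub hf₀m
    rw [integral_finsetSum]
    · exact Finset.sum_eq_zero fun t ht => h.integral_noise_mul_eq_zero
        (g := fun y => f y - f₀ y) hfg (abs_sub_le_two_mul (h𝓕F f hf) hf₀) (by simpa using ht)
    · intro t ht
      have ht' : t ∈ Set.Icc 1 T := by simpa using ht
      have hXt := hXm t ht'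
      refine ((h.integrable_v ht').abs.const_mul (Cη * (2 * F))).mono'
        (((h.measurable_indicator_η.comp hXt).mul (h.measurable_v ht')).mul
          (hfg.comp hXt)).aestronglyMeasurable (ae_of_all _ fun ω => ?_)
      rw [Real.norm_eq_abs, abs_mul, abs_mul]
      calc _ ≤ Cη * |v t ω| * (2 * F) := by
            gcongr
            · exact he _
            · exact abs_sub_le_two_mul (h𝓕F f hf) hf₀ _
        _ = _ := by ring
  have I4 : ∫ ω, sqErr T X f₀ f ω ∂P = T * genError P T X (fun _ => f) f₀ := by
    rw [mul_genError_eq (fhat := fun _ => f) hT hXm hf₀m hfm' (fun _ => h𝓕F f hf) hf₀]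
    simp
  have I5 : a - T * genError P T X (fun _ => f) f₀ -
      2 * ∫ ω, noiseErr T X v f₀ e (fhat ω) ω ∂P ≤ T * optGap P T X Y 𝓕 fhat := by
    rw [optGap, ← integral_const_mul (T : ℝ)]
    have i1 : Integrable (fun ω => sqErr T X f₀ (fhat ω) ω - sqErr T X f₀ f ω) P := iS.sub iSf
    have i2 : Integrable (fun ω => sqErr T X f₀ (fhat ω) ω - sqErr T X f₀ f ω -
      2 * noiseErr T X v f₀ e (fhat ω) ω) P := i1.sub (iV.const_mul 2)
    refine le_trans (le_of_eq ?_)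
      (integral_mono (i2.add (iVf.const_mul 2)) (iD.const_mul (T : ℝ)) hD)
    simp only [Pi.add_apply]
    rw [integral_add i2 (iVf.const_mul 2), integral_sub i1 (iV.const_mul 2),
      integral_sub iS iSf, integral_const_mul, integral_const_mul, I3, I4]
    ring
  have ha0 : 0 ≤ a := integral_nonneg fun ω => sqErr_nonneg _ _ _
  -- combination
  have J1 : 2 * ∫ ω, noiseErr T X v f₀ e (fhat ω) ω ∂P ≤
      2 / lam * LN + x * (a + 4 * F) + 2 * Cη := by
    have e1 : lam * (2 * ∫ ω, noiseErr T X v f₀ e (fhat ω) ω ∂P) ≤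
        lam * (2 / lam * LN + x * (a + 4 * F) + 2 * Cη) := by
      have e2 : lam * (2 / lam * LN) = 2 * LN := by field_simp
      have e3 := mul_le_mul_of_nonneg_right hlam1 (by positivity : 0 ≤ lam * (a + 4 * F))
      have e4 := mul_le_mul_of_nonneg_left hWle hlam.le
      rw [mul_add, mul_add, e2]
      linarith
    exact le_of_mul_le_mul_left e1 hlam
  -- The second factor 1 - x turns a into a - x a, which absorbs the term x a from the noise bound.
  have J2 := mul_le_mul_of_nonneg_left I1 (by linarith : 0 ≤ 1 - x)
  have hLN0 : 0 ≤ LN := Real.log_nonneg (by linarith [(Nat.cast_nonneg A.card : (0 : ℝ) ≤ A.card)])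
  set W₁ := 4 * F ^ 2 * b / x * (2 * ((1 + 2 * T * β) * LN + 2 * T ^ 2 * β)) with hW₁
  have hW₁0 : 0 ≤ W₁ := by positivity
  have J3 : (1 - x) * ∫ ω, Z₁ ω ∂P ≤ W₁ := by
    have := mul_le_mul_of_nonneg_left hZ₁ (by linarith : 0 ≤ 1 - x)
    nlinarith
  have J4 : x * (4 * F) ≤ 4 * F := mul_le_of_le_one_left (by positivity) hx1
  have J5 : (1 - x) * (1 + 8 * F) ≤ 1 + 8 * F :=
    mul_le_of_le_one_left (by positivity) (by linarith)
  have J6 : (1 - x) ^ 2 * (T * genError P T X fhat f₀) =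
      (1 - x) * ((1 - x) * (T * genError P T X fhat f₀)) := by ring
  rw [J6]
  linarith

end Oracle

/-! ### Choice of constants and conclusion -/

theorem oracle_remainder_le {x q F LN C₀ Λ ℓ Cη k c T β : ℝ} {b : ℕ} (hx : 0 < x) (hq : 0 ≤ q)
    (hF : 1 ≤ F) (hLN0 : 0 ≤ LN) (hLN : LN ≤ C₀ * Λ) (hΛ : 1 ≤ Λ) (hℓ : 1 ≤ ℓ) (hCη : 0 ≤ Cη)
    (hb : b ≤ k * ℓ) (hc : 0 ≤ c) (hTβ : T * β ≤ c) (hTβ' : T ^ 2 * β ≤ c)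
    (hC₀ : 0 ≤ C₀) :
    2 * q * F / x * LN + 12 * F + 2 * Cη + 1 +
        4 * F ^ 2 * b / x * (2 * ((1 + 2 * T * β) * LN + 2 * T ^ 2 * β)) ≤
      (2 * q * C₀ / x + 13 + 2 * Cη + 8 * k / x * ((1 + 2 * c) * C₀ + 2 * c)) *
        (F ^ 2 * (Λ * ℓ)) := by
  -- Since F, Λ and ℓ are at least 1, every term is dominated by a multiple of F² Λ ℓ. The factor ℓ
  -- comes from the block length, F² from the bound on squared errors.
  have hF2 : F ≤ F ^ 2 := by nlinarith
  have hΛℓ : 1 ≤ Λ * ℓ := one_le_mul_of_one_le_of_one_le hΛ hℓ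
  have hΛ' : Λ ≤ Λ * ℓ := le_mul_of_one_le_right (by linarith) hℓ
  have hP : F ^ 2 ≤ F ^ 2 * (Λ * ℓ) := le_mul_of_one_le_right (by positivity) hΛℓ
  set p := F ^ 2 * (Λ * ℓ) with hp
  have hp1 : 1 ≤ p := by linarith
  have e1 : 2 * q * F / x * LN ≤ 2 * q * C₀ / x * p := by
    calc 2 * q * F / x * LN ≤ 2 * q * F ^ 2 / x * (C₀ * (Λ * ℓ)) := by
          have : LN ≤ C₀ * (Λ * ℓ) := hLN.trans (by gcongr)
          gcongr
      _ = _ := by rw [hp]; ring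
  have e2 : 2 * Cη ≤ 2 * Cη * p := le_mul_of_one_le_right (by positivity) hp1
  have e3 : (1 + 2 * T * β) * LN + 2 * T ^ 2 * β ≤ ((1 + 2 * c) * C₀ + 2 * c) * Λ := by
    have h1 : (1 + 2 * T * β) * LN ≤ (1 + 2 * c) * (C₀ * Λ) := by
      calc _ ≤ (1 + 2 * c) * LN := mul_le_mul_of_nonneg_right (by linarith) hLN0
        _ ≤ _ := by gcongr
    have h2 : 2 * c ≤ 2 * c * Λ := le_mul_of_one_le_right (by positivity) hΛ
    linarith
  have e4 : 4 * F ^ 2 * b / x * (2 * ((1 + 2 * T * β) * LN + 2 * T ^ 2 * β)) ≤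
      8 * k / x * ((1 + 2 * c) * C₀ + 2 * c) * p := by
    calc _ ≤ 4 * F ^ 2 * b / x * (2 * (((1 + 2 * c) * C₀ + 2 * c) * Λ)) := by gcongr
      _ ≤ 4 * F ^ 2 * (k * ℓ) / x * (2 * (((1 + 2 * c) * C₀ + 2 * c) * Λ)) := by gcongr
      _ = _ := by rw [hp]; ring
  linarith

/-- The scale λ is of order x/F. The first summand of the denominator lets the compensator be
absorbed into x a, the second keeps the exponents in the sub-Gaussian range, and the 1 keeps it
positive. -/
theorem noise_scale_bounds {x K Cη F : ℝ} (hx0 : 0 < x) (hx1 : x ≤ 1) (hF : 1 ≤ F) :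
    0 < x / ((2 * (K ^ 2 * Cη ^ 2) + 2 * |Cη * K| + 1) * F) ∧
    2 * (x / ((2 * (K ^ 2 * Cη ^ 2) + 2 * |Cη * K| + 1) * F)) * (K ^ 2 * Cη ^ 2) ≤ x ∧
    x / ((2 * (K ^ 2 * Cη ^ 2) + 2 * |Cη * K| + 1) * F) * (Cη * (2 * F)) * K ≤ 1 ∧
    2 / (x / ((2 * (K ^ 2 * Cη ^ 2) + 2 * |Cη * K| + 1) * F)) =
      2 * (2 * (K ^ 2 * Cη ^ 2) + 2 * |Cη * K| + 1) * F / x := by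
  set c := K ^ 2 * Cη ^ 2
  have hc : 0 ≤ c := by positivity
  have ha := abs_nonneg (Cη * K)
  have ha' := le_abs_self (Cη * K)
  set q := 2 * c + 2 * |Cη * K| + 1 with hq
  have hq1 : 1 ≤ q := by linarith
  have hqF : 0 < q * F := by positivity
  refine ⟨by positivity, ?_, ?_, by field_simp⟩
  · rw [mul_div_assoc', div_mul_eq_mul_div, div_le_iff₀ hqF]
    have h1 : 2 * c ≤ q * F :=
      (show 2 * c ≤ q by linarith).trans (le_mul_of_one_le_right (by linarith) hF)
    linarith [mul_le_mul_of_nonneg_left h1 hx0.le]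
  · have h1 : x / (q * F) * (Cη * (2 * F)) * K = x * (2 * (Cη * K)) / q := by
      field_simp
    rw [h1, div_le_one (by linarith)]
    have h3 := mul_le_mul_of_nonneg_left (show 2 * (Cη * K) ≤ q by linarith) hx0.le
    exact h3.trans (mul_le_of_le_one_left (by linarith) hx1)

/-- Blocks of length at least 2 log T / C₂ bring the mixing coefficient down to order T^(-2), which
offsets the factor T² in the decoupling cost: up to T blocks, times a bound of order T on the
logarithm. -/
theorem betaMixing_rate_le {C₁ C₂ T : ℝ} {b : ℕ} (hC₂ : 0 < C₂) (hT : 0 < T)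
    (hb : 2 * Real.log T / C₂ ≤ b) :
    C₁ * Real.exp (-C₂ * ((b + 1 : ℕ) : ℝ)) ≤ |C₁| / T ^ 2 := by
  rw [div_le_iff₀ hC₂] at hb
  have h2 : Real.exp (-C₂ * ((b + 1 : ℕ) : ℝ)) ≤ 1 / T ^ 2 := by
    have h3 : 1 / T ^ 2 = Real.exp (-(2 * Real.log T)) := by
      rw [Real.exp_neg, two_mul, Real.exp_add, Real.exp_log hT]
      ring
    rw [h3, Real.exp_le_exp]
    push_cast
    linarith
  calc C₁ * Real.exp (-C₂ * ((b + 1 : ℕ) : ℝ)) ≤ |C₁| * (1 / T ^ 2) := by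
        gcongr
        exact le_abs_self _
    _ = _ := by ring

theorem le_of_scaled_oracle_inequality {ρ x T R G E F Λ ℓ p : ℝ} (hT : 0 < T) (hρ : 0 < ρ)
    (hρx : 1 ≤ ρ * (1 - x) ^ 2) (hR : 0 ≤ R)
    (h : (1 - x) ^ 2 * (T * R) ≤ T * G + T * p + E * (F ^ 2 * (Λ * ℓ))) :
    R ≤ ρ * (G + p) + ρ * E * F ^ 2 * (Λ * ℓ / T) := by
  have h1 := mul_le_mul_of_nonneg_right hρx (mul_nonneg hT.le hR)
  have h2 := mul_le_mul_of_nonneg_left h hρ.le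
  refine le_of_mul_le_mul_left ?_ hT
  have h4 : T * (ρ * (G + p) + ρ * E * F ^ 2 * (Λ * ℓ / T)) =
      ρ * (T * G + T * p + E * (F ^ 2 * (Λ * ℓ))) := by
    field_simp
  rw [h4]
  linarith

theorem mainTheorem6 (d : ℕ) (Cσ s₀ : ℝ≥0) (Cη C₁ C₂ K ρ : ℝ) (hC₂ : 0 < C₂) (hρ : 1 < ρ) :
    ∃ Cρ : ℝ, 0 < Cρ ∧
      ∀ (σ : ℝ → ℝ), LipschitzWith Cσ σ → |σ 0| ≤ s₀ →
      ∀ {Ω : Type*} [mΩ : MeasurableSpace Ω] (P : Measure Ω) [IsProbabilityMeasure P]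
        (𝒢 : Filtration ℕ mΩ) (T : ℕ), 3 ≤ T →
      ∀ (X : ℕ → Ω → (Fin d → ℝ)) (v Y : ℕ → Ω → ℝ) (m η : (Fin d → ℝ) → ℝ),
        RegressionModel P 𝒢 T X v Y m η Cη C₁ C₂ K →
      ∀ (L N B F S : ℝ), 0 < L → 0 < N → 1 ≤ B → 1 ≤ F → 0 < S →
        (∀ x ∈ unitCube d, |m x| ≤ F) →
      ∀ (fhat : Ω → (Fin d → ℝ) → ℝ), IsEstimator T X Y fhat →
        (∀ ω, fhat ω ∈ sparseDNNClass d σ L N B F S) →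
        genError P T X fhat ((unitCube d).indicator m) ≤
          ρ * (optGap P T X Y (sparseDNNClass d σ L N B F S) fhat +
              ⨅ f : sparseDNNClass d σ L N B F S,
                genError P T X (fun _ => f) ((unitCube d).indicator m)) +
            Cρ * F ^ 2 *
              (S * (L + 1) * Real.log ((L + 1) * (N + 1) * B * T) * Real.log T / T) := by
  obtain ⟨C₀, hC₀, hcover⟩ := exists_log_card_cover_sparseDNNClass_le d Cσ s₀
  have hρ0 : 0 < ρ := by linarith
  -- With this choice ρ (1 - x)² = (ρ + 1)² / (4 ρ), which is at least 1 because (ρ - 1)² ≥ 0.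
  set x : ℝ := (ρ - 1) / (2 * ρ) with hx
  have hx0 : 0 < x := div_pos (by linarith) (by linarith)
  have hx1 : x ≤ 1 := by
    rw [hx, div_le_one (by linarith)]
    linarith
  have hρx : 1 ≤ ρ * (1 - x) ^ 2 := by
    have h1 : ρ * (1 - x) ^ 2 = (ρ + 1) ^ 2 / (4 * ρ) := by
      rw [hx]
      field_simp
      ring
    rw [h1, le_div_iff₀ (by linarith)]
    nlinarith [sq_nonneg (ρ - 1)]
  -- The constants are fixed before any model is given, so no signs of Cη, K and C₁ are available
  -- yet; hence the absolute values here and in `E`.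
  set q : ℝ := 2 * (K ^ 2 * Cη ^ 2) + 2 * |Cη * K| + 1 with hq
  have hq1 : 1 ≤ q := by
    rw [hq]
    linarith [mul_nonneg (sq_nonneg K) (sq_nonneg Cη), abs_nonneg (Cη * K)]
  set k : ℝ := 2 / C₂ + 1 with hk
  have hk0 : 0 < k := by positivity
  set E : ℝ := 2 * q * C₀ / x + 13 + 2 * |Cη| + 8 * k / x * ((1 + 2 * |C₁|) * C₀ + 2 * |C₁|)
    with hE
  have hE0 : 0 < E := by positivity
  refine ⟨ρ * E, by positivity, ?_⟩
  intro σ hσ hσ0 Ω mΩ P _ 𝒢 T hT X v Y m η h L N B F S hL hN hB hF hS hmF fhat hest hfhat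
  have hT3 : (3 : ℝ) ≤ T := by exact_mod_cast hT
  have hT0 : (0 : ℝ) < T := by linarith
  have hTne : T ≠ 0 := by omega
  have hF0 : 0 ≤ F := by linarith
  have hCη := h.Cη_nonneg
  set 𝓕 := sparseDNNClass d σ L N B F S with h𝓕
  have hgap : 0 ≤ optGap P T X Y 𝓕 fhat := optGap_nonneg hfhat
  have hℓ : 1 ≤ Real.log T := by
    rw [Real.le_log_iff_exp_le hT0]
    linarith [Real.exp_one_lt_d9]
  have hU : 3 ≤ (L + 1) * (N + 1) * B * T := by
    have h1 : 1 ≤ (L + 1) * (N + 1) * B := one_le_mul_of_one_le_of_one_le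
      (one_le_mul_of_one_le_of_one_le (by linarith) (by linarith)) hB
    exact hT3.trans (le_mul_of_one_le_left hT0.le h1)
  have hΛ : 1 ≤ Real.log ((L + 1) * (N + 1) * B * T) := by
    rw [Real.le_log_iff_exp_le (by linarith)]
    linarith [Real.exp_one_lt_d9]
  have hne : Nonempty 𝓕 := by
    have := (inferInstance : IsProbabilityMeasure P).neZero
    obtain ⟨ω⟩ : Nonempty Ω := Measure.nonempty_of_neZero P
    exact ⟨⟨fhat ω, hfhat ω⟩⟩
  suffices hmain : ∀ f ∈ 𝓕, genError P T X fhat ((unitCube d).indicator m) ≤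
      ρ * (optGap P T X Y 𝓕 fhat + genError P T X (fun _ => f) ((unitCube d).indicator m)) +
        ρ * E * F ^ 2 *
          (S * (L + 1) * Real.log ((L + 1) * (N + 1) * B * T) * Real.log T / T) by
    set r := ρ * E * F ^ 2 *
          (S * (L + 1) * Real.log ((L + 1) * (N + 1) * B * T) * Real.log T / T)
    have h1 : (genError P T X fhat ((unitCube d).indicator m) - r) / ρ -
        optGap P T X Y 𝓕 fhat ≤
        ⨅ f : 𝓕, genError P T X (fun _ => f) ((unitCube d).indicator m) := by
      refine le_ciInf fun f => ?_
      have h2 := hmain f f.2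
      rw [sub_le_iff_le_add, div_le_iff₀ hρ0]
      linarith
    rw [sub_le_iff_le_add, div_le_iff₀ hρ0] at h1
    linarith
  intro f hf
  -- For S < 1 the estimator coincides with f, and ρ > 1 together with nonnegativity of the other
  -- terms suffices.
  rcases lt_or_ge S 1 with hS1 | hS1
  · have h1 : fhat = fun _ => f := funext fun ω => by
      rw [sparseDNNClass.eq_zero_of_lt_one hS1 (hfhat ω),
        sparseDNNClass.eq_zero_of_lt_one hS1 hf]
    have h2 : 0 ≤ ρ * E * F ^ 2 *
        (S * (L + 1) * Real.log ((L + 1) * (N + 1) * B * T) * Real.log T / T) := by positivity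
    have h3 := genError_nonneg (P := P) (T := T) (X := X) (fun _ => f) ((unitCube d).indicator m)
    rw [← h1] at h3 ⊢
    have h4 := mul_nonneg hρ0.le hgap
    have h5 := le_mul_of_one_le_left h3 hρ.le
    rw [mul_add]
    linarith
  obtain ⟨A, hA𝓕, hA, hcard⟩ := hcover σ hσ hσ0 L N B F S T hL hN hB hS1 hT
  set Λ := S * (L + 1) * Real.log ((L + 1) * (N + 1) * B * T) with hΛdef
  have hΛ1 : 1 ≤ Λ := one_le_mul_of_one_le_of_one_le
    (one_le_mul_of_one_le_of_one_le hS1 (by linarith)) hΛ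
  set b := ⌈2 * Real.log T / C₂⌉₊ with hb
  have hb1 : 1 ≤ b := Nat.one_le_iff_ne_zero.2 (Nat.ceil_pos.2 (by positivity)).ne'
  have hbk : (b : ℝ) ≤ k * Real.log T := by
    have h1 : (b : ℝ) ≤ 2 * Real.log T / C₂ + 1 := (Nat.ceil_lt_add_one (by positivity)).le
    have h2 : k * Real.log T = 2 * Real.log T / C₂ + Real.log T := by rw [hk]; ring
    linarith
  set β : ℝ := |C₁| / T ^ 2 with hβdef
  have hβ : betaMixing P T X (b + 1) ≤ β :=
    (h.mixing (b + 1) (by omega)).trans (betaMixing_rate_le hC₂ hT0 (Nat.le_ceil _))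
  have hT2β : (T : ℝ) ^ 2 * β ≤ |C₁| := by
    rw [hβdef]
    field_simp
    exact le_rfl
  have hTβ : (T : ℝ) * β ≤ |C₁| := by
    have h1 : (T : ℝ) ≤ T ^ 2 := le_self_pow₀ (by linarith) two_ne_zero
    have h2 : 0 ≤ β := by positivity
    exact (mul_le_mul_of_nonneg_right h1 h2).trans hT2β
  obtain ⟨hlam0, hlam1, hlam2, hlam3⟩ := noise_scale_bounds (K := K) (Cη := Cη) hx0 hx1 hF
  rw [← hq] at hlam0 hlam1 hlam2 hlam3
  have key := genError_le_of_cover h hTne hF hmF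
    (fun f hf x hx => sparseDNNClass.eq_zero_of_notMem hf hx)
    (fun f hf => sparseDNNClass.abs_le hF0 hf)
    (fun f hf => sparseDNNClass.measurable hσ.continuous hf)
    (fun δ hδ => exists_finset_cover_sparseDNNClass hσ hσ0 L N B F S hB hδ)
    hA𝓕 hA (h.measurable_estimator hest) hfhat hb1 (by positivity : 0 ≤ β) hβ hx0 hx1
    (lam := x / (q * F)) hlam0 hlam1 hlam2 hf
  rw [hlam3] at key
  have hrem := oracle_remainder_le (b := b) (T := T) (β := β) hx0 (by linarith : 0 ≤ q) hF
    (Real.log_nonneg (by linarith [(Nat.cast_nonneg A.card : (0 : ℝ) ≤ A.card)])) hcard hΛ1 hℓ hCη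
    hbk (abs_nonneg C₁) hTβ hT2β hC₀.le
  have hE' := hE
  rw [abs_of_nonneg hCη] at hE'
  rw [← hE'] at hrem
  exact le_of_scaled_oracle_inequality hT0 hρ0 hρx (genError_nonneg _ _)
    (key.trans (add_le_add_right hrem _))
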